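/- **Theorem.** Let $1\le k\le n$ be integers, let $t>k$, $q\ge 1$, $\Lambda\in\mathbb R$, $\gamma>0$, $\rho>0$, $C_a,A,K_u,K_v\in\mathbb R$, and let $L\colon\mathbb R\to\mathbb R$ be a function. There is a constant $\varepsilon_0>0$, depending only on $n,k,t,q,\Lambda,\gamma,\rho,C_a,A,K_u,K_v,L$, such that the following holds. For a smoothly embedded submanifold $M\subset\mathbb R^n$ of dimension $n-k$ with normal spaces $N_pM$, and for $\varepsilon>0$, let $B(p,\varepsilon)=\{p+y : y\in N_pM,\ |y|<\varepsilon\}$ and $\mathscr B(M,\varepsilon)=\bigcup_{p\in M}B(p,\varepsilon)$. We say that $M$ admits a normal tube of radius $\varepsilon$ if this union is disjoint and $(p,y)\mapsto p+y$ is a diffeomorphism from $\{(p,y): p\in M,\ y\in N_pM,\ |y|<\varepsilon\}$ onto the open set $\mathscr B(M,\varepsilon)$. Let $M\subset\mathbb R^n$ be a smoothly embedded submanifold of dimension $n-k$ that admits a normal tube of radius $\rho$, let $0<\varepsilon<\varepsilon_0$ be such that $M$ admits a normal tube of radius $\varepsilon$, and let $\Omega\subseteq\mathscr B(M,\varepsilon)$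 be a smooth (possibly unbounded) domain. Let $a\colon\overline\Omega\to[0,\infty)$, $f\colon\Omega\times\mathbb R\to\mathbb R$ and $u,v\in C^1(\Omega)\cap C^0(\overline\Omega)\cap W^{1,\infty}(\Omega)$ with $|u|,|\nabla u|\le K_u$ and $|v|,|\nabla v|\le K_v$ in $\Omega$. Assume: * (A1) $a\in C^0(\overline\Omega)$, $a\le A$ in $\Omega$, and for all $p\in M$, with respect to Lebesgue measure on the $k$-dimensional space $N_pM$ (and with $0^{-t}=+\infty$), $$\int_{\Omega\cap B(p,\varepsilon)}a^{-t}\,dy^1\cdots dy^k\le C_a ;$$ * (A2) for all $m>0$, $z\in\Omega$ and $r,s\in[-m,m]$ we have $|f(z,r)-f(z,s)|\le L(m)\,|r-s|$; * (A3) $M$ has an atlas of smooth charts $\phi_\alpha\colon U_\alpha\to V_\alpha\subset\mathbb R^{n-k}$ such that the first and second derivatives of $\phi_\alpha^{-1}\colon V_\alpha\to\mathbb R^n$ are bounded uniformly in $\alpha$; * (A4) there are $\bar p\in M$ and $C_1,R_0>0$ with $\mathrm{vol}(B_M(\bar p,R))\le C_1R^\gamma$ for all $R>R_0$, where $B_M(\bar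 p,R)$ is the ball of radius $R$ in $M$ for the intrinsic distance, and the volume is the Riemannian one, both with respect to the metric induced by $\mathbb R^n$. Suppose that $f(\cdot,u)$ and $f(\cdot,v)$ are locally integrable in $\Omega$ and that, for every $\psi\in C_c^\infty(\Omega)$ with $\psi\ge 0$, $$\int_\Omega a\,\nabla u\cdot\nabla\psi+\Lambda|\nabla u|^q\psi\,dz\le\int_\Omega f(z,u)\,\psi\,dz,\qquad \int_\Omega a\,\nabla v\cdot\nabla\psi+\Lambda|\nabla v|^q\psi\,dz\ge\int_\Omega f(z,v)\,\psi\,dz .$$ If $u\le v$ on $\partial\Omega$, then $u\le v$ in $\Omega$. -/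

import Mathlib

open Set MeasureTheory Topology
open scoped ENNReal ContDiff

noncomputable section

namespace TubeComparison

/-- `ℝᵐ` with its Euclidean structure. -/
abbrev E (m : ℕ) : Type := EuclideanSpace ℝ (Fin m)

/-! ### Submanifolds of Euclidean space -/

/-- The inverse `V → U ⊆ M ↪ ℝⁿ` of a chart `φ : U → V ⊆ ℝᵈ` of the subset `M`, seen as a map
into `ℝⁿ`. -/
def param {n d : ℕ} {M : Set (E n)} (φ : OpenPartialHomeomorph M (E d)) (x : E d) : E n :=
  (φ.symm x : E n)

/-- A homeomorphism from a relatively open subset of `M` onto an open subset of `ℝᵈ` is a smooth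
chart of `M ⊆ ℝⁿ` when its inverse is a smooth immersion into `ℝⁿ`. -/
def IsSmoothChart {n d : ℕ} {M : Set (E n)} (φ : OpenPartialHomeomorph M (E d)) : Prop :=
  ContDiffOn ℝ ∞ (param φ) φ.target ∧
    ∀ x ∈ φ.target, Function.Injective (fderiv ℝ (param φ) x)

/-- `M ⊆ ℝⁿ` is a smoothly embedded submanifold of dimension `d`. -/
def IsSmoothSubmanifold {n : ℕ} (d : ℕ) (M : Set (E n)) : Prop :=
  ∀ p : M, ∃ φ : OpenPartialHomeomorph M (E d), p ∈ φ.source ∧ IsSmoothChart φ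

/-- The tangent space at `p`, spanned by the velocities at `p` of the curves in `M` through `p`. -/
def tangentSpaceAt {n : ℕ} (M : Set (E n)) (p : E n) : Submodule ℝ (E n) :=
  Submodule.span ℝ {w | ∃ c : ℝ → E n, c 0 = p ∧ (∀ᶠ s in 𝓝 (0 : ℝ), c s ∈ M) ∧ HasDerivAt c w 0}

/-- The normal space `N_p M`, the orthogonal complement of the tangent space. -/
def normalSpace {n : ℕ} (M : Set (E n)) (p : E n) : Submodule ℝ (E n) :=
  (tangentSpaceAt M p)ᗮ

/-! ### Normal tubes -/

/-- The ball `B(p, ε)` of radius `ε` centred at `p` in the affine normal space `p + N_p M`. -/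
def normalBall {n : ℕ} (M : Set (E n)) (p : E n) (ε : ℝ) : Set (E n) :=
  {z | z - p ∈ normalSpace M p ∧ ‖z - p‖ < ε}

/-- The union of the normal balls of radius `ε` centred at the points of `M`. -/
def tube {n : ℕ} (M : Set (E n)) (ε : ℝ) : Set (E n) :=
  ⋃ p ∈ M, normalBall M p ε

/-- `M` admits a normal tube of constant radius `ε > 0`: the map `(p, y) ↦ p + y` is a
diffeomorphism from the bundle of normal vectors of length `< ε` onto an open subset of `ℝⁿ`. Its
inverse is `z ↦ (π z, z - π z)` for the foot point map `π`, so this says that the normal balls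
are disjoint, their union is open, and the foot point map is smooth on it. -/
structure HasNormalTube {n : ℕ} (M : Set (E n)) (ε : ℝ) : Prop where
  pos : 0 < ε
  disjoint : M.PairwiseDisjoint fun p => normalBall M p ε
  isOpen : IsOpen (tube M ε)
  smooth_foot : ∃ π : E n → E n, ContDiffOn ℝ ∞ π (tube M ε) ∧
    ∀ p ∈ M, ∀ z ∈ normalBall M p ε, π z = p

/-! ### The assumptions on `M` -/

/-- `M` has an atlas of smooth charts for which the first and second derivatives of the inverse
charts, as maps into `ℝⁿ`, are bounded uniformly with respect to the chart. -/
def HasBoundedAtlas {n : ℕ} (d : ℕ) (M : Set (E n)) : Prop :=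
  ∃ (𝒜 : Set (OpenPartialHomeomorph M (E d))) (K : ℝ),
    (∀ φ ∈ 𝒜, IsSmoothChart φ) ∧ (∀ p : M, ∃ φ ∈ 𝒜, p ∈ φ.source) ∧
    ∀ φ ∈ 𝒜, ∀ x ∈ φ.target,
      ‖fderiv ℝ (param φ) x‖ ≤ K ∧ ‖iteratedFDeriv ℝ 2 (param φ) x‖ ≤ K

/-- The length of a `C¹` curve defined on `[0, 1]`. -/
def curveLength {n : ℕ} (c : ℝ → E n) : ℝ≥0∞ :=
  ∫⁻ s in Icc (0 : ℝ) 1, ‖derivWithin c (Icc 0 1) s‖ₑ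

/-- The distance `d_M` on `M` of the metric induced by `ℝⁿ`: the infimum of the lengths of
the `C¹` curves in `M` that join two points (`∞` if there are none). -/
def intrinsicEDist {n : ℕ} (M : Set (E n)) (p p' : E n) : ℝ≥0∞ :=
  ⨅ (c : ℝ → E n) (_ : ContDiffOn ℝ 1 c (Icc 0 1) ∧ MapsTo c (Icc 0 1) M ∧ c 0 = p ∧ c 1 = p'),
    curveLength c

/-- The intrinsic ball `B_M(p, R)`. -/
def intrinsicBall {n : ℕ} (M : Set (E n)) (p : E n) (R : ℝ) : Set (E n) :=
  {p' ∈ M | intrinsicEDist M p p' < ENNReal.ofReal R}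

/-- The volume of the intrinsic balls around some point of the `d`-dimensional submanifold `M`
grows at most like `R ^ γ`. The Riemannian volume of a subset of `M` is its `d`-dimensional
Hausdorff measure, normalized as Lebesgue measure. -/
def HasVolumeGrowth {n : ℕ} (d : ℕ) (M : Set (E n)) (γ : ℝ) : Prop :=
  ∃ p ∈ M, ∃ C₁ > 0, ∃ R₀ > 0, ∀ R > R₀,
    Measure.euclideanHausdorffMeasure d (intrinsicBall M p R) ≤ ENNReal.ofReal (C₁ * R ^ γ)

/-! ### The domain, the weight and the nonlinearity -/

/-- A smooth domain: open, connected, and near each boundary point the sublevel set `{g < 0}` of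
a smooth function `g` whose differential does not vanish there. -/
structure IsSmoothDomain {n : ℕ} (Ω : Set (E n)) : Prop where
  isOpen : IsOpen Ω
  isConnected : IsConnected Ω
  smooth_boundary : ∀ z ∈ frontier Ω, ∃ (W : Set (E n)) (g : E n → ℝ),
    IsOpen W ∧ z ∈ W ∧ ContDiffOn ℝ ∞ g W ∧ fderiv ℝ g z ≠ 0 ∧ Ω ∩ W = {x ∈ W | g x < 0}

/-- The assumption on the weight: `0 ≤ a ≤ A`, `a` is continuous on the closure of `Ω`, and on each
slice `Ω_p = Ω ∩ B(p, ε)` the integral of `a ^ (-t)` with respect to the Lebesgue measure of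
`N_p M` is at most `Ca`. The power is taken in `[0, ∞]`, so it is `∞` where `a` vanishes. -/
structure IsAdmissibleWeight {n : ℕ} (M : Set (E n)) (ε : ℝ) (Ω : Set (E n)) (t Ca A : ℝ)
    (a : E n → ℝ) : Prop where
  nonneg : ∀ z ∈ closure Ω, 0 ≤ a z
  continuousOn : ContinuousOn a (closure Ω)
  le : ∀ z ∈ Ω, a z ≤ A
  slice : ∀ p ∈ M,
    ∫⁻ y in {y : normalSpace M p | p + (y : E n) ∈ Ω ∩ normalBall M p ε},
      ENNReal.ofReal (a (p + (y : E n))) ^ (-t) ≤ ENNReal.ofReal Ca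

/-- `f(z, ·)` is locally Lipschitz uniformly in `z ∈ Ω`, with constant `L m` on `[-m, m]`. -/
def IsUniformlyLocallyLipschitz {n : ℕ} (Ω : Set (E n)) (L : ℝ → ℝ) (f : E n → ℝ → ℝ) : Prop :=
  ∀ m > 0, ∀ z ∈ Ω, ∀ r ∈ Icc (-m) m, ∀ s ∈ Icc (-m) m, |f z r - f z s| ≤ L m * |r - s|

/-! ### Weak sub- and supersolutions -/

/-- `u ∈ C¹(Ω) ∩ C⁰(closure Ω) ∩ W^{1,∞}(Ω)` with `‖u‖_{W^{1,∞}} ≤ K`. -/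
structure IsRegular {n : ℕ} (Ω : Set (E n)) (K : ℝ) (u : E n → ℝ) : Prop where
  contDiffOn : ContDiffOn ℝ 1 u Ω
  continuousOn : ContinuousOn u (closure Ω)
  bound : ∀ z ∈ Ω, |u z| ≤ K
  gradient_bound : ∀ z ∈ Ω, ‖gradient u z‖ ≤ K

/-- Nonnegative test functions in `C_c^∞(Ω)`. -/
structure IsTestFunction {n : ℕ} (Ω : Set (E n)) (ψ : E n → ℝ) : Prop where
  smooth : ContDiff ℝ ∞ ψ
  hasCompactSupport : HasCompactSupport ψ
  tsupport_subset : tsupport ψ ⊆ Ω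
  nonneg : ∀ z, 0 ≤ ψ z

/-- The left-hand side `∫_Ω a ∇u · ∇ψ + Λ |∇u|^q ψ` of the weak formulation. -/
def weakLHS {n : ℕ} (Ω : Set (E n)) (a : E n → ℝ) (Λ q : ℝ) (u ψ : E n → ℝ) : ℝ :=
  ∫ z in Ω, (a z * inner ℝ (gradient u z) (gradient ψ z) + Λ * ‖gradient u z‖ ^ q * ψ z)

/-- `u` is a weak solution of `-div(a ∇u) + Λ |∇u|^q ≤ f(z, u)` in `Ω`; the local integrability
makes the right-hand side of the weak formulation meaningful. -/
structure IsWeakSubsolution {n : ℕ} (Ω : Set (E n)) (a : E n → ℝ) (Λ q : ℝ) (f : E n → ℝ → ℝ)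
    (u : E n → ℝ) : Prop where
  locallyIntegrable : LocallyIntegrableOn (fun z => f z (u z)) Ω
  le : ∀ ψ, IsTestFunction Ω ψ → weakLHS Ω a Λ q u ψ ≤ ∫ z in Ω, f z (u z) * ψ z

/-- `v` is a weak solution of `-div(a ∇v) + Λ |∇v|^q ≥ f(z, v)` in `Ω`. -/
structure IsWeakSupersolution {n : ℕ} (Ω : Set (E n)) (a : E n → ℝ) (Λ q : ℝ) (f : E n → ℝ → ℝ)
    (v : E n → ℝ) : Prop where
  locallyIntegrable : LocallyIntegrableOn (fun z => f z (v z)) Ω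
  ge : ∀ ψ, IsTestFunction Ω ψ → ∫ z in Ω, f z (v z) * ψ z ≤ weakLHS Ω a Λ q v ψ

end TubeComparison

end

/-! The difference W = u - v satisfies a linear weak inequality: since x ↦ x^q and f(z, ·) are
Lipschitz on bounded sets, -div(a ∇W) ≤ c|∇W| + l|W| (`weakForm_sub_nonpos`). Write w = W₊. Testing
with w³φ², φ a cutoff, and applying Young's inequality with weights a and a⁻¹ bounds ∫ a w²|∇W|²φ²
by a multiple of ∫ a⁻¹w⁴φ² plus cutoff errors (`tested_lower_bound`). The terms with a⁻¹ are forced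
by the first-order term c|∇W| and the possible degeneracy of a. They are absorbed by a Poincaré
inequality with small constant η, namely ∫ a⁻¹G² ≤ η ∫ a|∇G|² with G = w²φ.

The smallness of η comes from the narrowness of the tube. On a k-dimensional slice, Hölder's
inequality puts ∇G in L^{2k/(k+1)}, the Sobolev inequality puts G in L^{2k/(k-1)} (in L^∞ if k = 1),
and a second use of Hölder gives the inequality with constant C(∫ a^{-k})^{2/k}
(`exists_weighted_poincare`). Because t > k, the bound on ∫ a^{-t} makes ∫ a^{-k} at most a constant
times a positive power of the volume of the slice, hence small with ε
(`exists_radius_weighted_poincare`).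

The slice inequalities are integrated over M by a local form of Fubini's theorem
(`HasNormalTube.lintegral_le_of_forall_slice`). The differential of the foot point map π is
symmetric, and its nonzero eigenvalues lie in [1/2, 2] up to half the radius ρ of the tube
(`IsFootMap.eigenvalue_mem_Icc`). The Jacobian of the tube coordinates is therefore bounded above
and below by constants that depend only on n, which loses a factor 16^n
(`exists_radius_tube_poincare`).

After absorption, Q(R) = ∫ a⁻¹w⁴ over Ω ∩ {|z| ≤ R} satisfies R² Q(R) ≤ κ Q(2R), while Q(R) = O(R^n)
by the bounds on W and ∇W. Iterating n times over dyadic scales forces Q = 0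
(`eq_zero_of_scale_decay`), so W ≤ 0 almost everywhere, hence everywhere by continuity.

The powers w² and w³ are used in place of w because they are C¹: no weak derivatives of truncations
are needed, and w² extended by zero is C¹ on the whole space. -/

/-! ### A weighted Poincaré inequality on Euclidean space -/

namespace TubeComparison

open Module

/-- Hölder's inequality for the gradient: the `L^{2k/(k+1)}` norm is controlled by the weighted
`L²` norm and by the integral of the `-k`-th power of the weight. -/
theorem lintegral_rpow_le_weighted {α : Type*} [MeasurableSpace α] {μ : Measure α} {k : ℕ}
    (hk : 1 ≤ k) {b h : α → ℝ≥0∞} (hb : AEMeasurable b μ) (hh : AEMeasurable h μ)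
    (hbtop : ∀ x, b x ≠ ⊤) (hκ : ∫⁻ x, (b x)⁻¹ ^ (k : ℝ) ∂μ ≠ ⊤) :
    (∫⁻ x, h x ^ (2 * k / (k + 1) : ℝ) ∂μ) ^ ((k + 1) / k : ℝ) ≤
      (∫⁻ x, (b x)⁻¹ ^ (k : ℝ) ∂μ) ^ (1 / k : ℝ) * ∫⁻ x, b x * h x ^ (2 : ℝ) ∂μ := by
  have hk0 : (0 : ℝ) < k := by exact_mod_cast hk
  have hpos : ∀ᵐ x ∂μ, b x ≠ 0 := by
    have := ae_lt_top' (μ := μ) (f := fun x => (b x)⁻¹ ^ (k : ℝ)) (by fun_prop) hκ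
    filter_upwards [this] with x hx h0
    rw [h0, ENNReal.inv_zero, ENNReal.top_rpow_of_pos hk0] at hx
    exact lt_irrefl _ hx
  -- Almost everywhere h^{2k/(k+1)} = (b h²)^{k/(k+1)} · (b⁻¹)^{k/(k+1)}; these exponents turn the
  -- two factors into b h² and b^{-k}.
  have hconj : Real.HolderConjugate ((k + 1) / k : ℝ) (k + 1) := by
    rw [Real.holderConjugate_iff]
    constructor
    · rw [lt_div_iff₀ hk0]; linarith
    · field_simp
  have key := ENNReal.lintegral_mul_le_Lp_mul_Lq μ hconj
    (f := fun x => (b x * h x ^ (2 : ℝ)) ^ (k / (k + 1) : ℝ))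
    (g := fun x => (b x)⁻¹ ^ (k / (k + 1) : ℝ)) (by fun_prop) (by fun_prop)
  have e1 : ∀ x, ((b x * h x ^ (2 : ℝ)) ^ (k / (k + 1) : ℝ)) ^ ((k + 1) / k : ℝ)
      = b x * h x ^ (2 : ℝ) := fun x => by
    rw [← ENNReal.rpow_mul]
    have : (k / (k + 1) : ℝ) * ((k + 1) / k : ℝ) = 1 := by field_simp
    rw [this, ENNReal.rpow_one]
  have e2 : ∀ x, ((b x)⁻¹ ^ (k / (k + 1) : ℝ)) ^ (k + 1 : ℝ) = (b x)⁻¹ ^ (k : ℝ) := fun x => by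
    rw [← ENNReal.rpow_mul]
    congr 1; field_simp
  have e3 : ∫⁻ x, h x ^ (2 * k / (k + 1) : ℝ) ∂μ =
      ∫⁻ x, ((fun x => (b x * h x ^ (2 : ℝ)) ^ (k / (k + 1) : ℝ)) *
        (fun x => (b x)⁻¹ ^ (k / (k + 1) : ℝ))) x ∂μ := by
    refine lintegral_congr_ae ?_
    filter_upwards [hpos] with x hx
    simp only [Pi.mul_apply]
    rw [← ENNReal.mul_rpow_of_nonneg _ _ (by positivity), mul_comm (b x), mul_assoc,
      ENNReal.mul_inv_cancel hx (hbtop x), mul_one, ← ENNReal.rpow_mul]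
    congr 1; field_simp
  simp only [e1, e2] at key
  rw [e3]
  calc _ ≤ _ := ENNReal.rpow_le_rpow key (by positivity)
    _ = _ := by
      rw [ENNReal.mul_rpow_of_nonneg _ _ (by positivity), ← ENNReal.rpow_mul, ← ENNReal.rpow_mul,
        mul_comm]
      have h1 : (1 / ((k + 1) / k) : ℝ) * ((k + 1) / k : ℝ) = 1 := by field_simp
      have h2 : (1 / (k + 1) : ℝ) * ((k + 1) / k : ℝ) = 1 / k := by field_simp
      rw [h1, h2, ENNReal.rpow_one]

/-- In dimension one a function is bounded by the integral of its derivative. -/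
theorem enorm_le_lintegral_enorm_fderiv_of_one {μ : Measure (E 1)} (hμ : μ = volume) {g : E 1 → ℝ}
    (hg : ContDiff ℝ 1 g) (hgc : HasCompactSupport g) (x : E 1) :
    ‖g x‖ₑ ≤ ∫⁻ y, ‖fderiv ℝ g y‖ₑ ∂μ := by
  subst hμ
  let e : ℝ ≃ₗᵢ[ℝ] E 1 := ((stdOrthonormalBasis ℝ ℝ).reindex (finCongr (by simp))).repr
  have hd : ∀ s, ‖deriv (g ∘ e) s‖ₑ ≤ ‖fderiv ℝ g (e s)‖ₑ := fun s => by
    have : HasDerivAt (g ∘ e) (fderiv ℝ g (e s) (e 1)) s := by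
      have h1 := (hg.differentiable one_ne_zero (e s)).hasFDerivAt
      have h2 := h1.comp s e.toContinuousLinearEquiv.hasFDerivAt
      simpa using h2.hasDerivAt
    rw [this.deriv]
    have h := (fderiv ℝ g (e s)).le_opNorm (e 1)
    rw [e.norm_map, norm_one, mul_one] at h
    simpa [enorm_le_iff_norm_le] using h
  have h1 : ContDiff ℝ 1 (g ∘ e) := hg.comp e.contDiff
  have h2 : HasCompactSupport (g ∘ e) := hgc.comp_homeomorph e.toHomeomorph
  have := h2.enorm_le_lintegral_Ici_deriv h1 (e.symm x)
  simp only [Function.comp_apply, e.apply_symm_apply] at this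
  refine this.trans ((setLIntegral_le_lintegral _ _).trans ((lintegral_mono hd).trans ?_))
  rw [e.measurePreserving.lintegral_comp (f := fun y => ‖fderiv ℝ g y‖ₑ)]
  have := hg.continuous_fderiv one_ne_zero
  fun_prop

/-- A weighted Poincaré inequality on `ℝᵏ`, from the critical Sobolev inequality between the
exponents `2k/(k+1)` and `2k/(k-1)`. -/
theorem exists_weighted_poincare {k : ℕ} (hk : 1 ≤ k) :
    ∃ C : NNReal, ∀ (g : E k → ℝ) (b : E k → ℝ≥0∞) (S : Set (E k)), ContDiff ℝ 1 g →
      HasCompactSupport g → Measurable b → (∀ x, b x ≠ ⊤) → MeasurableSet S →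
      (∀ x ∉ S, g x = 0) → (∀ x ∉ S, fderiv ℝ g x = 0) →
      ∫⁻ x in S, (b x)⁻¹ ^ (k : ℝ) ≠ ⊤ →
      ∫⁻ x in S, (b x)⁻¹ * ‖g x‖ₑ ^ (2 : ℝ) ≤
        C * (∫⁻ x in S, (b x)⁻¹ ^ (k : ℝ)) ^ (2 / k : ℝ) *
          ∫⁻ x in S, b x * ‖fderiv ℝ g x‖ₑ ^ (2 : ℝ) := by
  have hk0 : (0 : ℝ) < k := by exact_mod_cast hk
  -- For k = 1 the target exponent 2k/(k-1) is infinite, and the sup bound by the L¹ norm of the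
  -- derivative takes the place of the Sobolev inequality.
  rcases hk.eq_or_lt with rfl | hk2
  · refine ⟨1, fun g b S hg hgc hb hbt hS h0 h0' hκ => ?_⟩
    have hf := hg.continuous_fderiv one_ne_zero
    have h1 := fun x => enorm_le_lintegral_enorm_fderiv_of_one rfl hg hgc x
    have h2 : ∫⁻ y, ‖fderiv ℝ g y‖ₑ = ∫⁻ y in S, ‖fderiv ℝ g y‖ₑ := by
      rw [← lintegral_indicator hS]
      refine lintegral_congr fun y => ?_
      by_cases hy : y ∈ S
      · simp [hy]
      · rw [indicator_of_notMem hy, ← ofReal_norm, h0' y hy, norm_zero, ENNReal.ofReal_zero]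
    have h3 := lintegral_rpow_le_weighted (μ := volume.restrict S) le_rfl (b := b)
      (h := fun x => ‖fderiv ℝ g x‖ₑ) hb.aemeasurable (by fun_prop) hbt hκ
    norm_num at h3
    rw [h2] at h1
    norm_num
    calc ∫⁻ x in S, (b x)⁻¹ * ‖g x‖ₑ ^ 2
        ≤ ∫⁻ x in S, (b x)⁻¹ * (∫⁻ y in S, ‖fderiv ℝ g y‖ₑ) ^ 2 := by
          gcongr with x; exact h1 x
      _ = (∫⁻ x in S, (b x)⁻¹) * (∫⁻ y in S, ‖fderiv ℝ g y‖ₑ) ^ 2 :=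
          lintegral_mul_const _ hb.inv
      _ ≤ (∫⁻ x in S, (b x)⁻¹) * ((∫⁻ x in S, (b x)⁻¹) *
            ∫⁻ x in S, b x * ‖fderiv ℝ g x‖ₑ ^ 2) := by gcongr
      _ = _ := by ring
  · have hk1 : (1 : ℝ) < k := by exact_mod_cast hk2
    -- These exponents satisfy 1/p' = 1/p - 1/k, the critical Sobolev relation in dimension k.
    let p : NNReal := 2 * k / (k + 1)
    let p' : NNReal := ⟨2 * k / (k - 1), div_nonneg (by positivity) (by linarith)⟩
    have hpR : (p : ℝ) = 2 * k / (k + 1) := by simp [p]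
    have hp'R : (p' : ℝ) = 2 * k / (k - 1) := rfl
    have hp0 : 0 < (p : ℝ) := by rw [hpR]; positivity
    have hp'0 : 0 < (p' : ℝ) := by
      rw [hp'R]; exact div_pos (by positivity) (by linarith)
    let C₀ : NNReal := SNormLESNormFDerivOfEqConst ℝ (volume : Measure (E k)) p
    refine ⟨C₀ ^ 2, fun g b S hg hgc hb hbt hS h0 h0' hκ => ?_⟩
    have hf := hg.continuous_fderiv one_ne_zero
    have hgm := hg.continuous
    set κ := ∫⁻ x in S, (b x)⁻¹ ^ (k : ℝ) with hκdef
    have hsob := eLpNorm_le_eLpNorm_fderiv_of_eq (volume : Measure (E k)) hg hgc (p := p)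
      (p' := p') (by
        rw [← NNReal.coe_le_coe, hpR, NNReal.coe_one, le_div_iff₀ (by positivity)]; linarith)
      (by simpa using hk0) (by
        rw [hp'R, NNReal.coe_inv, hpR]; simp; field_simp; ring)
    rw [eLpNorm_nnreal_eq_lintegral (p := p) (by exact_mod_cast hp0.ne'),
      eLpNorm_nnreal_eq_lintegral (p := p') (by exact_mod_cast hp'0.ne')] at hsob
    have i1 : ∫⁻ x, ‖g x‖ₑ ^ (p' : ℝ) = ∫⁻ x in S, ‖g x‖ₑ ^ (p' : ℝ) := by
      rw [← lintegral_indicator hS]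
      refine lintegral_congr fun y => ?_
      by_cases hy : y ∈ S <;> simp [hy, h0, hp'0]
    have i2 : ∫⁻ x, ‖fderiv ℝ g x‖ₑ ^ (p : ℝ) = ∫⁻ x in S, ‖fderiv ℝ g x‖ₑ ^ (p : ℝ) := by
      rw [← lintegral_indicator hS]
      refine lintegral_congr fun y => ?_
      by_cases hy : y ∈ S
      · simp [hy]
      · rw [indicator_of_notMem hy, ← ofReal_norm, h0' y hy, norm_zero, ENNReal.ofReal_zero,
          ENNReal.zero_rpow_of_pos hp0]
    rw [i1, i2] at hsob
    have h3 := lintegral_rpow_le_weighted (μ := volume.restrict S) hk (b := b)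
      (h := fun x => ‖fderiv ℝ g x‖ₑ) hb.aemeasurable (by fun_prop) hbt hκ
    -- The second Hölder inequality pairs b⁻¹ in L^k with g² in L^{k/(k-1)}, that is, g in L^{p'}.
    have hconj : Real.HolderConjugate (k : ℝ) (k / (k - 1)) := by
      rw [Real.holderConjugate_iff]
      refine ⟨hk1, ?_⟩
      have : (k : ℝ) - 1 ≠ 0 := by linarith
      field_simp; ring
    have h4 := ENNReal.lintegral_mul_le_Lp_mul_Lq (volume.restrict S) hconj
      (f := fun x => (b x)⁻¹) (g := fun x => ‖g x‖ₑ ^ (2 : ℝ)) (by fun_prop) (by fun_prop)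
    simp only [Pi.mul_apply, ← ENNReal.rpow_mul] at h4
    have e1 : (2 * (k / (k - 1)) : ℝ) = p' := by rw [hp'R]; ring
    have e2 : (1 / (k / (k - 1)) : ℝ) = 1 / p' * 2 := by
      rw [hp'R]
      have : (k : ℝ) - 1 ≠ 0 := by linarith
      field_simp
    have e3 : ((k + 1) / k : ℝ) = 1 / p * 2 := by
      rw [hpR]
      field_simp
    rw [e1, e2, ENNReal.rpow_mul] at h4
    rw [← hpR, e3, ENNReal.rpow_mul _ _ 2] at h3
    calc _ ≤ _ := h4
      _ ≤ κ ^ (1 / k : ℝ) * (C₀ * (∫⁻ x in S, ‖fderiv ℝ g x‖ₑ ^ (p : ℝ)) ^ (1 / p : ℝ)) ^ (2 : ℝ) := by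
        gcongr
      _ = κ ^ (1 / k : ℝ) * (C₀ ^ 2 *
            ((∫⁻ x in S, ‖fderiv ℝ g x‖ₑ ^ (p : ℝ)) ^ (1 / p : ℝ)) ^ (2 : ℝ)) := by
        rw [ENNReal.mul_rpow_of_nonneg _ _ (by norm_num)]; norm_num
      _ ≤ κ ^ (1 / k : ℝ) * (C₀ ^ 2 * (κ ^ (1 / k : ℝ) *
            ∫⁻ x in S, b x * ‖fderiv ℝ g x‖ₑ ^ (2 : ℝ))) := by gcongr
      _ = _ := by
        have : (2 / k : ℝ) = 1 / k + 1 / k := by ring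
        rw [this, ENNReal.rpow_add_of_nonneg _ _ (by positivity) (by positivity)]
        push_cast; ring

/-- Hölder's inequality against the constant 1. With s = k this is where t > k enters: the surplus
of integrability is traded for the factor μ(univ)^{1-k/t}, the only source of smallness in the whole
argument. -/
theorem lintegral_rpow_le_of_lt {α : Type*} [MeasurableSpace α] {μ : Measure α} {s t : ℝ}
    (hs : 0 < s) (hst : s < t) {h : α → ℝ≥0∞} (hh : AEMeasurable h μ) :
    ∫⁻ x, h x ^ s ∂μ ≤ (∫⁻ x, h x ^ t ∂μ) ^ (s / t) * μ univ ^ (1 - s / t) := by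
  have ht : 0 < t := hs.trans hst
  have hconj : Real.HolderConjugate (t / s) (t / (t - s)) := by
    rw [Real.holderConjugate_iff]
    have : t - s ≠ 0 := by linarith
    refine ⟨by rw [lt_div_iff₀ hs]; linarith, ?_⟩
    field_simp; ring
  have key := ENNReal.lintegral_mul_le_Lp_mul_Lq μ hconj (f := fun x => h x ^ s) (g := fun _ => 1)
    (by fun_prop) (by fun_prop)
  simp only [Pi.mul_apply, mul_one, ← ENNReal.rpow_mul, ENNReal.one_rpow, lintegral_one] at key
  have e1 : s * (t / s) = t := by field_simp
  have e2 : 1 / (t / s) = s / t := by field_simp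
  have e3 : 1 / (t / (t - s)) = 1 - s / t := by
    have : t - s ≠ 0 := by linarith
    field_simp
  rwa [e1, e2, e3] at key

/-- The weighted Poincaré inequality for functions supported in small balls of a `k`-dimensional
Euclidean space: if the weight `b` satisfies `∫ b ^ (-t) ≤ Ca` for some `t > k`, then the constant
is as small as desired on small balls. -/
theorem exists_radius_weighted_poincare {k : ℕ} (hk : 1 ≤ k) {t : ℝ} (ht : (k : ℝ) < t) (Ca : ℝ)
    {η : ℝ} (hη : 0 < η) :
    ∃ ε₁ > 0, ∀ (V : Type) [NormedAddCommGroup V] [InnerProductSpace ℝ V]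
      [FiniteDimensional ℝ V] [MeasurableSpace V] [BorelSpace V], finrank ℝ V = k →
      ∀ (g : V → ℝ) (b : V → ℝ≥0∞) (S : Set V) (ε : ℝ), ε < ε₁ → S ⊆ Metric.ball 0 ε →
      ContDiff ℝ 1 g → HasCompactSupport g → Measurable b → (∀ x, b x ≠ ⊤) → MeasurableSet S →
      (∀ x ∉ S, g x = 0) → (∀ x ∉ S, fderiv ℝ g x = 0) →
      ∫⁻ x in S, (b x)⁻¹ ^ t ≤ ENNReal.ofReal Ca →
      ∫⁻ x in S, (b x)⁻¹ * ‖g x‖ₑ ^ (2 : ℝ) ≤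
        ENNReal.ofReal η * ∫⁻ x in S, b x * ‖fderiv ℝ g x‖ₑ ^ (2 : ℝ) := by
  have hk0 : (0 : ℝ) < k := by exact_mod_cast hk
  have ht0 : 0 < t := hk0.trans ht
  have hkt : 0 < 1 - k / t := by rw [sub_pos, div_lt_one ht0]; exact ht
  obtain ⟨C, hC⟩ := exists_weighted_poincare hk
  -- the constant as a function of the radius tends to zero
  have hpow : ∀ r : ℝ, 0 < r → Filter.Tendsto (fun x : ℝ≥0∞ => x ^ r) (𝓝 0) (𝓝 0) := fun r hr => by
    simpa [ENNReal.zero_rpow_of_pos hr] using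
      (ENNReal.continuous_rpow_const (y := r)).tendsto (0 : ℝ≥0∞)
  let K : ℝ → ℝ≥0∞ := fun ε => C * ((ENNReal.ofReal Ca) ^ (k / t : ℝ) *
    (volume (Metric.ball (0 : E k) ε)) ^ (1 - k / t : ℝ)) ^ (2 / k : ℝ)
  have hlim : Filter.Tendsto K (𝓝[>] 0) (𝓝 0) := by
    have h1 : Filter.Tendsto (fun ε => volume (Metric.ball (0 : E k) ε)) (𝓝[>] 0) (𝓝 0) := by
      have hne : Nonempty (Fin k) := ⟨⟨0, hk⟩⟩
      simp only [EuclideanSpace.volume_ball, Fintype.card_fin]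
      have h2 : Filter.Tendsto (fun ε : ℝ => ENNReal.ofReal ε ^ k) (𝓝[>] 0) (𝓝 0) := by
        have h3 : Filter.Tendsto (fun ε : ℝ => ENNReal.ofReal ε ^ k) (𝓝 0)
            (𝓝 (ENNReal.ofReal 0 ^ k)) :=
          ENNReal.Tendsto.pow (ENNReal.tendsto_ofReal Filter.tendsto_id)
        rw [ENNReal.ofReal_zero, zero_pow (by omega)] at h3
        exact h3.mono_left nhdsWithin_le_nhds
      simpa using ENNReal.Tendsto.mul_const h2 (Or.inr ENNReal.ofReal_ne_top)
    have h4 := ENNReal.Tendsto.const_mul (a := (ENNReal.ofReal Ca) ^ (k / t : ℝ))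
      ((hpow _ hkt).comp h1)
      (Or.inr (ENNReal.rpow_ne_top_of_nonneg (by positivity) ENNReal.ofReal_ne_top))
    rw [mul_zero] at h4
    have h5 := ENNReal.Tendsto.const_mul (a := (C : ℝ≥0∞))
      ((hpow (2 / k) (by positivity)).comp h4)
      (Or.inr ENNReal.coe_ne_top)
    rw [mul_zero] at h5
    exact h5
  have hev : ∀ᶠ ε in 𝓝[>] (0 : ℝ), K ε < ENNReal.ofReal η :=
    hlim.eventually_lt_const (by simpa using hη)
  -- `K` increases with the radius, so a bound at the single radius `ε₁` serves all smaller ones.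
  obtain ⟨ε₁, hε₁, hsub⟩ := mem_nhdsGT_iff_exists_Ioc_subset.1 hev
  have hKε₁ : K ε₁ ≤ ENNReal.ofReal η := (hsub ⟨hε₁, le_rfl⟩ : K ε₁ < _).le
  refine ⟨ε₁, hε₁, ?_⟩
  intro V _ _ _ _ _ hV g b S ε hε hS hg hgc hb hbt hSm h0 h0' hCa
  let e : E k ≃ₗᵢ[ℝ] V := ((stdOrthonormalBasis ℝ V).reindex (finCongr hV)).repr.symm
  have hmp := e.measurePreserving
  have hemb : MeasurableEmbedding e := e.toHomeomorph.measurableEmbedding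
  have hset : ∀ h : V → ℝ≥0∞, ∫⁻ x in S, h x = ∫⁻ x in e ⁻¹' S, h (e x) := fun h =>
    (hmp.setLIntegral_comp_preimage_emb hemb h S).symm
  have hfd : ∀ x, fderiv ℝ (g ∘ e) x =
      (fderiv ℝ g (e x)).comp (e.toContinuousLinearEquiv : E k →L[ℝ] V) := fun x =>
    ((hg.differentiable one_ne_zero (e x)).hasFDerivAt.comp x
      e.toContinuousLinearEquiv.hasFDerivAt).fderiv
  have hfn : ∀ x, ‖fderiv ℝ (g ∘ e) x‖ₑ ≤ ‖fderiv ℝ g (e x)‖ₑ := fun x => by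
    rw [enorm_le_iff_norm_le, hfd]
    refine ContinuousLinearMap.opNorm_le_bound _ (norm_nonneg _) fun y => ?_
    simpa using (fderiv ℝ g (e x)).le_opNorm (e y)
  have hSm' : MeasurableSet (e ⁻¹' S) := hemb.measurable hSm
  have hbm : Measurable (b ∘ e) := hb.comp hemb.measurable
  have hvol : volume (e ⁻¹' S) ≤ volume (Metric.ball (0 : E k) ε₁) := by
    refine measure_mono fun x hx => ?_
    have := hS hx
    simp only [mem_ball_zero_iff, e.norm_map] at this ⊢
    exact this.trans hε
  have hκ : ∫⁻ x in e ⁻¹' S, ((b ∘ e) x)⁻¹ ^ (k : ℝ) ≤ (ENNReal.ofReal Ca) ^ (k / t : ℝ) *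
      (volume (Metric.ball (0 : E k) ε₁)) ^ (1 - k / t : ℝ) := by
    refine (lintegral_rpow_le_of_lt hk0 ht hbm.inv.aemeasurable).trans ?_
    rw [hset] at hCa
    rw [Measure.restrict_apply_univ]
    gcongr
    exact hCa
  have hκtop : ∫⁻ x in e ⁻¹' S, ((b ∘ e) x)⁻¹ ^ (k : ℝ) ≠ ⊤ := by
    refine ne_top_of_le_ne_top (ENNReal.mul_ne_top ?_ ?_) hκ
    · exact ENNReal.rpow_ne_top_of_nonneg (by positivity) ENNReal.ofReal_ne_top
    · exact ENNReal.rpow_ne_top_of_nonneg hkt.le measure_ball_lt_top.ne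
  have key := hC (g ∘ e) (b ∘ e) (e ⁻¹' S) (hg.comp e.contDiff)
    (hgc.comp_homeomorph e.toHomeomorph) hbm (fun x => hbt _) hSm' (fun x hx => h0 _ hx)
    (fun x hx => by rw [hfd, h0' _ hx, ContinuousLinearMap.zero_comp]) hκtop
  rw [hset, hset]
  refine key.trans ?_
  gcongr
  · exact le_trans (by simp only [K]; gcongr) hKε₁
  · rfl
  · exact hfn _

end TubeComparison

/-! ### The foot point map of a normal tube -/

namespace TubeComparison

/-- `π` is a smooth foot point map on the normal tube of radius `ρ` around `M`. -/
structure IsFootMap {n : ℕ} (M : Set (E n)) (ρ : ℝ) (π : E n → E n) : Prop where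
  pos : 0 < ρ
  isOpen : IsOpen (tube M ρ)
  smooth : ContDiffOn ℝ ∞ π (tube M ρ)
  foot : ∀ p ∈ M, ∀ z ∈ normalBall M p ρ, π z = p

theorem HasNormalTube.exists_isFootMap {n : ℕ} {M : Set (E n)} {ρ : ℝ} (h : HasNormalTube M ρ) :
    ∃ π, IsFootMap M ρ π := by
  obtain ⟨π, h1, h2⟩ := h.smooth_foot
  exact ⟨π, h.pos, h.isOpen, h1, h2⟩

theorem mem_tube_iff {n : ℕ} {M : Set (E n)} {ρ : ℝ} {z : E n} :
    z ∈ tube M ρ ↔ ∃ p ∈ M, z - p ∈ normalSpace M p ∧ ‖z - p‖ < ρ := by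
  simp only [tube, normalBall, mem_iUnion, mem_ofPred_eq, exists_prop]

theorem tube_mono {n : ℕ} {M : Set (E n)} {ε ρ : ℝ} (h : ε ≤ ρ) : tube M ε ⊆ tube M ρ := by
  intro z hz
  obtain ⟨p, hp, h1, h2⟩ := mem_tube_iff.1 hz
  exact mem_tube_iff.2 ⟨p, hp, h1, h2.trans_le h⟩

theorem inner_eq_zero_of_mem_normalSpace {n : ℕ} {M : Set (E n)} {p y w : E n}
    (hy : y ∈ normalSpace M p) (hw : w ∈ tangentSpaceAt M p) : inner ℝ y w = 0 :=
  Submodule.inner_left_of_mem_orthogonal hw hy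

namespace IsFootMap

variable {n : ℕ} {M : Set (E n)} {ρ : ℝ} {π : E n → E n}

theorem apply_mem (h : IsFootMap M ρ π) {z : E n} (hz : z ∈ tube M ρ) : π z ∈ M := by
  obtain ⟨p, hp, h1, h2⟩ := mem_tube_iff.1 hz
  rw [h.foot p hp z ⟨h1, h2⟩]
  exact hp

theorem sub_mem (h : IsFootMap M ρ π) {z : E n} (hz : z ∈ tube M ρ) :
    z - π z ∈ normalSpace M (π z) := by
  obtain ⟨p, hp, h1, h2⟩ := mem_tube_iff.1 hz
  rw [h.foot p hp z ⟨h1, h2⟩]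
  exact h1

theorem add_mem_tube {p y : E n} (hp : p ∈ M) (hy : y ∈ normalSpace M p)
    (hyρ : ‖y‖ < ρ) : p + y ∈ tube M ρ :=
  mem_tube_iff.2 ⟨p, hp, by simpa using hy, by simpa using hyρ⟩

theorem apply_add (h : IsFootMap M ρ π) {p y : E n} (hp : p ∈ M) (hy : y ∈ normalSpace M p)
    (hyρ : ‖y‖ < ρ) : π (p + y) = p :=
  h.foot p hp _ ⟨by simpa using hy, by simpa using hyρ⟩

theorem self_mem (h : IsFootMap M ρ π) {p : E n} (hp : p ∈ M) : p ∈ tube M ρ := by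
  simpa using add_mem_tube (ρ := ρ) hp (zero_mem _) (by simpa using h.pos)

theorem apply_self (h : IsFootMap M ρ π) {p : E n} (hp : p ∈ M) : π p = p := by
  simpa using h.apply_add hp (zero_mem _) (by simpa using h.pos)

theorem mem_tube_iff_norm (h : IsFootMap M ρ π) {ε : ℝ} (hε : ε ≤ ρ) {z : E n}
    (hz : z ∈ tube M ρ) : z ∈ tube M ε ↔ ‖z - π z‖ < ε := by
  refine ⟨fun hz' => ?_, fun hz' => mem_tube_iff.2 ⟨π z, h.apply_mem hz, h.sub_mem hz, hz'⟩⟩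
  obtain ⟨p, hp, h1, h2⟩ := mem_tube_iff.1 hz'
  rwa [h.foot p hp z ⟨h1, h2.trans_le hε⟩]

theorem contDiffAt (h : IsFootMap M ρ π) {z : E n} (hz : z ∈ tube M ρ) : ContDiffAt ℝ ∞ π z :=
  h.smooth.contDiffAt (h.isOpen.mem_nhds hz)

theorem hasFDerivAt (h : IsFootMap M ρ π) {z : E n} (hz : z ∈ tube M ρ) :
    HasFDerivAt π (fderiv ℝ π z) z :=
  ((h.contDiffAt hz).differentiableAt (by simp)).hasFDerivAt

theorem continuousAt_fderiv (h : IsFootMap M ρ π) {z : E n} (hz : z ∈ tube M ρ) :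
    ContinuousAt (fderiv ℝ π) z :=
  ((h.contDiffAt hz).fderiv_right (m := 0) (by simp)).continuousAt

/-- When z moves along a line, its foot point traces a curve in M, whose velocity is the derivative.
-/
theorem fderiv_mem_tangentSpaceAt (h : IsFootMap M ρ π) {z : E n} (hz : z ∈ tube M ρ) (v : E n) :
    fderiv ℝ π z v ∈ tangentSpaceAt M (π z) := by
  have hline : HasDerivAt (fun s : ℝ => z + s • v) v 0 := by
    simpa using ((hasDerivAt_id (0 : ℝ)).smul_const v).const_add z
  refine Submodule.subset_span ⟨fun s : ℝ => π (z + s • v), by simp, ?_, ?_⟩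
  · have : Filter.Tendsto (fun s : ℝ => z + s • v) (𝓝 0) (𝓝 z) := by
      simpa using hline.continuousAt.tendsto
    filter_upwards [this.eventually (h.isOpen.mem_nhds hz)] with s hs
    exact h.apply_mem hs
  · have h1 : HasFDerivAt π (fderiv ℝ π z) (z + (0 : ℝ) • v) := by simpa using h.hasFDerivAt hz
    exact h1.comp_hasDerivAt (0 : ℝ) hline

/-- Curves in M are fixed by π, hence so are their velocities, and the claim extends to their span
by linearity. -/
theorem fderiv_apply_of_mem_tangentSpaceAt (h : IsFootMap M ρ π) {p : E n} (hp : p ∈ M) {w : E n}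
    (hw : w ∈ tangentSpaceAt M p) : fderiv ℝ π p w = w := by
  suffices tangentSpaceAt M p ≤ LinearMap.ker ((fderiv ℝ π p : E n →ₗ[ℝ] E n) - LinearMap.id) by
    simpa [sub_eq_zero] using this hw
  refine Submodule.span_le.2 ?_
  rintro w ⟨c, hc0, hcM, hc⟩
  have h1 : HasFDerivAt π (fderiv ℝ π p) (c 0) := by
    rw [hc0]; exact h.hasFDerivAt (h.self_mem hp)
  have h2 := h1.comp_hasDerivAt (0 : ℝ) hc
  have h3 : HasDerivAt (π ∘ c) w 0 := by
    refine hc.congr_of_eventuallyEq ?_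
    filter_upwards [hcM] with s hs
    exact h.apply_self hs
  simpa [sub_eq_zero] using h2.unique h3

/-- The foot point map is the gradient of a function up to sign and the identity, so its
differential is symmetric. -/
theorem inner_fderiv_comm (h : IsFootMap M ρ π) {z : E n} (hz : z ∈ tube M ρ) (v w : E n) :
    inner ℝ (fderiv ℝ π z v) w = inner ℝ v (fderiv ℝ π z w) := by
  let b : E n → ℝ := fun z => (1 / 2 : ℝ) * inner ℝ (z - π z) (z - π z)
  have hb' : ∀ z ∈ tube M ρ, HasFDerivAt b (innerSL ℝ (z - π z)) z := by
    intro z hz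
    have h1 : HasFDerivAt (fun z => z - π z) (ContinuousLinearMap.id ℝ (E n) - fderiv ℝ π z) z :=
      (hasFDerivAt_id z).sub (h.hasFDerivAt hz)
    refine ((h1.inner ℝ h1).const_mul (1 / 2 : ℝ)).congr_fderiv (ContinuousLinearMap.ext fun v => ?_)
    have h2 := inner_eq_zero_of_mem_normalSpace (h.sub_mem hz) (h.fderiv_mem_tangentSpaceAt hz v)
    have h3 : (1 / 2 : ℝ) * (inner ℝ (z - π z) (v - fderiv ℝ π z v) +
        inner ℝ (v - fderiv ℝ π z v) (z - π z)) = inner ℝ (z - π z) v := by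
      rw [real_inner_comm (z - π z) (v - fderiv ℝ π z v), inner_sub_right, h2]
      ring
    exact h3
  have h2 : HasFDerivAt (fun z => innerSL ℝ (z - π z))
      ((innerSL ℝ : E n →L[ℝ] E n →L[ℝ] ℝ).comp
        (ContinuousLinearMap.id ℝ (E n) - fderiv ℝ π z)) z :=
    (innerSL ℝ : E n →L[ℝ] E n →L[ℝ] ℝ).hasFDerivAt.comp z
      ((hasFDerivAt_id z).sub (h.hasFDerivAt hz))
  have h3 := second_derivative_symmetric_of_eventually (f := b)
    (f' := fun z => innerSL ℝ (z - π z)) (x := z)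
    (by filter_upwards [h.isOpen.mem_nhds hz] with y hy using hb' y hy) h2 v w
  have h4 : inner ℝ (v - fderiv ℝ π z v) w = inner ℝ (w - fderiv ℝ π z w) v := h3
  rw [inner_sub_left, inner_sub_left, real_inner_comm v w] at h4
  rw [real_inner_comm _ v]
  linarith

/-- Differentiating `π (π z + s (z - π z)) = π z`. -/
theorem fderiv_comp_fderiv (h : IsFootMap M ρ π) {z : E n} (hz : z ∈ tube M ρ) {s : ℝ}
    (hs : ‖s • (z - π z)‖ < ρ) (v : E n) :
    fderiv ℝ π (π z + s • (z - π z)) (fderiv ℝ π z v + s • (v - fderiv ℝ π z v)) =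
      fderiv ℝ π z v := by
  have hmem : π z + s • (z - π z) ∈ tube M ρ :=
    add_mem_tube (h.apply_mem hz) (Submodule.smul_mem _ _ (h.sub_mem hz)) hs
  have h1 : HasFDerivAt (fun z => π z + s • (z - π z))
      (fderiv ℝ π z + s • (ContinuousLinearMap.id ℝ (E n) - fderiv ℝ π z)) z :=
    (h.hasFDerivAt hz).add (((hasFDerivAt_id z).sub (h.hasFDerivAt hz)).const_smul s)
  have h2 := (h.hasFDerivAt hmem).comp z h1
  have hcont : ContinuousAt (fun z => ‖s • (z - π z)‖) z :=
    ((continuousAt_id.sub (h.hasFDerivAt hz).continuousAt).const_smul s).norm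
  have h3 : HasFDerivAt (π ∘ fun z => π z + s • (z - π z)) (fderiv ℝ π z) z := by
    refine (h.hasFDerivAt hz).congr_of_eventuallyEq ?_
    filter_upwards [h.isOpen.mem_nhds hz, hcont.eventually_lt_const hs] with y hy hys
    exact h.apply_add (h.apply_mem hy) (Submodule.smul_mem _ _ (h.sub_mem hy)) hys
  have := congrArg (fun A : E n →L[ℝ] E n => A v) (h2.unique h3)
  simpa using this

theorem fderiv_foot_comp (h : IsFootMap M ρ π) {z : E n} (hz : z ∈ tube M ρ) (v : E n) :
    fderiv ℝ π (π z) (fderiv ℝ π z v) = fderiv ℝ π z v := by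
  simpa using h.fderiv_comp_fderiv hz (s := 0) (by simpa using h.pos) v

/-- At a point p of M the differential of π is symmetric, takes tangential values and fixes tangent
vectors: it is the orthogonal projection onto the tangent space, so its kernel is the normal space.
-/
theorem mem_normalSpace_iff (h : IsFootMap M ρ π) {p : E n} (hp : p ∈ M) {y : E n} :
    y ∈ normalSpace M p ↔ fderiv ℝ π p y = 0 := by
  have hpt := h.self_mem hp
  constructor
  · intro hy
    rw [← inner_self_eq_zero (𝕜 := ℝ), h.inner_fderiv_comm hpt]
    have := h.fderiv_mem_tangentSpaceAt hpt (fderiv ℝ π p y)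
    rw [h.apply_self hp] at this
    exact inner_eq_zero_of_mem_normalSpace hy this
  · intro hy
    rw [normalSpace, Submodule.mem_orthogonal]
    intro w hw
    rw [← h.fderiv_apply_of_mem_tangentSpaceAt hp hw, h.inner_fderiv_comm hpt, hy, inner_zero_right]

/-- If 2|z - πz| ≤ ρ, the normal segment may be stretched by any factor s with |s| < 2 without
leaving the tube. Differentiating π(πz + s(z - πz)) = πz along e shows that some linear map sends (l
+ s(1 - l))e to le ≠ 0, so l + s(1 - l) has no zero with |s| < 2. -/
theorem eigenvalue_mem_Icc (h : IsFootMap M ρ π) {z : E n} (hz : z ∈ tube M ρ)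
    (hzρ : 2 * ‖z - π z‖ ≤ ρ) {l : ℝ} (hl : l ≠ 0) {e : E n} (he : e ≠ 0)
    (hle : fderiv ℝ π z e = l • e) : l ∈ Icc (1 / 2 : ℝ) 2 := by
  have key : ∀ s : ℝ, |s| < 2 → l + s * (1 - l) ≠ 0 := by
    intro s hs h0
    have hs' : ‖s • (z - π z)‖ < ρ := by
      rw [norm_smul, Real.norm_eq_abs]
      rcases (norm_nonneg (z - π z)).eq_or_lt with h1 | h1
      · rw [← h1, mul_zero]; exact h.pos
      · exact (mul_lt_mul_of_pos_right hs h1).trans_le hzρ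
    have h1 := h.fderiv_comp_fderiv hz hs' e
    have h2 : l • e + s • (e - l • e) = (l + s * (1 - l)) • e := by module
    rw [hle, h2, h0, zero_smul, map_zero] at h1
    exact (smul_ne_zero hl he) h1.symm
  by_contra hcon
  by_cases h1 : l = 1
  · exact hcon (by rw [h1]; norm_num)
  have hl1 : l - 1 ≠ 0 := sub_ne_zero.2 h1
  -- This is the zero of s ↦ l + s(1 - l); for l outside [1/2, 2] its modulus is below 2.
  refine key (l / (l - 1)) ?_ (by field_simp; ring)
  rw [abs_div, div_lt_iff₀ (abs_pos.2 hl1)]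
  rw [mem_Icc, not_and_or, not_le, not_le] at hcon
  rcases hcon with h2 | h2
  · rw [abs_of_neg (show l - 1 < 0 by linarith)]
    exact abs_lt.2 ⟨by linarith, by linarith⟩
  · rw [abs_of_pos (show 0 < l - 1 by linarith)]
    exact abs_lt.2 ⟨by linarith, by linarith⟩

/-- By `fderiv_comp_fderiv` the differential of π at πz + s(z - πz) kills se, hence e, for all small
s ≠ 0; let s → 0 and use the continuity of the differential. -/
theorem eq_zero_of_fderiv_eq_zero (h : IsFootMap M ρ π) {z : E n} (hz : z ∈ tube M ρ) {e : E n}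
    (he : fderiv ℝ π z e = 0) : fderiv ℝ π (π z) e = 0 := by
  have hzM := h.self_mem (h.apply_mem hz)
  have hlim : Filter.Tendsto (fun s : ℝ => π z + s • (z - π z)) (𝓝[≠] 0) (𝓝 (π z)) := by
    have : Continuous fun s : ℝ => π z + s • (z - π z) := by fun_prop
    simpa using (this.tendsto 0).mono_left nhdsWithin_le_nhds
  have h1 : Filter.Tendsto (fun s : ℝ => fderiv ℝ π (π z + s • (z - π z)) e) (𝓝[≠] 0)
      (𝓝 (fderiv ℝ π (π z) e)) :=
    (((ContinuousLinearMap.apply ℝ (E n) e).continuous.tendsto _).comp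
      ((h.continuousAt_fderiv hzM).tendsto.comp hlim))
  have hsmall : ∀ᶠ s : ℝ in 𝓝[≠] 0, ‖s • (z - π z)‖ < ρ := by
    have : Continuous fun s : ℝ => ‖s • (z - π z)‖ := by fun_prop
    have := (this.tendsto 0).mono_left (nhdsWithin_le_nhds (s := {0}ᶜ))
    exact this.eventually_lt_const (by simpa using h.pos)
  refine tendsto_nhds_unique h1 (tendsto_const_nhds.congr' ?_)
  filter_upwards [hsmall, self_mem_nhdsWithin] with s hs hs0
  have h2 := h.fderiv_comp_fderiv hz hs e
  rw [he, zero_add, sub_zero, map_smul] at h2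
  exact ((smul_eq_zero.1 h2).resolve_left hs0).symm

/-- The Jacobian of the tube coordinates at a point `z` over their base point is bounded from above
and from below. -/
theorem det_mem_Icc (h : IsFootMap M ρ π) {z : E n} (hz : z ∈ tube M ρ)
    (hzρ : 2 * ‖z - π z‖ ≤ ρ) :
    (fderiv ℝ π z + (ContinuousLinearMap.id ℝ (E n) - fderiv ℝ π (π z))).det ∈
      Icc ((1 / 2 : ℝ) ^ n) (2 ^ n) := by
  have hzM := h.self_mem (h.apply_mem hz)
  set B := fderiv ℝ π z + (ContinuousLinearMap.id ℝ (E n) - fderiv ℝ π (π z)) with hB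
  have hBv : ∀ v, B v = fderiv ℝ π z v + (v - fderiv ℝ π (π z) v) := fun v => rfl
  have hsymm : (B : E n →ₗ[ℝ] E n).IsSymmetric := by
    intro v w
    change inner ℝ (B v) w = inner ℝ v (B w)
    rw [hBv, hBv, inner_add_left, inner_sub_left, inner_add_right, inner_sub_right,
      h.inner_fderiv_comm hz, h.inner_fderiv_comm hzM]
  have hn : Module.finrank ℝ (E n) = n := by simp
  have hfoot : π (π z) = π z := h.apply_self (h.apply_mem hz)
  have hidem : ∀ v, fderiv ℝ π (π z) (fderiv ℝ π (π z) v) = fderiv ℝ π (π z) v := fun v => by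
    have := h.fderiv_foot_comp hzM v
    rwa [hfoot] at this
  have hev : ∀ i, hsymm.eigenvalues hn i ∈ Icc (1 / 2 : ℝ) 2 := by
    intro i
    set m := hsymm.eigenvalues hn i with hm
    set e := hsymm.eigenvectorBasis hn i with hedef
    have he : e ≠ 0 := (hsymm.eigenvectorBasis hn).orthonormal.ne_zero i
    have hme : B e = m • e := hsymm.apply_eigenvectorBasis hn i
    -- An eigenvector of `B` with eigenvalue m ≠ 1 turns out to be tangent to M at πz. It is then an
    -- eigenvector of the differential of π at z with the same eigenvalue, and m = 0 is excluded
    -- because a tangent vector killed at z would also be killed at πz.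
    by_cases hm1 : m = 1
    · rw [hm1]; norm_num
    have h1 : fderiv ℝ π z e = m • fderiv ℝ π (π z) e := by
      rw [← map_smul, ← hme, hBv, map_add, map_sub, hidem, h.fderiv_foot_comp hz, sub_self,
        add_zero]
    have h2 : fderiv ℝ π (π z) e = e := by
      have h3 : (m - 1) • (e - fderiv ℝ π (π z) e) = 0 := by
        have h4 := hBv e
        rw [hme, h1] at h4
        have : (m - 1) • (e - fderiv ℝ π (π z) e) =
          m • e - (m • fderiv ℝ π (π z) e + (e - fderiv ℝ π (π z) e)) := by module
        rw [this, ← h4, sub_self]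
      have := (smul_eq_zero.1 h3).resolve_left (sub_ne_zero.2 hm1)
      exact (sub_eq_zero.1 this).symm
    rw [h2] at h1
    refine h.eigenvalue_mem_Icc hz hzρ ?_ he h1
    intro hm0
    rw [hm0, zero_smul] at h1
    exact he (h2 ▸ h.eq_zero_of_fderiv_eq_zero hz h1)
  have hdet : B.det = ∏ i, hsymm.eigenvalues hn i := by
    have := hsymm.det_eq_prod_eigenvalues hn
    simpa [ContinuousLinearMap.det] using this
  rw [hdet]
  constructor
  · calc (1 / 2 : ℝ) ^ n = ∏ i : Fin n, (1 / 2 : ℝ) := by simp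
      _ ≤ _ := Finset.prod_le_prod (fun i _ => by norm_num) fun i _ => (hev i).1
  · calc _ ≤ ∏ i : Fin n, (2 : ℝ) :=
          Finset.prod_le_prod (fun i _ => by linarith [(hev i).1]) fun i _ => (hev i).2
      _ = _ := by simp

end IsFootMap

end TubeComparison

/-! ### The dimension of the normal spaces -/

namespace TubeComparison

/-- The curve is only differentiable at 0, so its chart representation cannot be differentiated
directly. Instead, let `B` be a left inverse of the differential A of the parametrization and R = I
- AB. Since `φ` is a homeomorphism for the subspace topology, φ(c s) tends to φ(p), and the
first-order expansion of the parametrization gives R(c s - p) = o(|c s - p|) = o(s). Hence Rw = 0,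
that is, w = A(Bw). -/
theorem mem_range_fderiv_param {n d : ℕ} {M : Set (E n)} {φ : OpenPartialHomeomorph M (E d)}
    (hφ : IsSmoothChart φ) {p : M} (hp : p ∈ φ.source) {c : ℝ → E n} {w : E n} (hc0 : c 0 = p)
    (hcM : ∀ᶠ s in 𝓝 (0 : ℝ), c s ∈ M) (hc : HasDerivAt c w 0) :
    w ∈ LinearMap.range (fderiv ℝ (param φ) (φ p) : E d →ₗ[ℝ] E n) := by
  set x₀ := φ p with hx₀
  have hx₀t : x₀ ∈ φ.target := φ.map_source hp
  set A := fderiv ℝ (param φ) x₀ with hA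
  have hder : HasFDerivAt (param φ) A x₀ :=
    ((hφ.1.contDiffAt (φ.open_target.mem_nhds hx₀t)).differentiableAt (by simp)).hasFDerivAt
  have hpx : param φ x₀ = p := by simp [param, hx₀, φ.left_inv hp]
  obtain ⟨B₀, hB₀⟩ := (A : E d →ₗ[ℝ] E n).exists_leftInverse_of_injective
    (LinearMap.ker_eq_bot.2 (hφ.2 x₀ hx₀t))
  let B : E n →L[ℝ] E d := LinearMap.toContinuousLinearMap B₀
  have hBA : ∀ v, B (A v) = v := fun v => LinearMap.congr_fun hB₀ v
  let R : E n →L[ℝ] E n := ContinuousLinearMap.id ℝ (E n) - A.comp B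
  have hRA : ∀ v, R (A v) = 0 := fun v => by simp [R, hBA]
  suffices hRw : R w = 0 from ⟨B w, (sub_eq_zero.1 hRw).symm⟩
  have hcont : Filter.Tendsto c (𝓝 0) (𝓝 p) := hc0 ▸ hc.continuousAt.tendsto
  have hO : (fun s => R (c s - p)) =o[𝓝 0] fun s => c s - (p : E n) := by
    rw [Asymptotics.isLittleO_iff]
    intro ε hε
    -- the remainder of `param φ` at `x₀` is smaller than `δ ‖x - x₀‖`
    obtain ⟨δ, hδ, hδ1, hδ2⟩ : ∃ δ > 0, ‖B‖ * δ ≤ 1 / 2 ∧ ‖R‖ * (δ * (2 * ‖B‖)) ≤ ε := by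
      have h1 : ∀ᶠ δ in 𝓝[>] (0 : ℝ), ‖B‖ * δ < 1 / 2 := by
        have : Continuous fun δ : ℝ => ‖B‖ * δ := by fun_prop
        exact ((this.tendsto 0).mono_left nhdsWithin_le_nhds).eventually_lt_const (by simp)
      have h2 : ∀ᶠ δ in 𝓝[>] (0 : ℝ), ‖R‖ * (δ * (2 * ‖B‖)) < ε := by
        have : Continuous fun δ : ℝ => ‖R‖ * (δ * (2 * ‖B‖)) := by fun_prop
        exact ((this.tendsto 0).mono_left nhdsWithin_le_nhds).eventually_lt_const (by simpa)
      obtain ⟨δ, h1, h2, h3⟩ := (h1.and (h2.and self_mem_nhdsWithin)).exists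
      exact ⟨δ, h3, h1.le, h2.le⟩
    have hrem := Asymptotics.isLittleO_iff.1 hder.isLittleO hδ
    have hnear : ∀ᶠ m : M in 𝓝 p, m ∈ φ.source ∧
        ‖param φ (φ m) - param φ x₀ - A (φ m - x₀)‖ ≤ δ * ‖φ m - x₀‖ :=
      Filter.Eventually.and (φ.open_source.mem_nhds hp) ((φ.continuousAt hp).eventually hrem)
    rw [nhds_subtype_eq_comap, Filter.eventually_comap] at hnear
    filter_upwards [hcont.eventually hnear, hcM] with s hs hsM
    obtain ⟨hsrc, hle⟩ := hs ⟨c s, hsM⟩ rfl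
    set x := φ ⟨c s, hsM⟩ with hx
    have hpc : param φ x = c s := by simp [param, hx, φ.left_inv hsrc]
    rw [hpc, hpx] at hle
    -- The left inverse makes the chart coordinates Lipschitz at p: the remainder contributes at
    -- most half of ‖x - x₀‖ because ‖B‖δ ≤ 1/2, and is absorbed.
    have hxx : ‖x - x₀‖ ≤ 2 * ‖B‖ * ‖c s - p‖ := by
      have h1 : x - x₀ = B (c s - p) - B (c s - p - A (x - x₀)) := by
        rw [map_sub B (c s - p) (A (x - x₀)), hBA]; abel
      have h2 : ‖x - x₀‖ ≤ ‖B‖ * ‖c s - p‖ + ‖B‖ * (δ * ‖x - x₀‖) := by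
        calc ‖x - x₀‖ = ‖B (c s - p) - B (c s - p - A (x - x₀))‖ := by rw [← h1]
          _ ≤ ‖B (c s - p)‖ + ‖B (c s - p - A (x - x₀))‖ := norm_sub_le _ _
          _ ≤ _ := add_le_add (B.le_opNorm _) ((B.le_opNorm _).trans (by gcongr))
      nlinarith [norm_nonneg (x - x₀)]
    calc ‖R (c s - p)‖ = ‖R (c s - p - A (x - x₀))‖ := by rw [map_sub R _ (A _), hRA, sub_zero]
      _ ≤ ‖R‖ * (δ * ‖x - x₀‖) := (R.le_opNorm _).trans (by gcongr)
      _ ≤ ‖R‖ * (δ * (2 * ‖B‖ * ‖c s - p‖)) := by gcongr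
      _ = ‖R‖ * (δ * (2 * ‖B‖)) * ‖c s - p‖ := by ring
      _ ≤ ε * ‖c s - p‖ := by gcongr
  have hbig : (fun s => c s - (p : E n)) =O[𝓝 0] fun s : ℝ => s := by
    simpa [hc0] using hc.hasFDerivAt.isBigO_sub
  have h0 : HasDerivAt (fun s => R (c s - p)) 0 0 := by
    rw [hasDerivAt_iff_isLittleO]
    simpa [hc0] using hO.trans_isBigO hbig
  have h1 : HasDerivAt (fun s => R (c s - p)) (R w) 0 :=
    R.hasFDerivAt.comp_hasDerivAt (0 : ℝ) (hc.sub_const _)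
  exact h1.unique h0

theorem tangentSpaceAt_eq_range {n d : ℕ} {M : Set (E n)} {φ : OpenPartialHomeomorph M (E d)}
    (hφ : IsSmoothChart φ) {p : M} (hp : p ∈ φ.source) :
    tangentSpaceAt M p = LinearMap.range (fderiv ℝ (param φ) (φ p) : E d →ₗ[ℝ] E n) := by
  apply le_antisymm
  · refine Submodule.span_le.2 ?_
    rintro w ⟨c, hc0, hcM, hc⟩
    exact mem_range_fderiv_param hφ hp hc0 hcM hc
  · rintro _ ⟨v, rfl⟩
    have hx₀t : φ p ∈ φ.target := φ.map_source hp
    have hder : HasFDerivAt (param φ) (fderiv ℝ (param φ) (φ p)) (φ p + (0 : ℝ) • v) := by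
      rw [zero_smul, add_zero]
      exact ((hφ.1.contDiffAt (φ.open_target.mem_nhds hx₀t)).differentiableAt
        (by simp)).hasFDerivAt
    have hline : HasDerivAt (fun s : ℝ => φ p + s • v) v 0 := by
      simpa using ((hasDerivAt_id (0 : ℝ)).smul_const v).const_add (φ p)
    refine Submodule.subset_span ⟨fun s : ℝ => param φ (φ p + s • v), ?_, ?_, ?_⟩
    · simp [param, φ.left_inv hp]
    · exact Filter.Eventually.of_forall fun s => (φ.symm _).2
    · exact hder.comp_hasDerivAt (0 : ℝ) hline

theorem finrank_normalSpace {n k : ℕ} (hkn : k ≤ n) {M : Set (E n)}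
    (hM : IsSmoothSubmanifold (n - k) M) {p : E n} (hp : p ∈ M) :
    Module.finrank ℝ (normalSpace M p) = k := by
  obtain ⟨φ, hpφ, hφ⟩ := hM ⟨p, hp⟩
  have h1 := tangentSpaceAt_eq_range hφ hpφ
  have h2 : Module.finrank ℝ (tangentSpaceAt M p) = n - k := by
    rw [h1, LinearMap.finrank_range_of_inj (hφ.2 _ (φ.map_source hpφ))]
    simp
  have h3 := (tangentSpaceAt M p).finrank_add_finrank_orthogonal
  rw [h2, finrank_euclideanSpace_fin] at h3
  change Module.finrank ℝ (tangentSpaceAt M p)ᗮ = k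
  omega

end TubeComparison

/-! ### Comparison of integrals over a tube and over its slices -/

namespace TubeComparison

/-- Fubini's theorem for the decomposition of a Euclidean space into a subspace and its
orthogonal complement. -/
theorem lintegral_le_of_forall_slice {V : Type*} [NormedAddCommGroup V] [InnerProductSpace ℝ V]
    [FiniteDimensional ℝ V] [MeasurableSpace V] [BorelSpace V] (K : Submodule ℝ V)
    {g₁ g₂ : V → ℝ≥0∞} (hg₁ : Measurable g₁) (hg₂ : Measurable g₂) {C : ℝ≥0∞}
    (h : ∀ ξ : Kᗮ, ∫⁻ η : K, g₁ (ξ + η) ≤ C * ∫⁻ η : K, g₂ (ξ + η)) :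
    ∫⁻ x, g₁ x ≤ C * ∫⁻ x, g₂ x := by
  have hmp : MeasurePreserving (fun x : K × Kᗮ => (x.1 : V) + x.2) := by
    have h1 := K.orthogonalDecomposition.symm.measurePreserving.comp
      (WithLp.volume_preserving_toLp (U := K) (V := Kᗮ))
    convert! h1 using 1
  have key : ∀ g : V → ℝ≥0∞, Measurable g →
      ∫⁻ x, g x = ∫⁻ ξ : Kᗮ, ∫⁻ η : K, g (ξ + η) := fun g hg => by
    have hm : Measurable fun x : K × Kᗮ => g ((x.1 : V) + x.2) := hg.comp hmp.measurable
    rw [← hmp.lintegral_comp hg]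
    change ∫⁻ x : K × Kᗮ, g ((x.1 : V) + x.2) ∂(volume.prod volume) = _
    rw [lintegral_prod_symm _ hm.aemeasurable]
    simp only [add_comm]
  rw [key g₁ hg₁, key g₂ hg₂, ← lintegral_const_mul]
  · exact lintegral_mono h
  · have hm : Measurable fun x : Kᗮ × K => g₂ ((x.1 : V) + x.2) := hg₂.comp (by fun_prop)
    exact hm.lintegral_prod_right'

/-- A linear isomorphism multiplies integrals by a constant. -/
theorem exists_lintegral_comp_linearEquiv {V W : Type*} [NormedAddCommGroup V]
    [InnerProductSpace ℝ V] [FiniteDimensional ℝ V] [MeasurableSpace V] [BorelSpace V]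
    [NormedAddCommGroup W] [InnerProductSpace ℝ W] [FiniteDimensional ℝ W] [MeasurableSpace W]
    [BorelSpace W] (A : V ≃L[ℝ] W) :
    ∃ c : ℝ≥0∞, ∀ g : W → ℝ≥0∞, ∫⁻ x, g x = c * ∫⁻ y, g (A y) := by
  let μ : Measure W := Measure.map A volume
  have hμ : μ.IsAddHaarMeasure := A.isAddHaarMeasure_map volume
  refine ⟨Measure.addHaarScalarFactor volume μ, fun g => ?_⟩
  have h1 : (volume : Measure W) = Measure.addHaarScalarFactor volume μ • μ :=
    Measure.isAddLeftInvariant_eq_smul _ _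
  have h2 : ∫⁻ y, g (A y) = ∫⁻ x, g x ∂μ :=
    (A.toHomeomorph.measurableEmbedding.lintegral_map g).symm
  rw [h2]
  conv_lhs => rw [h1]
  rw [lintegral_smul_measure]
  rfl

/-- Coordinates of the tube around a base point with foot point differential `P`: the foot point and
the normal vector are projected to the tangent and to the normal space at the base point. -/
noncomputable def tubeChart {n : ℕ} (π : E n → E n) (P : E n →L[ℝ] E n) (z : E n) : E n :=
  P (π z) + ((z - π z) - P (z - π z))

/-- The differential of `tubeChart`. -/
noncomputable def tubeChartDeriv {n : ℕ} (π : E n → E n) (P : E n →L[ℝ] E n) (z : E n) : E n →L[ℝ] E n :=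
  P.comp (fderiv ℝ π z) + ((ContinuousLinearMap.id ℝ (E n) - fderiv ℝ π z) -
    P.comp (ContinuousLinearMap.id ℝ (E n) - fderiv ℝ π z))

namespace IsFootMap

variable {n : ℕ} {M : Set (E n)} {ρ : ℝ} {π : E n → E n}

theorem hasFDerivAt_tubeChart (h : IsFootMap M ρ π) (P : E n →L[ℝ] E n) {z : E n}
    (hz : z ∈ tube M ρ) : HasFDerivAt (tubeChart π P) (tubeChartDeriv π P z) z := by
  have h1 := h.hasFDerivAt hz
  have h2 : HasFDerivAt (fun z => z - π z) (ContinuousLinearMap.id ℝ (E n) - fderiv ℝ π z) z :=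
    (hasFDerivAt_id z).sub h1
  exact (P.hasFDerivAt.comp z h1).add (h2.sub (P.hasFDerivAt.comp z h2))

theorem tubeChart_add (h : IsFootMap M ρ π) (P : E n →L[ℝ] E n) {p y : E n} (hp : p ∈ M)
    (hy : y ∈ normalSpace M p) (hyρ : ‖y‖ < ρ) : tubeChart π P (p + y) = P p + (y - P y) := by
  simp [tubeChart, h.apply_add hp hy hyρ]

theorem fderiv_idem (h : IsFootMap M ρ π) {p : E n} (hp : p ∈ M) (v : E n) :
    fderiv ℝ π p (fderiv ℝ π p v) = fderiv ℝ π p v := by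
  have := h.fderiv_foot_comp (h.self_mem hp) v
  rwa [h.apply_self hp] at this

theorem sub_fderiv_mem_normalSpace (h : IsFootMap M ρ π) {p : E n} (hp : p ∈ M) (y : E n) :
    y - fderiv ℝ π p y ∈ normalSpace M p :=
  (h.mem_normalSpace_iff hp).2 (by rw [map_sub, h.fderiv_idem hp, sub_self])

theorem norm_sub_fderiv_le (h : IsFootMap M ρ π) {p : E n} (hp : p ∈ M) (y : E n) :
    ‖y - fderiv ℝ π p y‖ ≤ ‖y‖ := by
  rw [← sq_le_sq₀ (norm_nonneg _) (norm_nonneg _)]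
  have h9 : inner ℝ y (fderiv ℝ π p y) = inner ℝ (fderiv ℝ π p y) (fderiv ℝ π p y) := by
    rw [h.inner_fderiv_comm (h.self_mem hp), h.fderiv_idem hp]
  rw [norm_sub_sq_real, h9, real_inner_self_eq_norm_sq]
  nlinarith [sq_nonneg ‖fderiv ℝ π p y‖]

/-- The difference of x and its projection is normal, hence orthogonal to x, and it is orthogonal to
the projection by symmetry; so it is orthogonal to itself. This avoids identifying the double
orthogonal complement with the tangent space. -/
theorem fderiv_apply_of_mem_orthogonal (h : IsFootMap M ρ π) {p : E n} (hp : p ∈ M) {x : E n}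
    (hx : x ∈ (normalSpace M p)ᗮ) : fderiv ℝ π p x = x := by
  have h0 : fderiv ℝ π p (x - fderiv ℝ π p x) = 0 := by
    rw [map_sub, h.fderiv_idem hp, sub_self]
  have h1 : x - fderiv ℝ π p x ∈ normalSpace M p := (h.mem_normalSpace_iff hp).2 h0
  have h2 : inner ℝ (x - fderiv ℝ π p x) x = 0 := Submodule.inner_right_of_mem_orthogonal h1 hx
  have h3 : inner ℝ (x - fderiv ℝ π p x) (x - fderiv ℝ π p x) = (0 : ℝ) := by
    rw [inner_sub_right, h2, ← h.inner_fderiv_comm (h.self_mem hp), h0, inner_zero_left, sub_zero]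
  exact (sub_eq_zero.1 (inner_self_eq_zero.1 h3)).symm

/-- A neighbourhood of a point of `M` over which `tubeChart` is injective with a controlled
Jacobian. -/
theorem exists_chart_nhds (h : IsFootMap M ρ π) {p₀ : E n} (hp₀ : p₀ ∈ M) :
    ∃ U : Set (E n), IsOpen U ∧ p₀ ∈ U ∧
      (∀ p ∈ M ∩ U, ∀ p' ∈ M ∩ U, fderiv ℝ π p₀ p = fderiv ℝ π p₀ p' → p = p') ∧
      (∀ p ∈ M ∩ U, ‖fderiv ℝ π p - fderiv ℝ π p₀‖ ≤ 1 / 2) ∧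
      ∀ p ∈ M ∩ U, ∀ y ∈ normalSpace M p, 4 * ‖y‖ ≤ ρ →
        |(tubeChartDeriv π (fderiv ℝ π p₀) (p + y)).det| ∈ Icc ((1 / 4 : ℝ) ^ n) (4 ^ n) := by
  have hp₀t := h.self_mem hp₀
  set P := fderiv ℝ π p₀ with hP
  -- For n = 0 the open interval between (1/4)^n and 4^n, used below to make the Jacobian bound an
  -- open condition, is empty.
  rcases Nat.eq_zero_or_pos n with rfl | hn
  · refine ⟨univ, isOpen_univ, mem_univ _, fun _ _ _ _ _ => Subsingleton.elim _ _, fun p _ => ?_,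
      fun p _ y _ _ => ?_⟩
    · rw [Subsingleton.elim (fderiv ℝ π p - P) 0, norm_zero]; norm_num
    · rw [Subsingleton.elim (tubeChartDeriv π P (p + y)) (ContinuousLinearMap.id ℝ (E 0))]
      simp [ContinuousLinearMap.det]
  -- injectivity
  have hstrict : HasStrictFDerivAt π P p₀ := (h.contDiffAt hp₀t).hasStrictFDerivAt (by simp)
  have h1 : ∀ᶠ x : E n × E n in 𝓝 p₀ ×ˢ 𝓝 p₀,
      ‖π x.1 - π x.2 - P (x.1 - x.2)‖ ≤ 1 / 2 * ‖x.1 - x.2‖ := by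
    rw [← nhds_prod_eq]
    exact hstrict.isLittleO.def (show (0 : ℝ) < 1 / 2 by norm_num)
  obtain ⟨U₁, hU₁, U₂, hU₂, h12⟩ := Filter.eventually_prod_iff.1 h1
  -- the compact ball in the normal space at the base point
  let B : Set (E n) := (fun y : E n => p₀ + y) '' ((normalSpace M p₀ : Set (E n)) ∩
    Metric.closedBall 0 (ρ / 4))
  have hB : IsCompact B := by
    refine IsCompact.image ?_ (by fun_prop)
    exact (isCompact_closedBall _ _).inter_left (Submodule.closed_of_finiteDimensional _)
  have hBρ : ∀ y ∈ (normalSpace M p₀ : Set (E n)) ∩ Metric.closedBall 0 (ρ / 4),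
      ‖y‖ < ρ := fun y hy => by
    have := hy.2
    rw [mem_closedBall_zero_iff] at this
    linarith [h.pos]
  -- On the slice at p₀ the Jacobian lies between (1/2)^n and 2^n. The larger open interval leaves
  -- room to pass to a neighbourhood of the compact set `B`.
  let O : Set (E n) := {z ∈ tube M ρ |
    |(tubeChartDeriv π P z).det| ∈ Ioo ((1 / 4 : ℝ) ^ n) (4 ^ n)}
  have hO : IsOpen O := by
    have hc : ContinuousOn (fun z => |(tubeChartDeriv π P z).det|) (tube M ρ) := by
      intro z hz
      refine ContinuousAt.continuousWithinAt ?_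
      have h2 : ContinuousAt (fun z => tubeChartDeriv π P z) z := by
        have := h.continuousAt_fderiv hz
        unfold tubeChartDeriv
        fun_prop
      exact (ContinuousLinearMap.continuous_det.continuousAt.comp h2).abs
    exact hc.isOpen_inter_preimage h.isOpen isOpen_Ioo
  have hBO : B ⊆ O := by
    rintro _ ⟨y, hy, rfl⟩
    have hyρ := hBρ y hy
    have hmem : p₀ + y ∈ tube M ρ := add_mem_tube hp₀ hy.1 hyρ
    have hfoot : π (p₀ + y) = p₀ := h.apply_add hp₀ hy.1 hyρ
    refine ⟨hmem, ?_⟩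
    -- Over the base point itself P fixes the range of the differential of π, so the chart
    -- differential reduces to the map of `det_mem_Icc`.
    have heq : tubeChartDeriv π P (p₀ + y) = fderiv ℝ π (p₀ + y) +
        (ContinuousLinearMap.id ℝ (E n) - fderiv ℝ π (π (p₀ + y))) := by
      ext1 v
      have h3 := h.fderiv_foot_comp hmem v
      rw [hfoot] at h3
      rw [hfoot]
      simp [tubeChartDeriv, ← hP] at h3 ⊢
      rw [h3]; abel
    have hd := h.det_mem_Icc hmem (by
      have := hy.2
      rw [mem_closedBall_zero_iff] at this
      rw [hfoot, add_sub_cancel_left]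
      linarith [h.pos])
    rw [← heq] at hd
    have h4 : (0 : ℝ) < (1 / 2) ^ n := by positivity
    rw [abs_of_pos (h4.trans_le hd.1)]
    refine ⟨lt_of_lt_of_le ?_ hd.1, lt_of_le_of_lt hd.2 ?_⟩
    · exact pow_lt_pow_left₀ (by norm_num) (by norm_num) hn.ne'
    · exact pow_lt_pow_left₀ (by norm_num) (by norm_num) hn.ne'
  obtain ⟨δ, hδ, hδO⟩ := hB.exists_thickening_subset_open hO hBO
  have hρ := h.pos
  have h5 : ∀ᶠ p in 𝓝 p₀, ‖fderiv ℝ π p - P‖ < min (1 / 2) (δ / (2 * ρ)) := by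
    have : ContinuousAt (fun p => ‖fderiv ℝ π p - P‖) p₀ :=
      ((h.continuousAt_fderiv hp₀t).sub continuousAt_const).norm
    refine this.eventually_lt_const ?_
    simp only [← hP, sub_self, norm_zero]
    positivity
  have h6 : ∀ᶠ p in 𝓝 p₀, p ∈ Metric.ball p₀ (δ / 2) := Metric.ball_mem_nhds _ (by positivity)
  obtain ⟨U, hUsub, hUo, hUp⟩ := eventually_nhds_iff.1 (hU₁.and (hU₂.and (h5.and h6)))
  refine ⟨U, hUo, hUp, ?_, ?_, ?_⟩
  · rintro p ⟨hp, hpU⟩ p' ⟨hp', hp'U⟩ hpp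
    have h7 : ‖π p - π p' - P (p - p')‖ ≤ 1 / 2 * ‖p - p'‖ :=
      h12 (hUsub p hpU).1 (hUsub p' hp'U).2.1
    rw [h.apply_self hp, h.apply_self hp', map_sub, hpp, sub_self, sub_zero] at h7
    have : ‖p - p'‖ ≤ 0 := by linarith
    exact sub_eq_zero.1 (norm_le_zero_iff.1 this)
  · rintro p ⟨hp, hpU⟩
    exact ((hUsub p hpU).2.2.1.trans_le (min_le_left _ _)).le
  · rintro p ⟨hp, hpU⟩ y hy hyρ
    have hmem : p + y ∈ O := by
      refine hδO (Metric.mem_thickening_iff.2 ⟨p₀ + (y - P y), ⟨y - P y, ⟨?_, ?_⟩, rfl⟩, ?_⟩)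
      · exact h.sub_fderiv_mem_normalSpace hp₀ y
      · rw [mem_closedBall_zero_iff]
        have := h.norm_sub_fderiv_le hp₀ y
        linarith
      -- As y is normal at p, Py only measures how far the normal space has turned between p₀ and p;
      -- hence p + y is close to the point p₀ + (y - Py) of `B`.
      · have h11 : P y = (P - fderiv ℝ π p) y := by
          simp [(h.mem_normalSpace_iff hp).1 hy]
        have h12 : ‖P y‖ ≤ δ / 2 * (1 / 4) := by
          rw [h11]
          refine ((P - fderiv ℝ π p).le_opNorm y).trans ?_
          rw [norm_sub_rev]
          calc ‖fderiv ℝ π p - P‖ * ‖y‖ ≤ δ / (2 * ρ) * (ρ / 4) := by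
                have := (hUsub p hpU).2.2.1.trans_le (min_le_right _ _)
                gcongr
                linarith
            _ = δ / 2 * (1 / 4) := by field_simp
        have h13 : ‖p - p₀‖ < δ / 2 := mem_ball_iff_norm.1 (hUsub p hpU).2.2.2
        rw [dist_eq_norm]
        calc ‖p + y - (p₀ + (y - P y))‖ = ‖(p - p₀) + P y‖ := by congr 1; abel
          _ ≤ ‖p - p₀‖ + ‖P y‖ := norm_add_le _ _
          _ < δ := by linarith
    exact ⟨hmem.2.1.le, hmem.2.2.le⟩

end IsFootMap

end TubeComparison

/-! ### Slice comparison over small pieces of `M` and its globalization. -/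

namespace TubeComparison

namespace IsFootMap

variable {n : ℕ} {M : Set (E n)} {ρ : ℝ} {π : E n → E n}

theorem measurableSet_tube (h : IsFootMap M ρ π) {ε : ℝ} (hε : ε ≤ ρ) :
    MeasurableSet (tube M ε) := by
  have h1 : tube M ε = tube M ρ ∩ (fun z => ‖z - π z‖) ⁻¹' Iio ε := by
    ext z
    constructor
    · intro hz
      have := tube_mono hε hz
      exact ⟨this, (h.mem_tube_iff_norm hε this).1 hz⟩
    · rintro ⟨hz, hz'⟩
      exact (h.mem_tube_iff_norm hε hz).2 hz'
  rw [h1]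
  have hc : ContinuousOn (fun z => ‖z - π z‖) (tube M ρ) :=
    (continuousOn_id.sub h.smooth.continuousOn).norm
  exact (hc.isOpen_inter_preimage h.isOpen isOpen_Iio).measurableSet

theorem measurableSet_tube_inter_preimage (h : IsFootMap M ρ π) {ε : ℝ} (hε : ε ≤ ρ)
    {S : Set (E n)} (hS : MeasurableSet S) : MeasurableSet (tube M ε ∩ π ⁻¹' S) := by
  classical
  have hm : Measurable ((tube M ρ).piecewise π fun _ => 0) :=
    h.smooth.continuousOn.measurable_piecewise continuousOn_const h.isOpen.measurableSet
  have h1 : tube M ε ∩ π ⁻¹' S = tube M ε ∩ ((tube M ρ).piecewise π fun _ => 0) ⁻¹' S := by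
    ext z
    refine and_congr_right fun hz => ?_
    rw [mem_preimage, mem_preimage, piecewise_eq_of_mem _ _ _ (tube_mono hε hz)]
  rw [h1]
  exact (h.measurableSet_tube hε).inter (hm hS)

/-- Near a base point the normal spaces are projected isomorphically to the normal space at the
base point. -/
theorem exists_normalSpace_equiv (h : IsFootMap M ρ π) {p₀ p : E n} (hp₀ : p₀ ∈ M) (hp : p ∈ M)
    (hpp : ‖fderiv ℝ π p - fderiv ℝ π p₀‖ ≤ 1 / 2) :
    ∃ A : normalSpace M p ≃L[ℝ] normalSpace M p₀,
      ∀ y : normalSpace M p, (A y : E n) = y - fderiv ℝ π p₀ y := by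
  -- A vector normal at p whose normal part at p' vanishes has at most half of its own norm, so it
  -- is zero. The roles of the two points are symmetric, which gives equality of dimensions.
  have hinj : ∀ p ∈ M, ∀ p' ∈ M, ‖fderiv ℝ π p - fderiv ℝ π p'‖ ≤ 1 / 2 →
      ∃ A : normalSpace M p →ₗ[ℝ] normalSpace M p', Function.Injective A ∧
        ∀ y : normalSpace M p, (A y : E n) = y - fderiv ℝ π p' y := by
    intro p hp p' hp' hpp
    let A : normalSpace M p →ₗ[ℝ] normalSpace M p' :=
      (((ContinuousLinearMap.id ℝ (E n) - fderiv ℝ π p' : E n →L[ℝ] E n) : E n →ₗ[ℝ] E n).comp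
        (normalSpace M p).subtype).codRestrict _ fun y => h.sub_fderiv_mem_normalSpace hp' y
    refine ⟨A, (injective_iff_map_eq_zero A).2 fun y hy => ?_, fun y => rfl⟩
    have h1 : (y : E n) - fderiv ℝ π p' y = 0 := congrArg Subtype.val hy
    have h2 : fderiv ℝ π p y = 0 := (h.mem_normalSpace_iff hp).1 y.2
    have h3 : (y : E n) = -((fderiv ℝ π p - fderiv ℝ π p') y) := by
      simp [h2, ← sub_eq_zero.1 h1]
    have h4 : ‖(y : E n)‖ ≤ 1 / 2 * ‖(y : E n)‖ := by
      calc ‖(y : E n)‖ = ‖(fderiv ℝ π p - fderiv ℝ π p') y‖ := by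
            conv_lhs => rw [h3, norm_neg]
        _ ≤ ‖fderiv ℝ π p - fderiv ℝ π p'‖ * ‖(y : E n)‖ := ContinuousLinearMap.le_opNorm _ _
        _ ≤ _ := by gcongr
    have h5 : ‖(y : E n)‖ ≤ 0 := by linarith
    exact Subtype.ext (norm_le_zero_iff.1 h5)
  obtain ⟨A, hA, hA'⟩ := hinj p hp p₀ hp₀ hpp
  obtain ⟨B, hB, -⟩ := hinj p₀ hp₀ p hp (by rwa [norm_sub_rev])
  have hdim : Module.finrank ℝ (normalSpace M p) = Module.finrank ℝ (normalSpace M p₀) :=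
    le_antisymm (LinearMap.finrank_le_finrank_of_injective hA)
      (LinearMap.finrank_le_finrank_of_injective hB)
  exact ⟨(LinearEquiv.ofInjectiveOfFinrankEq A hA hdim).toContinuousLinearEquiv, fun y => hA' y⟩

/-- The slice comparison over a small piece of `M`. -/
theorem lintegral_le_of_forall_slice_local (h : IsFootMap M ρ π) {p₀ : E n} (hp₀ : p₀ ∈ M) :
    ∃ U : Set (E n), IsOpen U ∧ p₀ ∈ U ∧ ∀ S ⊆ U, MeasurableSet S → ∀ ε : ℝ, 4 * ε ≤ ρ →
      ∀ (h₁ h₂ : E n → ℝ≥0∞) (C : ℝ≥0∞), Measurable h₁ → Measurable h₂ →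
      (∀ p ∈ M, ∫⁻ y in {y : normalSpace M p | ‖y‖ < ε}, h₁ (p + y) ≤
        C * ∫⁻ y in {y : normalSpace M p | ‖y‖ < ε}, h₂ (p + y)) →
      ∫⁻ z in tube M ε ∩ π ⁻¹' S, h₁ z ≤ 16 ^ n * C * ∫⁻ z in tube M ε ∩ π ⁻¹' S, h₂ z := by
  obtain ⟨U, hU, hp₀U, hinj, hnear, hdet⟩ := h.exists_chart_nhds hp₀
  refine ⟨U, hU, hp₀U, fun S hSU hS ε hε h₁ h₂ C hh₁ hh₂ hslice => ?_⟩
  have hρ := h.pos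
  have hερ : ε ≤ ρ := by linarith
  set P := fderiv ℝ π p₀ with hP
  set Ψ := tubeChart π P with hΨ
  set D := tube M ε ∩ π ⁻¹' S with hD
  have hDm : MeasurableSet D := h.measurableSet_tube_inter_preimage hερ hS
  -- points of `D` and their images
  have hDmem : ∀ {p y : E n}, p ∈ M → p ∈ S → y ∈ normalSpace M p → ‖y‖ < ε → p + y ∈ D :=
    fun hp hpS hy hyε => ⟨add_mem_tube hp hy hyε, by
      rw [mem_preimage, h.apply_add hp hy (hyε.trans_le hερ)]; exact hpS⟩
  have hDrep : ∀ z ∈ D, ∃ p ∈ M, p ∈ S ∧ ∃ y ∈ normalSpace M p, ‖y‖ < ε ∧ z = p + y ∧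
      Ψ z = P p + (y - P y) := by
    rintro z ⟨hz, hzS⟩
    have hzρ := tube_mono hερ hz
    have hzε := (h.mem_tube_iff_norm hερ hzρ).1 hz
    refine ⟨π z, h.apply_mem hzρ, hzS, z - π z, h.sub_mem hzρ, hzε, by abel, rfl⟩
  have hPP : ∀ p y : E n, P (P p + (y - P y)) = P p := fun p y => by
    rw [map_add, map_sub, hP, h.fderiv_idem hp₀, h.fderiv_idem hp₀, sub_self, add_zero]
  have hrep_inj : ∀ p ∈ M, p ∈ S → ∀ p' ∈ M, p' ∈ S → ∀ y ∈ normalSpace M p,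
      ∀ y' ∈ normalSpace M p', P p + (y - P y) = P p' + (y' - P y') → p = p' ∧ y = y' := by
    intro p hp hpS p' hp' hp'S y hy y' hy' heq
    have h1 : P p = P p' := by rw [← hPP p y, heq, hPP]
    have h2 : p = p' := hinj p ⟨hp, hSU hpS⟩ p' ⟨hp', hSU hp'S⟩ h1
    subst h2
    refine ⟨rfl, ?_⟩
    obtain ⟨A, hA⟩ := h.exists_normalSpace_equiv hp₀ hp (hnear p ⟨hp, hSU hpS⟩)
    have h3 : A ⟨y, hy⟩ = A ⟨y', hy'⟩ := by
      apply Subtype.ext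
      rw [hA, hA]
      exact add_left_cancel heq
    exact congrArg Subtype.val (A.injective h3)
  have hΨinj : InjOn Ψ D := by
    intro z hz z' hz' heq
    obtain ⟨p, hp, hpS, y, hy, -, rfl, h1⟩ := hDrep z hz
    obtain ⟨p', hp', hp'S, y', hy', -, rfl, h2⟩ := hDrep z' hz'
    rw [h1, h2] at heq
    obtain ⟨rfl, rfl⟩ := hrep_inj p hp hpS p' hp' hp'S y hy y' hy' heq
    rfl
  have hΨd : ∀ z ∈ D, HasFDerivWithinAt Ψ (tubeChartDeriv π P z) D z := fun z hz =>
    (h.hasFDerivAt_tubeChart P (tube_mono hερ hz.1)).hasFDerivWithinAt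
  have hemb := measurableEmbedding_of_fderivWithin hDm hΨd hΨinj
  -- transport of functions to the chart
  let T : (E n → ℝ≥0∞) → E n → ℝ≥0∞ := fun g =>
    Function.extend (D.domRestrict Ψ) (fun z : D => g z) 0
  have hTm : ∀ g : E n → ℝ≥0∞, Measurable g → Measurable (T g) := fun g hg =>
    hemb.measurable_extend (hg.comp measurable_subtype_coe) measurable_const
  have hTapp : ∀ (g : E n → ℝ≥0∞), ∀ z ∈ D, T g (Ψ z) = g z := fun g z hz =>
    hemb.injective.extend_apply (fun z : D => g z) 0 ⟨z, hz⟩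
  have hTzero : ∀ (g : E n → ℝ≥0∞), ∀ x ∉ Ψ '' D, T g x = 0 := fun g x hx => by
    refine Function.extend_apply' _ _ _ ?_
    rintro ⟨z, hz⟩
    exact hx ⟨z, z.2, hz⟩
  have hTint : ∀ g : E n → ℝ≥0∞, ∫⁻ x, T g x =
      ∫⁻ z in D, ENNReal.ofReal |(tubeChartDeriv π P z).det| * g z := fun g => by
    have h1 : MeasurableSet (Ψ '' D) := by
      have := hemb.measurableSet_range
      rwa [range_domRestrict] at this
    have h2 : ∫⁻ x, T g x = ∫⁻ x in Ψ '' D, T g x := by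
      rw [← lintegral_indicator h1]
      refine lintegral_congr fun x => ?_
      by_cases hx : x ∈ Ψ '' D
      · rw [indicator_of_mem hx]
      · rw [indicator_of_notMem hx, hTzero g x hx]
    rw [h2, lintegral_image_eq_lintegral_abs_det_fderiv_mul volume hDm hΨd hΨinj]
    exact setLIntegral_congr_fun hDm fun z hz => by simp only [hTapp g z hz]
  have hdetD : ∀ z ∈ D, |(tubeChartDeriv π P z).det| ∈ Icc ((1 / 4 : ℝ) ^ n) (4 ^ n) := by
    intro z hz
    obtain ⟨p, hp, hpS, y, hy, hyε, rfl, -⟩ := hDrep z hz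
    exact hdet p ⟨hp, hSU hpS⟩ y hy (by linarith)
  have hupper : ∫⁻ x, T h₂ x ≤ 4 ^ n * ∫⁻ z in D, h₂ z := by
    rw [hTint, ← lintegral_const_mul _ hh₂]
    refine setLIntegral_mono' hDm fun z hz => ?_
    gcongr
    calc _ ≤ ENNReal.ofReal (4 ^ n) := ENNReal.ofReal_le_ofReal (hdetD z hz).2
      _ = _ := by rw [ENNReal.ofReal_pow (by norm_num)]; norm_num
  have hlower : ∫⁻ z in D, h₁ z ≤ 4 ^ n * ∫⁻ x, T h₁ x := by
    rw [hTint, ← lintegral_const_mul' _ _ (by finiteness)]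
    refine setLIntegral_mono' hDm fun z hz => ?_
    rw [← mul_assoc]
    refine le_mul_of_one_le_left zero_le ?_
    calc (1 : ℝ≥0∞) = ENNReal.ofReal (4 ^ n * (1 / 4) ^ n) := by
          rw [← mul_pow]; norm_num
      _ ≤ ENNReal.ofReal (4 ^ n * |(tubeChartDeriv π P z).det|) := by
          gcongr; exact (hdetD z hz).1
      _ = _ := by rw [ENNReal.ofReal_mul (by positivity), ENNReal.ofReal_pow (by norm_num)]; norm_num
  -- the slices in the chart
  have hmain : ∫⁻ x, T h₁ x ≤ C * ∫⁻ x, T h₂ x := by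
    refine lintegral_le_of_forall_slice (normalSpace M p₀) (hTm _ hh₁) (hTm _ hh₂) fun ξ => ?_
    have hPξ : ∀ η : normalSpace M p₀, P ((ξ : E n) + η) = ξ := fun η => by
      rw [map_add, hP, h.fderiv_apply_of_mem_orthogonal hp₀ ξ.2,
        (h.mem_normalSpace_iff hp₀).1 η.2, add_zero]
    -- The chart maps the normal ball at p into the affine space P p + N, N being the normal space
    -- at p₀. So each slice of the image comes from one normal ball, unique by the injectivity of P
    -- on M ∩ U, or is empty.
    by_cases hex : ∃ p ∈ M, p ∈ S ∧ P p = ξ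
    · obtain ⟨p, hp, hpS, hpξ⟩ := hex
      obtain ⟨A, hA⟩ := h.exists_normalSpace_equiv hp₀ hp (hnear p ⟨hp, hSU hpS⟩)
      obtain ⟨c, hc⟩ := exists_lintegral_comp_linearEquiv A
      have hset : MeasurableSet {y : normalSpace M p | ‖y‖ < ε} :=
        (isOpen_lt continuous_norm continuous_const).measurableSet
      -- On one slice the chart is a translate of the linear map `A`, so the same constant c occurs
      -- for h₁ and h₂ and does not affect the comparison.
      have hval : ∀ g : E n → ℝ≥0∞, ∫⁻ η : normalSpace M p₀, T g (ξ + η) =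
          c * ∫⁻ y in {y : normalSpace M p | ‖y‖ < ε}, g (p + y) := fun g => by
        rw [hc, ← lintegral_indicator hset]
        congr 1
        refine lintegral_congr fun y => ?_
        rw [← hpξ, hA]
        by_cases hy : ‖y‖ < ε
        · rw [indicator_of_mem (by exact hy)]
          have h1 : Ψ (p + y) = P p + (y - P y) := h.tubeChart_add P hp y.2 (hy.trans_le hερ)
          rw [← h1]
          exact hTapp g _ (hDmem hp hpS y.2 hy)
        · rw [indicator_of_notMem (by exact hy)]
          refine hTzero g _ ?_
          rintro ⟨z, hz, hzeq⟩
          obtain ⟨p', hp', hp'S, y', hy', hy'ε, rfl, h1⟩ := hDrep z hz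
          rw [h1] at hzeq
          obtain ⟨rfl, rfl⟩ := hrep_inj p' hp' hp'S p hp hpS y' hy' y y.2 hzeq
          exact hy hy'ε
      rw [hval, hval, mul_left_comm]
      gcongr
      exact hslice p hp
    · have hz : ∀ η : normalSpace M p₀, T h₁ (ξ + η) = 0 := fun η => by
        refine hTzero _ _ ?_
        rintro ⟨z, hz, hzeq⟩
        obtain ⟨p, hp, hpS, y, hy, -, rfl, h1⟩ := hDrep z hz
        exact hex ⟨p, hp, hpS, by rw [← hPξ η, ← hzeq, h1, hPP]⟩
      simp [hz]
  calc ∫⁻ z in D, h₁ z ≤ 4 ^ n * ∫⁻ x, T h₁ x := hlower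
    _ ≤ 4 ^ n * (C * (4 ^ n * ∫⁻ z in D, h₂ z)) := by gcongr; exact hmain.trans (by gcongr)
    _ = (4 * 4) ^ n * C * ∫⁻ z in D, h₂ z := by rw [mul_pow]; ring
    _ = _ := by norm_num

end IsFootMap

/-- If the integrals over all normal slices of radius `ε` are comparable, then so are the
integrals over the tube. -/
theorem HasNormalTube.lintegral_le_of_forall_slice {n : ℕ} {M : Set (E n)} {ρ ε : ℝ}
    (h : HasNormalTube M ρ) (hε : 4 * ε ≤ ρ) {h₁ h₂ : E n → ℝ≥0∞} {C : ℝ≥0∞}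
    (hh₁ : Measurable h₁) (hh₂ : Measurable h₂)
    (hslice : ∀ p ∈ M, ∫⁻ y in {y : normalSpace M p | ‖y‖ < ε}, h₁ (p + y) ≤
      C * ∫⁻ y in {y : normalSpace M p | ‖y‖ < ε}, h₂ (p + y)) :
    ∫⁻ z in tube M ε, h₁ z ≤ 16 ^ n * C * ∫⁻ z in tube M ε, h₂ z := by
  obtain ⟨π, hπ⟩ := h.exists_isFootMap
  have hερ : ε ≤ ρ := by linarith [h.pos]
  choose! U hU hpU hloc using fun (p : E n) (hp : p ∈ M) =>
    hπ.lintegral_le_of_forall_slice_local hp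
  -- The neighbourhoods may shrink along M, but the factor 16^n does not depend on them: a countable
  -- cover made disjoint is enough to sum the local comparisons.
  obtain ⟨T, hTM, hTc, hcover⟩ := TopologicalSpace.countable_cover_nhdsWithin
    (s := M) (f := U) fun p hp => mem_nhdsWithin_of_mem_nhds ((hU p hp).mem_nhds (hpU p hp))
  rcases T.eq_empty_or_nonempty with rfl | hTne
  · have : tube M ε = ∅ := by
      refine eq_empty_of_forall_notMem fun z hz => ?_
      simpa using hcover (hπ.apply_mem (tube_mono hερ hz))
    simp [this]
  obtain ⟨e, rfl⟩ := hTc.exists_eq_range hTne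
  have heM : ∀ i, e i ∈ M := fun i => hTM (mem_range_self i)
  let S : ℕ → Set (E n) := disjointed fun i => U (e i)
  have hSm : ∀ i, MeasurableSet (S i) := fun i =>
    MeasurableSet.disjointed (fun i => (hU _ (heM i)).measurableSet) i
  have hSU : ∀ i, S i ⊆ U (e i) := fun i => disjointed_subset _ i
  have htube : tube M ε = ⋃ i, tube M ε ∩ π ⁻¹' S i := by
    rw [← inter_iUnion, ← preimage_iUnion, iUnion_disjointed]
    refine (inter_eq_left.2 fun z hz => ?_).symm
    have := hcover (hπ.apply_mem (tube_mono hερ hz))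
    simpa using this
  have hdisj : Pairwise (Function.onFun Disjoint fun i => tube M ε ∩ π ⁻¹' S i) := by
    intro i j hij
    refine Disjoint.mono inter_subset_right inter_subset_right ?_
    exact (disjoint_disjointed _ hij).preimage π
  have hm : ∀ i, MeasurableSet (tube M ε ∩ π ⁻¹' S i) := fun i =>
    hπ.measurableSet_tube_inter_preimage hερ (hSm i)
  rw [htube, lintegral_iUnion hm hdisj, lintegral_iUnion hm hdisj, ← ENNReal.tsum_mul_left]
  exact ENNReal.tsum_le_tsum fun i =>
    hloc (e i) (heM i) (S i) (hSU i) (hSm i) ε hε h₁ h₂ C hh₁ hh₂ hslice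

end TubeComparison

/-! ### The weighted Poincaré inequality in a narrow tube -/

namespace TubeComparison

section

variable {n : ℕ} {M : Set (E n)} {ε ρ : ℝ} {Ω : Set (E n)}

/-- The restriction of a function to the slice at `p`, extended by zero. -/
noncomputable def sliceFun (M : Set (E n)) (p : E n) (ρ : ℝ) (G : E n → ℝ) (y : normalSpace M p) : ℝ :=
  {y : normalSpace M p | ‖y‖ < ρ}.indicator (fun y => G (p + y)) y

/-- The affine normal space at p can meet Ω again far away from p. Within distance ρ it cannot:
there p is the foot point, and a point of the thin tube is closer than ε to its foot point. -/
theorem HasNormalTube.norm_lt_of_add_mem (h : HasNormalTube M ρ) (hερ : ε ≤ ρ)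
    (hΩ : Ω ⊆ tube M ε) {p : E n} (hp : p ∈ M) {y : normalSpace M p} (hy : ‖y‖ < ρ)
    (hyΩ : p + (y : E n) ∈ Ω) : ‖y‖ < ε := by
  obtain ⟨π, hπ⟩ := h.exists_isFootMap
  have h1 := (hπ.mem_tube_iff_norm hερ (tube_mono hερ (hΩ hyΩ))).1 (hΩ hyΩ)
  rwa [hπ.apply_add hp y.2 hy, add_sub_cancel_left] at h1

/-- The gap between ε and ρ makes cutting off at radius ρ harmless: the function already vanishes
for ε < ‖y‖, so no singularity arises on the sphere of radius ρ. -/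
theorem HasNormalTube.hasFDerivAt_sliceFun (h : HasNormalTube M ρ) (hερ : ε < ρ)
    (hΩ : Ω ⊆ tube M ε) {p : E n} (hp : p ∈ M) {G : E n → ℝ} (hG : ContDiff ℝ 1 G)
    (hG0 : ∀ z ∉ Ω, G z = 0) :
    ContDiff ℝ 1 (sliceFun M p ρ G) ∧
      (∀ y : normalSpace M p, p + (y : E n) ∈ Ω → ‖y‖ < ε → sliceFun M p ρ G y = G (p + y) ∧
        fderiv ℝ (sliceFun M p ρ G) y =
          (fderiv ℝ G (p + y)).comp (normalSpace M p).subtypeL) ∧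
      (∀ y : normalSpace M p, ¬ (p + (y : E n) ∈ Ω ∧ ‖y‖ < ε) → sliceFun M p ρ G y = 0) ∧
      ((∀ z ∉ Ω, fderiv ℝ G z = 0) → ∀ y : normalSpace M p, ¬ (p + (y : E n) ∈ Ω ∧ ‖y‖ < ε) →
        fderiv ℝ (sliceFun M p ρ G) y = 0) := by
  have hin : ∀ y : normalSpace M p, ‖y‖ < ρ → sliceFun M p ρ G =ᶠ[𝓝 y] fun y => G (p + y) := by
    intro y hy
    filter_upwards [(isOpen_lt continuous_norm continuous_const).mem_nhds hy] with x hx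
    exact indicator_of_mem (s := {y : normalSpace M p | ‖y‖ < ρ}) hx fun y => G (p + y)
  have hzero : ∀ y : normalSpace M p, ¬ (p + (y : E n) ∈ Ω ∧ ‖y‖ < ε) →
      sliceFun M p ρ G y = 0 := by
    intro y hy
    by_cases hyρ : ‖y‖ < ρ
    · rw [(hin y hyρ).eq_of_nhds]
      refine hG0 _ fun hyΩ => hy ⟨hyΩ, h.norm_lt_of_add_mem hερ.le hΩ hp hyρ hyΩ⟩
    · exact indicator_of_notMem (s := {y : normalSpace M p | ‖y‖ < ρ}) hyρ fun y => G (p + y)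
  have hout : ∀ y : normalSpace M p, ¬ ‖y‖ < ρ → sliceFun M p ρ G =ᶠ[𝓝 y] fun _ => 0 := by
    intro y hy
    have h1 : ε < ‖y‖ := hερ.trans_le (not_lt.1 hy)
    filter_upwards [(isOpen_lt continuous_const continuous_norm).mem_nhds h1] with x hx
    exact hzero x fun hx' => lt_asymm hx'.2 hx
  have hsub : ContDiff ℝ 1 fun y : normalSpace M p => p + (y : E n) :=
    contDiff_const.add (normalSpace M p).subtypeL.contDiff
  have hder : ∀ y : normalSpace M p, ‖y‖ < ρ → fderiv ℝ (sliceFun M p ρ G) y =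
      (fderiv ℝ G (p + y)).comp (normalSpace M p).subtypeL := by
    intro y hy
    rw [(hin y hy).fderiv_eq]
    have h1 : HasFDerivAt (fun y : normalSpace M p => p + (y : E n))
        (normalSpace M p).subtypeL y := (normalSpace M p).subtypeL.hasFDerivAt.const_add p
    exact ((hG.differentiable one_ne_zero _).hasFDerivAt.comp y h1).fderiv
  refine ⟨?_, ?_, hzero, ?_⟩
  · rw [contDiff_iff_contDiffAt]
    intro y
    by_cases hy : ‖y‖ < ρ
    · exact (hG.comp hsub).contDiffAt.congr_of_eventuallyEq (hin y hy)
    · exact contDiffAt_const.congr_of_eventuallyEq (hout y hy)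
  · intro y hyΩ hyε
    have hyρ := hyε.trans hερ
    exact ⟨(hin y hyρ).eq_of_nhds, hder y hyρ⟩
  · intro hG' y hy
    by_cases hyρ : ‖y‖ < ρ
    · rw [hder y hyρ, hG' _ fun hyΩ => hy ⟨hyΩ, h.norm_lt_of_add_mem hερ.le hΩ hp hyρ hyΩ⟩,
        ContinuousLinearMap.zero_comp]
    · rw [(hout y hyρ).fderiv_eq]
      simp

/-- The weight extended by zero, as an extended nonnegative function. -/
noncomputable def extWeight (Ω : Set (E n)) (a : E n → ℝ) : E n → ℝ≥0∞ :=
  Ω.indicator fun z => ENNReal.ofReal (a z)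

theorem measurable_extWeight (hΩ : IsOpen Ω) {a : E n → ℝ} (ha : ContinuousOn a Ω) :
    Measurable (extWeight Ω a) := by
  classical
  have h1 : Measurable (Ω.piecewise a fun _ => 0) :=
    ha.measurable_piecewise continuousOn_const hΩ.measurableSet
  have h2 : extWeight Ω a = Ω.indicator fun z => ENNReal.ofReal ((Ω.piecewise a fun _ => 0) z) := by
    ext z
    by_cases hz : z ∈ Ω <;> simp [extWeight, hz]
  rw [h2]
  exact (ENNReal.measurable_ofReal.comp h1).indicator hΩ.measurableSet

theorem lintegral_ofReal_eq_extWeight (hΩ : IsOpen Ω) {a : E n → ℝ} (F : E n → ℝ≥0∞ → ℝ≥0∞) :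
    ∫⁻ z in Ω, F z (ENNReal.ofReal (a z)) = ∫⁻ z in Ω, F z (extWeight Ω a z) :=
  setLIntegral_congr_fun hΩ.measurableSet fun z hz => by simp [extWeight, hz]

theorem slice_extWeight_le {t Ca A : ℝ} {a : E n → ℝ} (hΩo : IsOpen Ω)
    (ha : IsAdmissibleWeight M ε Ω t Ca A a) {p : E n} (hp : p ∈ M) :
    ∫⁻ y in {y : normalSpace M p | p + (y : E n) ∈ Ω ∧ ‖y‖ < ε},
      (extWeight Ω a (p + y))⁻¹ ^ t ≤ ENNReal.ofReal Ca := by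
  have h1 : {y : normalSpace M p | p + (y : E n) ∈ Ω ∧ ‖y‖ < ε} =
      {y : normalSpace M p | p + (y : E n) ∈ Ω ∩ normalBall M p ε} := by
    ext y
    simp [normalBall]
  have hm : MeasurableSet {y : normalSpace M p | p + (y : E n) ∈ Ω ∧ ‖y‖ < ε} := by
    refine MeasurableSet.inter ?_ ?_
    · exact (hΩo.preimage (by fun_prop)).measurableSet
    · exact (isOpen_lt continuous_norm continuous_const).measurableSet
  refine le_trans (le_of_eq ?_) (ha.slice p hp)
  rw [← h1]
  refine setLIntegral_congr_fun hm fun y hy => ?_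
  have hy1 : p + (y : E n) ∈ Ω := hy.1
  simp only [extWeight, indicator_of_mem hy1]
  rw [ENNReal.inv_rpow, ENNReal.rpow_neg]

end

/-- In a narrow tube the weighted Poincaré inequality holds with a small constant. -/
theorem exists_radius_tube_poincare {n k : ℕ} (hk : 1 ≤ k) (hkn : k ≤ n) {t : ℝ}
    (ht : (k : ℝ) < t) (Ca A ρ : ℝ) {η : ℝ} (hη : 0 < η) :
    ∃ ε₀ > 0, ∀ (M : Set (E n)), IsSmoothSubmanifold (n - k) M → HasNormalTube M ρ →
      ∀ ε : ℝ, ε < ε₀ → ∀ Ω : Set (E n), IsOpen Ω → Ω ⊆ tube M ε →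
      ∀ a : E n → ℝ, IsAdmissibleWeight M ε Ω t Ca A a →
      (∀ᵐ z ∂(volume.restrict Ω), 0 < a z) ∧
      ∀ G : E n → ℝ, ContDiff ℝ 1 G → (∀ z ∉ Ω, G z = 0) → (∀ z ∉ Ω, fderiv ℝ G z = 0) →
        ∫⁻ z in Ω, (ENNReal.ofReal (a z))⁻¹ * ‖G z‖ₑ ^ (2 : ℝ) ≤
          ENNReal.ofReal η * ∫⁻ z in Ω, ENNReal.ofReal (a z) * ‖fderiv ℝ G z‖ₑ ^ (2 : ℝ) := by
  obtain ⟨ε₁, hε₁, hsl⟩ := exists_radius_weighted_poincare hk ht Ca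
    (show 0 < η / 16 ^ n by positivity)
  have ht0 : 0 < t := lt_of_le_of_lt (Nat.cast_nonneg k) ht
  by_cases hρ : 0 < ρ
  swap
  · exact ⟨1, one_pos, fun M _ hM => absurd hM.pos hρ⟩
  -- The radius `ε₁` makes the slice constant η/16^n, and ρ/4 is the range in which slices can be
  -- compared with the tube.
  refine ⟨min ε₁ (ρ / 4), by positivity, ?_⟩
  intro M hMs hM ε hε Ω hΩ hΩt a ha
  have hε1 : ε < ε₁ := hε.trans_le (min_le_left _ _)
  have hε4 : 4 * ε ≤ ρ := by linarith [hε.trans_le (min_le_right _ _)]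
  have hερ : ε < ρ := by linarith
  have hac : ContinuousOn a Ω := ha.continuousOn.mono subset_closure
  have hbm := measurable_extWeight hΩ hac
  have hΩm := hΩ.measurableSet
  have hslm : ∀ p, MeasurableSet {y : normalSpace M p | p + (y : E n) ∈ Ω ∧ ‖y‖ < ε} := fun p => by
    refine MeasurableSet.inter ?_ ?_
    · exact (hΩ.preimage (by fun_prop)).measurableSet
    · exact (isOpen_lt continuous_norm continuous_const).measurableSet
  have hbt : ∀ z, extWeight Ω a z ≠ ⊤ := fun z => by
    by_cases hz : z ∈ Ω <;> simp [extWeight, hz]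
  have hind : ∀ (F : E n → ℝ≥0∞) (p : E n),
      ∫⁻ y in {y : normalSpace M p | ‖y‖ < ε}, Ω.indicator F (p + y) =
      ∫⁻ y in {y : normalSpace M p | p + (y : E n) ∈ Ω ∧ ‖y‖ < ε}, F (p + y) := fun F p => by
    rw [← lintegral_indicator (isOpen_lt continuous_norm continuous_const).measurableSet,
      ← lintegral_indicator (hslm p)]
    refine lintegral_congr fun y => ?_
    by_cases h1 : p + (y : E n) ∈ Ω <;> by_cases h2 : ‖y‖ < ε <;>
      simp [indicator, h1, h2]
  have hΩind : ∀ F : E n → ℝ≥0∞, ∫⁻ z in tube M ε, Ω.indicator F z = ∫⁻ z in Ω, F z := fun F => by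
    rw [lintegral_indicator hΩm, Measure.restrict_restrict hΩm, inter_eq_left.2 hΩt]
  constructor
  -- The weight is positive almost everywhere on each slice by the bound on a^{-t}. The slice
  -- comparison with constant 0 turns this into a statement about Lebesgue measure on Ω.
  · let F : E n → ℝ≥0∞ := {z | extWeight Ω a z = 0}.indicator 1
    have hFm : Measurable F := measurable_one.indicator (hbm (measurableSet_singleton 0))
    have key := hM.lintegral_le_of_forall_slice hε4 (h₁ := Ω.indicator F) (h₂ := 0) (C := 0)
      (hFm.indicator hΩm) measurable_const (fun p hp => by
        rw [hind, zero_mul, nonpos_iff_eq_zero]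
        have h1 := ne_top_of_le_ne_top ENNReal.ofReal_ne_top (slice_extWeight_le hΩ ha hp)
        have h2 := ae_lt_top' (by fun_prop) h1
        rw [lintegral_eq_zero_iff (show Measurable fun y : normalSpace M p => F (p + y) by fun_prop)]
        filter_upwards [h2] with y hy
        have h3 : extWeight Ω a (p + y) ≠ 0 := fun h0 => by
          rw [h0, ENNReal.inv_zero, ENNReal.top_rpow_of_pos ht0] at hy
          exact lt_irrefl _ hy
        simp [F, h3])
    rw [hΩind, mul_zero, zero_mul, nonpos_iff_eq_zero, lintegral_eq_zero_iff hFm] at key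
    filter_upwards [key, ae_restrict_mem hΩm] with z hz hzΩ
    by_contra hcon
    have h4 : extWeight Ω a z = 0 := by
      simp [extWeight, hzΩ, ENNReal.ofReal_eq_zero, not_lt.1 hcon]
    simp [F, h4] at hz
  · intro G hG hG0 hG'
    have hGc := hG.continuous
    have hGc' := hG.continuous_fderiv one_ne_zero
    rw [lintegral_ofReal_eq_extWeight hΩ (F := fun z b => b⁻¹ * ‖G z‖ₑ ^ (2 : ℝ)),
      lintegral_ofReal_eq_extWeight hΩ (F := fun z b => b * ‖fderiv ℝ G z‖ₑ ^ (2 : ℝ)),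
      ← hΩind, ← hΩind]
    have hm1 : Measurable fun z => (extWeight Ω a z)⁻¹ * ‖G z‖ₑ ^ (2 : ℝ) := by fun_prop
    have hm2 : Measurable fun z => extWeight Ω a z * ‖fderiv ℝ G z‖ₑ ^ (2 : ℝ) := by fun_prop
    refine (hM.lintegral_le_of_forall_slice hε4 (C := ENNReal.ofReal (η / 16 ^ n))
      (hm1.indicator hΩm) (hm2.indicator hΩm) fun p hp => ?_).trans (le_of_eq ?_)
    · rw [hind, hind]
      obtain ⟨g1, g2, g3, g4⟩ := hM.hasFDerivAt_sliceFun hερ hΩt hp hG hG0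
      have hgc : HasCompactSupport (sliceFun M p ρ G) := by
        refine HasCompactSupport.of_support_subset_isCompact
          (isCompact_closedBall (0 : normalSpace M p) ε) fun y hy => ?_
        by_contra hcon
        rw [mem_closedBall_zero_iff, not_le] at hcon
        exact hy (g3 y fun h => lt_asymm h.2 hcon)
      have key := hsl (normalSpace M p) (finrank_normalSpace hkn hMs hp) (sliceFun M p ρ G)
        (fun y => extWeight Ω a (p + y))
        {y : normalSpace M p | p + (y : E n) ∈ Ω ∧ ‖y‖ < ε} ε hε1
        (fun y hy => mem_ball_zero_iff.2 hy.2) g1 hgc (by fun_prop) (fun y => hbt _) (hslm p)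
        (fun y hy => g3 y hy) (fun y hy => g4 hG' y hy) (slice_extWeight_le hΩ ha hp)
      calc _ = _ := setLIntegral_congr_fun (hslm p) fun y hy => by
            simp only [(g2 y hy.1 hy.2).1]
        _ ≤ _ := key
        _ ≤ _ := by
            refine mul_le_mul_right ?_ _
            refine setLIntegral_mono' (hslm p) fun y hy => ?_
            gcongr
            rw [enorm_le_iff_norm_le, (g2 y hy.1 hy.2).2]
            refine (ContinuousLinearMap.opNorm_comp_le _ _).trans ?_
            exact mul_le_of_le_one_right (norm_nonneg _) (Submodule.norm_subtypeL_le _)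
    · congr 1
      rw [ENNReal.ofReal_div_of_pos (by positivity), ENNReal.ofReal_pow (by norm_num)]
      simp only [ENNReal.ofReal_ofNat]
      exact ENNReal.mul_div_cancel (by simp) (by finiteness)

end TubeComparison

/-! ### Truncations -/

namespace TubeComparison

/-- At the kink s = 0 the function is bounded by |x|^m, which is o(x) as m ≥ 2. This is why squares
and cubes of positive parts, and not the positive part itself, are used throughout. -/
theorem hasDerivAt_max_zero_pow {m : ℕ} (hm : 2 ≤ m) (s : ℝ) :
    HasDerivAt (fun s : ℝ => max s 0 ^ m) (m * max s 0 ^ (m - 1)) s := by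
  rcases lt_trichotomy s 0 with hs | rfl | hs
  · rw [max_eq_right hs.le, zero_pow (by omega), mul_zero]
    refine (hasDerivAt_const s (0 : ℝ)).congr_of_eventuallyEq ?_
    filter_upwards [gt_mem_nhds hs] with x hx
    rw [max_eq_right hx.le, zero_pow (by omega)]
  · rw [max_self, zero_pow (by omega), mul_zero]
    rw [hasDerivAt_iff_isLittleO]
    simp only [max_self, sub_zero, smul_zero, zero_pow (show m ≠ 0 by omega)]
    have h1 : (fun x : ℝ => max x 0 ^ m) =O[𝓝 0] fun x : ℝ => x ^ m := by
      refine Asymptotics.IsBigO.of_bound 1 (Filter.Eventually.of_forall fun x => ?_)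
      rw [norm_pow, norm_pow, one_mul]
      refine pow_le_pow_left₀ (norm_nonneg _) ?_ _
      rw [Real.norm_eq_abs, Real.norm_eq_abs, abs_of_nonneg (le_max_right _ _)]
      exact max_le (le_abs_self x) (abs_nonneg x)
    have h2 : (fun x : ℝ => x ^ m) =o[𝓝 0] fun x : ℝ => x ^ 1 :=
      Asymptotics.isLittleO_pow_pow (by omega)
    simpa using h1.trans_isLittleO h2
  · rw [max_eq_left hs.le]
    refine (hasDerivAt_pow m s).congr_of_eventuallyEq ?_
    filter_upwards [lt_mem_nhds hs] with x hx
    rw [max_eq_left hx.le]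

theorem contDiff_max_zero_pow {m : ℕ} (hm : 2 ≤ m) : ContDiff ℝ 1 fun s : ℝ => max s 0 ^ m := by
  rw [contDiff_one_iff_deriv]
  refine ⟨fun s => (hasDerivAt_max_zero_pow hm s).differentiableAt, ?_⟩
  have : deriv (fun s : ℝ => max s 0 ^ m) = fun s : ℝ => (m : ℝ) * max s 0 ^ (m - 1) :=
    funext fun s => (hasDerivAt_max_zero_pow hm s).deriv
  rw [this]
  fun_prop

/-- A continuous function on `closure Ω` that is `C¹` in `Ω` and nonpositive on the boundary; `D` is
its gradient. Both are bounded by `K`. -/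
structure IsBoundaryNonpos {n : ℕ} (Ω : Set (E n)) (K : ℝ) (W : E n → ℝ) (D : E n → E n) :
    Prop where
  isOpen : IsOpen Ω
  contDiffOn : ContDiffOn ℝ 1 W Ω
  continuousOn : ContinuousOn W (closure Ω)
  hasFDerivAt : ∀ z ∈ Ω, HasFDerivAt W (innerSL ℝ (D z)) z
  continuousOn_grad : ContinuousOn D Ω
  abs_le : ∀ z ∈ Ω, |W z| ≤ K
  norm_grad_le : ∀ z ∈ Ω, ‖D z‖ ≤ K
  nonpos : ∀ z ∈ frontier Ω, W z ≤ 0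

/-- The power `(W - δ)₊ ^ m`, extended by zero outside of `Ω`. -/
noncomputable def truncPow {n : ℕ} (Ω : Set (E n)) (W : E n → ℝ) (m : ℕ) (δ : ℝ) : E n → ℝ :=
  Ω.indicator fun z => max (W z - δ) 0 ^ m

/-- The differential of `truncPow`. -/
noncomputable def truncPowDeriv {n : ℕ} (Ω : Set (E n)) (W : E n → ℝ) (D : E n → E n) (m : ℕ)
    (δ : ℝ) : E n → E n →L[ℝ] ℝ :=
  Ω.indicator fun z => (m * max (W z - δ) 0 ^ (m - 1)) • innerSL ℝ (D z)

namespace IsBoundaryNonpos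

variable {n : ℕ} {Ω : Set (E n)} {K : ℝ} {W : E n → ℝ} {D : E n → E n}

theorem isClosed_superlevel (h : IsBoundaryNonpos Ω K W D) (δ : ℝ) :
    IsClosed (closure Ω ∩ W ⁻¹' Ici δ) :=
  h.continuousOn.preimage_isClosed_of_isClosed isClosed_closure isClosed_Ici

/-- On the frontier W ≤ 0 < δ. Hence truncation at a positive height δ produces functions supported
in a closed set inside Ω, which extend smoothly by zero. -/
theorem superlevel_subset (h : IsBoundaryNonpos Ω K W D) {δ : ℝ} (hδ : 0 < δ) :
    closure Ω ∩ W ⁻¹' Ici δ ⊆ Ω := by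
  rintro z ⟨hz, hzδ⟩
  by_contra hzΩ
  have h1 : z ∈ frontier Ω := by
    rw [frontier, h.isOpen.interior_eq]
    exact ⟨hz, hzΩ⟩
  have h2 : δ ≤ W z := hzδ
  linarith [h.nonpos z h1]

theorem support_truncPow_subset {m : ℕ} (hm : 2 ≤ m) {δ : ℝ} :
    Function.support (truncPow Ω W m δ) ⊆ closure Ω ∩ W ⁻¹' Ici δ := by
  intro z hz
  have hzΩ : z ∈ Ω := by
    by_contra hcon
    exact hz (indicator_of_notMem hcon _)
  refine ⟨subset_closure hzΩ, ?_⟩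
  by_contra hcon
  rw [mem_preimage, mem_Ici, not_le] at hcon
  apply hz
  rw [truncPow, indicator_of_mem hzΩ, max_eq_right (by linarith), zero_pow (by omega)]

theorem tsupport_truncPow_subset (h : IsBoundaryNonpos Ω K W D) {m : ℕ} (hm : 2 ≤ m) {δ : ℝ}
    (hδ : 0 < δ) : tsupport (truncPow Ω W m δ) ⊆ Ω :=
  (closure_minimal (support_truncPow_subset hm) (h.isClosed_superlevel δ)).trans
    (h.superlevel_subset hδ)

theorem truncPow_eventuallyEq_zero (h : IsBoundaryNonpos Ω K W D) {m : ℕ} (hm : 2 ≤ m) {δ : ℝ}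
    (hδ : 0 < δ) {z : E n} (hz : z ∉ Ω) : truncPow Ω W m δ =ᶠ[𝓝 z] fun _ => 0 :=
  notMem_tsupport_iff_eventuallyEq.1 fun hz' => hz (h.tsupport_truncPow_subset hm hδ hz')

theorem truncPow_eventuallyEq (h : IsBoundaryNonpos Ω K W D) {m : ℕ} {δ : ℝ} {z : E n}
    (hz : z ∈ Ω) : truncPow Ω W m δ =ᶠ[𝓝 z] fun z => max (W z - δ) 0 ^ m := by
  filter_upwards [h.isOpen.mem_nhds hz] with x hx
  exact indicator_of_mem hx _

theorem hasFDerivAt_truncPow_of_mem (h : IsBoundaryNonpos Ω K W D) {m : ℕ} (hm : 2 ≤ m) {δ : ℝ}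
    {z : E n} (hz : z ∈ Ω) : HasFDerivAt (truncPow Ω W m δ) (truncPowDeriv Ω W D m δ z) z := by
  rw [truncPowDeriv, indicator_of_mem hz]
  refine HasFDerivAt.congr_of_eventuallyEq ?_ (h.truncPow_eventuallyEq hz)
  exact HasDerivAt.comp_hasFDerivAt (h₂ := fun s : ℝ => max s 0 ^ m) z
    (hasDerivAt_max_zero_pow hm (W z - δ)) ((h.hasFDerivAt z hz).sub_const δ)

theorem hasFDerivAt_truncPow (h : IsBoundaryNonpos Ω K W D) {m : ℕ} (hm : 2 ≤ m) {δ : ℝ}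
    (hδ : 0 < δ) (z : E n) :
    HasFDerivAt (truncPow Ω W m δ) (truncPowDeriv Ω W D m δ z) z := by
  by_cases hz : z ∈ Ω
  · exact h.hasFDerivAt_truncPow_of_mem hm hz
  · rw [truncPowDeriv, indicator_of_notMem hz]
    exact (hasFDerivAt_const 0 z).congr_of_eventuallyEq (h.truncPow_eventuallyEq_zero hm hδ hz)

theorem contDiff_truncPow (h : IsBoundaryNonpos Ω K W D) {m : ℕ} (hm : 2 ≤ m) {δ : ℝ}
    (hδ : 0 < δ) : ContDiff ℝ 1 (truncPow Ω W m δ) := by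
  rw [contDiff_iff_contDiffAt]
  intro z
  by_cases hz : z ∈ Ω
  · refine ContDiffAt.congr_of_eventuallyEq ?_ (h.truncPow_eventuallyEq hz)
    exact (contDiff_max_zero_pow hm).contDiffAt.comp z
      ((h.contDiffOn.contDiffAt (h.isOpen.mem_nhds hz)).sub contDiffAt_const)
  · exact contDiffAt_const.congr_of_eventuallyEq (h.truncPow_eventuallyEq_zero hm hδ hz)

theorem abs_max_sub_le (r : ℝ) {δ : ℝ} (hδ : 0 ≤ δ) : |max (r - δ) 0 - max r 0| ≤ δ := by
  have := abs_max_sub_max_le_abs (r - δ) r 0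
  rwa [sub_sub_cancel_left, abs_neg, abs_of_nonneg hδ] at this

/-- The square of the positive part of `W`, extended by zero outside of `Ω`, is `C¹`. -/
theorem contDiff_sq (h : IsBoundaryNonpos Ω K W D) :
    ContDiff ℝ 1 (truncPow Ω W 2 0) ∧
      ∀ z, HasFDerivAt (truncPow Ω W 2 0) (truncPowDeriv Ω W D 2 0 z) z := by
  let δ : ℕ → ℝ := fun j => 1 / ((j : ℝ) + 1)
  have hδ : ∀ j, 0 < δ j := fun j => by positivity
  have hδ0 : Filter.Tendsto δ Filter.atTop (𝓝 0) := tendsto_one_div_add_atTop_nhds_zero_nat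
  -- At height 0 the support may reach the frontier. The differentials of (W - δ)₊² converge
  -- uniformly, because ∇W is bounded and r ↦ r₊ is 1-Lipschitz, so the limit is C¹ across the
  -- frontier too.
  have hunif : TendstoUniformly (fun j => truncPowDeriv Ω W D 2 (δ j)) (truncPowDeriv Ω W D 2 0)
      Filter.atTop := by
    rw [Metric.tendstoUniformly_iff]
    intro ε hε
    have h1 : ∀ᶠ j in Filter.atTop, 2 * δ j * K < ε := by
      have : Filter.Tendsto (fun j => 2 * δ j * K) Filter.atTop (𝓝 (2 * 0 * K)) :=
        (hδ0.const_mul 2).mul_const K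
      exact this.eventually_lt_const (by simpa using hε)
    filter_upwards [h1] with j hj z
    by_cases hz : z ∈ Ω
    · have hsm : ∀ (r s : ℝ) (X : E n →L[ℝ] ℝ), ‖r • X - s • X‖ = ‖r - s‖ * ‖X‖ := fun r s X => by
        have : r • X - s • X = (r - s) • X := by ext v; simp [sub_mul]
        rw [this, norm_smul]
      rw [dist_comm, dist_eq_norm, truncPowDeriv, truncPowDeriv, indicator_of_mem hz,
        indicator_of_mem hz, hsm, innerSL_apply_norm]
      refine lt_of_le_of_lt ?_ hj
      have h2 := abs_max_sub_le (W z) (hδ j).le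
      have h3 : ‖((2 : ℕ) * max (W z - δ j) 0 ^ (2 - 1) - (2 : ℕ) * max (W z - 0) 0 ^ (2 - 1) : ℝ)‖ ≤
          2 * δ j := by
        have : ((2 : ℕ) * max (W z - δ j) 0 ^ (2 - 1) - (2 : ℕ) * max (W z - 0) 0 ^ (2 - 1) : ℝ) =
            2 * (max (W z - δ j) 0 - max (W z) 0) := by norm_num; ring
        rw [this, norm_mul, Real.norm_eq_abs, Real.norm_eq_abs, abs_two]
        linarith
      have := hδ j
      exact mul_le_mul h3 (h.norm_grad_le z hz) (norm_nonneg _) (by positivity)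
    · rw [truncPowDeriv, truncPowDeriv, indicator_of_notMem hz, indicator_of_notMem hz, dist_self]
      exact hε
  have hpt : ∀ z, Filter.Tendsto (fun j => truncPow Ω W 2 (δ j) z) Filter.atTop
      (𝓝 (truncPow Ω W 2 0 z)) := by
    intro z
    by_cases hz : z ∈ Ω
    · simp only [truncPow, indicator_of_mem hz]
      have : Continuous fun s : ℝ => max (W z - s) 0 ^ 2 := by fun_prop
      exact (this.tendsto 0).comp hδ0
    · simp only [truncPow, indicator_of_notMem hz]
      exact tendsto_const_nhds
  have hder : ∀ z, HasFDerivAt (truncPow Ω W 2 0) (truncPowDeriv Ω W D 2 0 z) z := fun z =>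
    hasFDerivAt_of_tendstoUniformly hunif
      (fun j => h.hasFDerivAt_truncPow le_rfl (hδ j)) hpt z
  refine ⟨contDiff_one_iff_hasFDerivAt.2 ⟨truncPowDeriv Ω W D 2 0, ?_, hder⟩, hder⟩
  refine hunif.continuous (Filter.Eventually.of_forall fun j => ?_).frequently
  have h1 := (h.contDiff_truncPow le_rfl (hδ j)).continuous_fderiv one_ne_zero
  have h2 : fderiv ℝ (truncPow Ω W 2 (δ j)) = truncPowDeriv Ω W D 2 (δ j) :=
    funext fun z => (h.hasFDerivAt_truncPow le_rfl (hδ j) z).fderiv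
  rwa [h2] at h1

end IsBoundaryNonpos

end TubeComparison

/-! ### Test functions of class `C¹` -/

namespace TubeComparison

open scoped Convolution Pointwise in
/-- Nonnegative `C¹` functions with compact support in `Ω` are approximated by test functions,
uniformly together with their differentials. -/
theorem exists_isTestFunction_approx {n : ℕ} {Ω : Set (E n)} (hΩ : IsOpen Ω) {ψ : E n → ℝ}
    (hψ : ContDiff ℝ 1 ψ) (hc : HasCompactSupport ψ) (hs : tsupport ψ ⊆ Ω) (h0 : ∀ z, 0 ≤ ψ z) :
    ∃ T : Set (E n), IsCompact T ∧ T ⊆ Ω ∧ tsupport ψ ⊆ T ∧ ∀ ε > 0, ∃ ψ' : E n → ℝ,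
      IsTestFunction Ω ψ' ∧ tsupport ψ' ⊆ T ∧ (∀ z, |ψ' z - ψ z| ≤ ε) ∧
      ∀ z, ‖fderiv ℝ ψ' z - fderiv ℝ ψ z‖ ≤ ε := by
  obtain ⟨r, hr, hrΩ⟩ := hc.isCompact.exists_cthickening_subset_open hΩ hs
  refine ⟨Metric.cthickening r (tsupport ψ), hc.isCompact.cthickening, hrΩ,
    Metric.self_subset_cthickening _, fun ε hε => ?_⟩
  have hcont := hψ.continuous
  have hcont' := hψ.continuous_fderiv one_ne_zero
  have hu := hc.uniformContinuous_of_continuous hcont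
  have hu' := (hc.fderiv ℝ).uniformContinuous_of_continuous hcont'
  obtain ⟨δ₁, hδ₁, h1⟩ := Metric.uniformContinuous_iff.1 hu ε hε
  obtain ⟨δ₂, hδ₂, h2⟩ := Metric.uniformContinuous_iff.1 hu' ε hε
  let s := min r (min δ₁ δ₂)
  have hs0 : 0 < s := by positivity
  let b : ContDiffBump (0 : E n) := ⟨s / 2, s, by positivity, by linarith⟩
  let L := ContinuousLinearMap.lsmul ℝ ℝ (E := ℝ)
  let ψ' : E n → ℝ := b.normed volume ⋆[L, volume] ψ
  have hloc : LocallyIntegrable ψ volume := hcont.locallyIntegrable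
  have hloc' : LocallyIntegrable (b.normed volume) (volume : Measure (E n)) :=
    b.continuous_normed.locallyIntegrable
  have hsupp : tsupport ψ' ⊆ Metric.cthickening r (tsupport ψ) := by
    refine closure_minimal ?_ Metric.isClosed_cthickening
    refine (support_convolution_subset L).trans ?_
    rintro _ ⟨x, hx, y, hy, rfl⟩
    rw [b.support_normed_eq] at hx
    refine Metric.mem_cthickening_of_dist_le _ y _ _ (subset_tsupport _ hy) ?_
    have h3 : ‖x‖ < s := by simpa using hx
    simpa [dist_eq_norm] using (h3.le.trans (min_le_left _ _))
  have hder : ∀ z, fderiv ℝ ψ' z =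
      (b.normed volume ⋆[ContinuousLinearMap.lsmul ℝ ℝ (E := E n →L[ℝ] ℝ), volume] fderiv ℝ ψ) z := by
    intro z
    rw [(hc.hasFDerivAt_convolution_right L hloc' hψ z).fderiv]
    congr 1
  refine ⟨ψ', ⟨?_, ?_, hsupp.trans hrΩ, fun z => ?_⟩, hsupp, fun z => ?_, fun z => ?_⟩
  · exact b.hasCompactSupport_normed.contDiff_convolution_left L b.contDiff_normed hloc
  · exact hc.isCompact.cthickening.of_isClosed_subset (isClosed_tsupport _) hsupp
  · exact integral_nonneg fun y => mul_nonneg (b.nonneg_normed y) (h0 _)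
  · rw [← Real.dist_eq]
    refine b.dist_normed_convolution_le hcont.aestronglyMeasurable fun x hx => (h1 ?_).le
    exact (Metric.mem_ball.1 hx).trans_le ((min_le_right _ _).trans (min_le_left _ _))
  · rw [hder, ← dist_eq_norm]
    refine b.dist_normed_convolution_le hcont'.aestronglyMeasurable fun x hx => (h2 ?_).le
    exact (Metric.mem_ball.1 hx).trans_le ((min_le_right _ _).trans (min_le_right _ _))

theorem integrableOn_of_continuousOn_of_compact {n : ℕ} {Ω T : Set (E n)} (hΩ : IsOpen Ω)
    (hT : IsCompact T) (hTΩ : T ⊆ Ω) {F : E n → ℝ} (hF : ContinuousOn F Ω)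
    (h0 : ∀ z ∉ T, F z = 0) : IntegrableOn F Ω :=
  ((hF.mono hTΩ).integrableOn_compact hT).of_forall_sdiff_eq_zero hΩ.measurableSet
    fun z hz => h0 z hz.2

theorem fderiv_eq_zero_of_notMem_tsupport {n : ℕ} {ψ : E n → ℝ} {z : E n} (hz : z ∉ tsupport ψ) :
    fderiv ℝ ψ z = 0 := by
  rw [(notMem_tsupport_iff_eventuallyEq.1 hz).fderiv_eq]
  simp

/-- The linear form `∫_Ω ∇ψ · V - B ψ`. -/
noncomputable def weakForm {n : ℕ} (Ω : Set (E n)) (V : E n → E n) (B : E n → ℝ) (ψ : E n → ℝ) :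
    ℝ :=
  ∫ z in Ω, (fderiv ℝ ψ z (V z) - B z * ψ z)

/-- The approximating test functions are supported in one compact T ⊆ Ω, on which V and B are
bounded; the form is therefore continuous under uniform convergence of the functions and their
differentials. -/
theorem weakForm_nonpos_of_contDiff {n : ℕ} {Ω : Set (E n)} (hΩ : IsOpen Ω) {V : E n → E n}
    {B : E n → ℝ} (hV : ContinuousOn V Ω) (hB : ContinuousOn B Ω)
    (hweak : ∀ ψ, IsTestFunction Ω ψ → weakForm Ω V B ψ ≤ 0) {ψ : E n → ℝ}
    (hψ : ContDiff ℝ 1 ψ) (hc : HasCompactSupport ψ) (hs : tsupport ψ ⊆ Ω) (h0 : ∀ z, 0 ≤ ψ z) :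
    weakForm Ω V B ψ ≤ 0 := by
  obtain ⟨T, hT, hTΩ, hψT, happ⟩ := exists_isTestFunction_approx hΩ hψ hc hs h0
  obtain ⟨C₁, hC₁⟩ := (hT.image_of_continuousOn (hV.mono hTΩ)).isBounded.exists_norm_le
  obtain ⟨C₂, hC₂⟩ := (hT.image_of_continuousOn (hB.mono hTΩ)).isBounded.exists_norm_le
  have hV' : ∀ z ∈ T, ‖V z‖ ≤ C₁ := fun z hz => hC₁ _ (mem_image_of_mem _ hz)
  have hB' : ∀ z ∈ T, ‖B z‖ ≤ C₂ := fun z hz => hC₂ _ (mem_image_of_mem _ hz)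
  have hintegrable : ∀ χ : E n → ℝ, ContDiff ℝ 1 χ → tsupport χ ⊆ T →
      IntegrableOn (fun z => fderiv ℝ χ z (V z) - B z * χ z) Ω := by
    intro χ hχ hχT
    have h1 := hχ.continuous_fderiv one_ne_zero
    refine integrableOn_of_continuousOn_of_compact hΩ hT hTΩ ?_ fun z hz => ?_
    · exact (h1.continuousOn.clm_apply hV).sub (hB.mul hχ.continuous.continuousOn)
    · have h2 : z ∉ tsupport χ := fun h => hz (hχT h)
      rw [fderiv_eq_zero_of_notMem_tsupport h2, image_eq_zero_of_notMem_tsupport h2]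
      simp
  refine le_of_forall_pos_le_add fun η hη => ?_
  rw [zero_add]
  obtain ⟨ε, hε, hεη⟩ : ∃ ε > 0, (ε * C₁ + C₂ * ε) * volume.real T ≤ η := by
    have h1 : ∀ᶠ ε in 𝓝[>] (0 : ℝ), (ε * C₁ + C₂ * ε) * volume.real T < η := by
      have : Continuous fun ε : ℝ => (ε * C₁ + C₂ * ε) * volume.real T := by fun_prop
      exact ((this.tendsto 0).mono_left nhdsWithin_le_nhds).eventually_lt_const (by simpa)
    obtain ⟨ε, h1, h2⟩ := (h1.and self_mem_nhdsWithin).exists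
    exact ⟨ε, h2, h1.le⟩
  obtain ⟨ψ', hψ', hψ'T, hd, hd'⟩ := happ ε hε
  have hψ'1 : ContDiff ℝ 1 ψ' := hψ'.smooth.of_le (by simp)
  have hdiff : |weakForm Ω V B ψ - weakForm Ω V B ψ'| ≤ η := by
    rw [weakForm, weakForm, ← integral_sub (hintegrable ψ hψ hψT) (hintegrable ψ' hψ'1 hψ'T),
      setIntegral_eq_of_subset_of_forall_sdiff_eq_zero hΩ.measurableSet hTΩ, ← Real.norm_eq_abs]
    · refine (norm_setIntegral_le_of_norm_le_const (hT.measure_lt_top) fun z hz => ?_).trans hεη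
      have h1 : fderiv ℝ ψ z (V z) - B z * ψ z - (fderiv ℝ ψ' z (V z) - B z * ψ' z) =
          (fderiv ℝ ψ z - fderiv ℝ ψ' z) (V z) - B z * (ψ z - ψ' z) := by
        rw [_root_.sub_apply]; ring
      rw [h1]
      have h2 : ‖(fderiv ℝ ψ z - fderiv ℝ ψ' z) (V z)‖ ≤ ε * C₁ := by
        refine (ContinuousLinearMap.le_opNorm _ _).trans ?_
        have := hd' z
        rw [norm_sub_rev] at this
        exact mul_le_mul this (hV' z hz) (norm_nonneg _) hε.le
      have h3 : ‖B z * (ψ z - ψ' z)‖ ≤ C₂ * ε := by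
        rw [norm_mul]
        have := hd z
        rw [abs_sub_comm] at this
        exact mul_le_mul (hB' z hz) this (norm_nonneg _) ((norm_nonneg _).trans (hB' z hz))
      exact (norm_sub_le _ _).trans (add_le_add h2 h3)
    · intro z hz
      have h2 : z ∉ tsupport ψ := fun h => hz.2 (hψT h)
      have h3 : z ∉ tsupport ψ' := fun h => hz.2 (hψ'T h)
      rw [fderiv_eq_zero_of_notMem_tsupport h2, image_eq_zero_of_notMem_tsupport h2,
        fderiv_eq_zero_of_notMem_tsupport h3, image_eq_zero_of_notMem_tsupport h3]
      simp
  linarith [(abs_le.1 hdiff).2, hweak ψ' hψ']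

end TubeComparison

/-! ### The tested inequality -/

namespace TubeComparison

/-- The integrand of the weak inequality tested with `(W - δ)₊ ^ 3 φ ^ 2`. -/
noncomputable def testedIntegrand {n : ℕ} (a W : E n → ℝ) (D : E n → E n) (c l : ℝ) (φ : E n → ℝ)
    (δ : ℝ) (z : E n) : ℝ :=
  a z * (3 * max (W z - δ) 0 ^ 2 * ‖D z‖ ^ 2 * φ z ^ 2 +
      2 * max (W z - δ) 0 ^ 3 * φ z * fderiv ℝ φ z (D z)) -
    (c * ‖D z‖ + l * |W z|) * (max (W z - δ) 0 ^ 3 * φ z ^ 2)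

namespace IsBoundaryNonpos

variable {n : ℕ} {Ω : Set (E n)} {K : ℝ} {W : E n → ℝ} {D : E n → E n}

/-- The bound does not depend on δ: it provides the majorant for the limit δ → 0. -/
theorem abs_testedIntegrand_le (h : IsBoundaryNonpos Ω K W D) {a : E n → ℝ} {A c l : ℝ}
    (ha : ∀ z ∈ Ω, a z ∈ Icc 0 A) (hc : 0 ≤ c) (hl : 0 ≤ l) {φ : E n → ℝ} {Φ : ℝ}
    (hφ : ∀ z, |φ z| ≤ Φ) (hφ' : ∀ z, ‖fderiv ℝ φ z‖ ≤ Φ) {δ : ℝ} (hδ : 0 ≤ δ) {z : E n}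
    (hz : z ∈ Ω) :
    |testedIntegrand a W D c l φ δ z| ≤
      A * (3 * K ^ 2 * K ^ 2 * Φ ^ 2 + 2 * K ^ 3 * Φ * (Φ * K)) +
        (c * K + l * K) * (K ^ 3 * Φ ^ 2) := by
  obtain ⟨ha0, haA⟩ := ha z hz
  have hW := h.abs_le z hz
  have hD := h.norm_grad_le z hz
  have hK : 0 ≤ K := (abs_nonneg _).trans hW
  have hΦ : 0 ≤ Φ := (abs_nonneg _).trans (hφ z)
  have hA : 0 ≤ A := ha0.trans haA
  set s := max (W z - δ) 0 with hs
  have hs0 : 0 ≤ s := le_max_right _ _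
  have hsK : s ≤ K := max_le (by linarith [le_abs_self (W z)]) hK
  have hφz := hφ z
  have hdφ : |fderiv ℝ φ z (D z)| ≤ Φ * K := by
    rw [← Real.norm_eq_abs]
    exact ((fderiv ℝ φ z).le_opNorm _).trans (mul_le_mul (hφ' z) hD (norm_nonneg _) hΦ)
  unfold testedIntegrand
  rw [← hs]
  refine (abs_sub _ _).trans (add_le_add ?_ ?_)
  · rw [abs_mul, abs_of_nonneg ha0]
    refine mul_le_mul haA ((abs_add_le _ _).trans (add_le_add ?_ ?_)) (abs_nonneg _) hA
    · rw [abs_mul, abs_mul, abs_mul, abs_pow, abs_pow, abs_pow, abs_norm, abs_of_nonneg hs0,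
        abs_of_nonneg (show (0 : ℝ) ≤ 3 by norm_num)]
      gcongr
    · rw [abs_mul, abs_mul, abs_mul, abs_pow, abs_of_nonneg hs0, abs_two]
      gcongr
  · rw [abs_mul, abs_mul, abs_pow, abs_pow, abs_of_nonneg hs0,
      abs_of_nonneg (show 0 ≤ c * ‖D z‖ + l * |W z| by positivity)]
    gcongr

theorem continuousOn_testedIntegrand (h : IsBoundaryNonpos Ω K W D) {a : E n → ℝ} (c l : ℝ)
    (ha : ContinuousOn a Ω) {φ : E n → ℝ} (hφ : ContDiff ℝ 1 φ) (δ : ℝ) :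
    ContinuousOn (testedIntegrand a W D c l φ δ) Ω := by
  have hW : ContinuousOn W Ω := h.continuousOn.mono subset_closure
  have hD := h.continuousOn_grad
  have h1 : ContinuousOn φ Ω := hφ.continuous.continuousOn
  have h2 : ContinuousOn (fun z => fderiv ℝ φ z (D z)) Ω :=
    (hφ.continuous_fderiv one_ne_zero).continuousOn.clm_apply hD
  have h3 : ContinuousOn (fun z => max (W z - δ) 0) Ω :=
    ContinuousOn.sup (hW.sub continuousOn_const) continuousOn_const
  unfold testedIntegrand
  fun_prop

theorem weakForm_truncPow (h : IsBoundaryNonpos Ω K W D) {a : E n → ℝ} (c l : ℝ)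
    {φ : E n → ℝ} (hφ : ContDiff ℝ 1 φ) {δ : ℝ} (hδ : 0 < δ) :
    weakForm Ω (fun z => a z • D z) (fun z => c * ‖D z‖ + l * |W z|)
      (fun z => truncPow Ω W 3 δ z * φ z ^ 2) = ∫ z in Ω, testedIntegrand a W D c l φ δ z := by
  refine setIntegral_congr_fun h.isOpen.measurableSet fun z hz => ?_
  have h1 := h.hasFDerivAt_truncPow (m := 3) (by norm_num) hδ z
  have h2 := (hφ.differentiable one_ne_zero z).hasFDerivAt
  have h3 : HasFDerivAt (fun z => truncPow Ω W 3 δ z * φ z ^ 2) _ z := h1.mul (h2.pow 2)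
  simp only
  rw [h3.fderiv]
  have h4 : truncPow Ω W 3 δ z = max (W z - δ) 0 ^ 3 := indicator_of_mem hz _
  have h5 : truncPowDeriv Ω W D 3 δ z = ((3 : ℕ) * max (W z - δ) 0 ^ (3 - 1)) • innerSL ℝ (D z) :=
    indicator_of_mem hz _
  have h6 : (innerSL ℝ (D z) : E n →L[ℝ] ℝ) (D z) = ‖D z‖ ^ 2 := real_inner_self_eq_norm_sq (D z)
  rw [h4, h5]
  simp only [add_apply, smul_apply, map_smul, h6, smul_eq_mul, testedIntegrand,
    nsmul_eq_mul, Nat.cast_ofNat, Nat.reduceSub, pow_one]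
  ring

/-- Testing with `W₊ ^ 3 φ ^ 2`. -/
theorem integral_testedIntegrand_nonpos (h : IsBoundaryNonpos Ω K W D) {a : E n → ℝ} {A c l : ℝ}
    (ha : ∀ z ∈ Ω, a z ∈ Icc 0 A) (hac : ContinuousOn a Ω) (hc : 0 ≤ c) (hl : 0 ≤ l)
    (hweak : ∀ ψ, IsTestFunction Ω ψ →
      weakForm Ω (fun z => a z • D z) (fun z => c * ‖D z‖ + l * |W z|) ψ ≤ 0)
    {φ : E n → ℝ} (hφ : ContDiff ℝ 1 φ) (hφc : HasCompactSupport φ) :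
    IntegrableOn (testedIntegrand a W D c l φ 0) Ω ∧
      ∫ z in Ω, testedIntegrand a W D c l φ 0 z ≤ 0 := by
  have hφcont := hφ.continuous
  have hφcont' := hφ.continuous_fderiv one_ne_zero
  obtain ⟨Φ₁, hΦ₁⟩ := hφcont.bounded_above_of_compact_support hφc
  obtain ⟨Φ₂, hΦ₂⟩ := hφcont'.bounded_above_of_compact_support (hφc.fderiv ℝ)
  have hb1 : ∀ z, |φ z| ≤ max Φ₁ Φ₂ := fun z => (hΦ₁ z).trans (le_max_left _ _)
  have hb2 : ∀ z, ‖fderiv ℝ φ z‖ ≤ max Φ₁ Φ₂ := fun z => (hΦ₂ z).trans (le_max_right _ _)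
  set Φ := max Φ₁ Φ₂
  set C := A * (3 * K ^ 2 * K ^ 2 * Φ ^ 2 + 2 * K ^ 3 * Φ * (Φ * K)) +
        (c * K + l * K) * (K ^ 3 * Φ ^ 2) with hC
  have hΩm := h.isOpen.measurableSet
  have hbound : ∀ δ : ℝ, 0 ≤ δ → ∀ᵐ z ∂(volume.restrict Ω),
      ‖testedIntegrand a W D c l φ δ z‖ ≤ (tsupport φ).indicator (fun _ => C) z := by
    intro δ hδ
    filter_upwards [ae_restrict_mem hΩm] with z hz
    by_cases hzφ : z ∈ tsupport φ
    · rw [indicator_of_mem hzφ]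
      exact h.abs_testedIntegrand_le ha hc hl hb1 hb2 hδ hz
    · rw [indicator_of_notMem hzφ, testedIntegrand, image_eq_zero_of_notMem_tsupport hzφ]
      simp
  have hmeas : ∀ δ : ℝ, AEStronglyMeasurable (testedIntegrand a W D c l φ δ)
      (volume.restrict Ω) := fun δ =>
    (h.continuousOn_testedIntegrand c l hac hφ δ).aestronglyMeasurable hΩm
  have hdom : Integrable ((tsupport φ).indicator fun _ => C) (volume.restrict Ω) := by
    refine Integrable.mono_measure ?_ Measure.restrict_le_self
    rw [integrable_indicator_iff (isClosed_tsupport φ).measurableSet]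
    exact integrableOn_const hφc.isCompact.measure_lt_top.ne
  refine ⟨hdom.mono' (hmeas 0) (hbound 0 le_rfl), ?_⟩
  -- For δ > 0 the function (W - δ)₊³φ² is an admissible C¹ test function with compact support in Ω;
  -- the case δ = 0 follows by dominated convergence.
  let δ : ℕ → ℝ := fun j => 1 / ((j : ℝ) + 1)
  have hδ : ∀ j, 0 < δ j := fun j => by positivity
  have hδ0 : Filter.Tendsto δ Filter.atTop (𝓝 0) := tendsto_one_div_add_atTop_nhds_zero_nat
  have hlim := tendsto_integral_of_dominated_convergence
    (F := fun j => testedIntegrand a W D c l φ (δ j)) (f := testedIntegrand a W D c l φ 0) _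
    (fun j => hmeas (δ j)) hdom (fun j => hbound _ (hδ j).le)
    (Filter.Eventually.of_forall fun z => by
      have : Continuous fun s : ℝ => testedIntegrand a W D c l φ s z := by
        unfold testedIntegrand
        fun_prop
      exact (this.tendsto 0).comp hδ0)
  refine le_of_tendsto' hlim fun j => ?_
  rw [← h.weakForm_truncPow c l hφ (hδ j)]
  have hts : tsupport (fun z => truncPow Ω W 3 (δ j) z * φ z ^ 2) ⊆
      tsupport (truncPow Ω W 3 (δ j)) := tsupport_mul_subset_left
  refine weakForm_nonpos_of_contDiff h.isOpen (hac.smul h.continuousOn_grad) ?_ hweak ?_ ?_ ?_ ?_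
  · exact (h.continuousOn_grad.norm.const_smul c).add
      ((h.continuousOn.mono subset_closure).abs.const_smul l)
  · exact (h.contDiff_truncPow (by norm_num) (hδ j)).mul (hφ.pow 2)
  · refine HasCompactSupport.mul_left ?_
    exact hφc.comp_left (g := fun x : ℝ => x ^ 2) (by norm_num)
  · exact hts.trans (h.tsupport_truncPow_subset (by norm_num) (hδ j))
  · intro z
    refine mul_nonneg (indicator_nonneg (fun z _ => ?_) z) (sq_nonneg _)
    positivity

end IsBoundaryNonpos

end TubeComparison

/-! ### The energy estimate -/

namespace TubeComparison

theorem enorm_rpow_two {F : Type*} [SeminormedAddCommGroup F] (x : F) :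
    ‖x‖ₑ ^ (2 : ℝ) = ENNReal.ofReal (‖x‖ ^ 2) := by
  rw [← ofReal_norm, ENNReal.ofReal_rpow_of_nonneg (norm_nonneg _) (by norm_num), Real.rpow_two]

/-- The weighted Poincaré inequality with constant `η` for `C¹` functions that vanish outside
of `Ω`. -/
def HasWeightedPoincare {n : ℕ} (Ω : Set (E n)) (a : E n → ℝ) (η : ℝ) : Prop :=
  ∀ G : E n → ℝ, ContDiff ℝ 1 G → (∀ z ∉ Ω, G z = 0) → (∀ z ∉ Ω, fderiv ℝ G z = 0) →
    ∫⁻ z in Ω, (ENNReal.ofReal (a z))⁻¹ * ‖G z‖ₑ ^ (2 : ℝ) ≤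
      ENNReal.ofReal η * ∫⁻ z in Ω, ENNReal.ofReal (a z) * ‖fderiv ℝ G z‖ₑ ^ (2 : ℝ)

/-- Cutoff functions at scale `R`. -/
theorem exists_cutoff (n : ℕ) : ∃ C₀ : ℝ, 0 ≤ C₀ ∧ ∀ R > 0, ∃ φ : E n → ℝ, ContDiff ℝ 1 φ ∧
    HasCompactSupport φ ∧ (∀ z, φ z ∈ Icc (0 : ℝ) 1) ∧ (∀ z ∈ Metric.closedBall 0 R, φ z = 1) ∧
    tsupport φ ⊆ Metric.closedBall 0 (2 * R) ∧ ∀ z, ‖fderiv ℝ φ z‖ ≤ C₀ / R := by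
  let b : ContDiffBump (0 : E n) := ⟨1, 2, one_pos, one_lt_two⟩
  have hb : ContDiff ℝ 1 b := b.contDiff
  obtain ⟨C, hC⟩ := (hb.continuous_fderiv one_ne_zero).bounded_above_of_compact_support
    (b.hasCompactSupport.fderiv ℝ)
  refine ⟨C, (norm_nonneg _).trans (hC 0), fun R hR => ⟨fun z => b (R⁻¹ • z), ?_, ?_, ?_, ?_, ?_, ?_⟩⟩
  · exact hb.comp (contDiff_const_smul _)
  · exact b.hasCompactSupport.comp_homeomorph (Homeomorph.smulOfNeZero R⁻¹ (inv_ne_zero hR.ne'))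
  · exact fun z => ⟨b.nonneg, b.le_one⟩
  · intro z hz
    refine b.one_of_mem_closedBall ?_
    rw [mem_closedBall_zero_iff] at hz ⊢
    rw [norm_smul, norm_inv, Real.norm_of_nonneg hR.le, inv_mul_le_iff₀ hR]
    change ‖z‖ ≤ R * 1
    linarith
  · refine closure_minimal (fun z hz => ?_) Metric.isClosed_closedBall
    have h1 : R⁻¹ • z ∈ Function.support b := hz
    rw [b.support_eq, mem_ball_zero_iff, norm_smul, norm_inv, Real.norm_of_nonneg hR.le,
      inv_mul_lt_iff₀ hR] at h1
    rw [mem_closedBall_zero_iff]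
    have h2 : ‖z‖ < R * 2 := h1
    linarith
  · intro z
    have h1 : HasFDerivAt (fun z : E n => R⁻¹ • z) (R⁻¹ • ContinuousLinearMap.id ℝ (E n)) z :=
      (hasFDerivAt_id z).const_smul R⁻¹
    have h2 := (hb.differentiable one_ne_zero (R⁻¹ • z)).hasFDerivAt.comp z h1
    have h3 : fderiv ℝ (fun z => b (R⁻¹ • z)) z = R⁻¹ • fderiv ℝ b (R⁻¹ • z) := by
      refine h2.fderiv.trans ?_
      ext v
      simp
    rw [h3, norm_smul, norm_inv, Real.norm_of_nonneg hR.le, div_eq_inv_mul]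
    exact mul_le_mul_of_nonneg_left (hC _) (by positivity)

/-- A nonnegative monotone function of at most polynomial growth that decays quadratically from
each scale to the previous one vanishes. -/
theorem eq_zero_of_scale_decay {Q : ℝ → ℝ} {κ C₁ : ℝ} {n : ℕ} (hn : 1 ≤ n) (hκ : 0 ≤ κ)
    (h0 : ∀ R, 0 ≤ Q R) (hmono : Monotone Q) (hgrow : ∀ R, 1 ≤ R → Q R ≤ C₁ * R ^ n)
    (hdecay : ∀ R, 1 ≤ R → Q R * R ^ 2 ≤ κ * Q (2 * R)) (R : ℝ) : Q R = 0 := by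
  have hC₁ : 0 ≤ C₁ := by simpa using (h0 1).trans (hgrow 1 le_rfl)
  have hiter : ∀ j : ℕ, ∃ C : ℝ, 0 ≤ C ∧ ∀ R, 1 ≤ R → Q R * R ^ (2 * j) ≤ C * R ^ n := by
    intro j
    induction j with
    | zero => exact ⟨C₁, hC₁, fun R hR => by simpa using hgrow R hR⟩
    | succ j ih =>
      obtain ⟨C, hC, hCR⟩ := ih
      refine ⟨κ * (C * 2 ^ n), by positivity, fun R hR => ?_⟩
      have hR0 : 0 ≤ R := by linarith
      have h2 := hCR (2 * R) (by linarith)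
      calc Q R * R ^ (2 * (j + 1)) = (Q R * R ^ 2) * R ^ (2 * j) := by ring
        _ ≤ (κ * Q (2 * R)) * R ^ (2 * j) :=
            mul_le_mul_of_nonneg_right (hdecay R hR) (by positivity)
        _ ≤ (κ * Q (2 * R)) * (2 * R) ^ (2 * j) := by
            refine mul_le_mul_of_nonneg_left ?_ (mul_nonneg hκ (h0 _))
            exact pow_le_pow_left₀ hR0 (by linarith) _
        _ = κ * (Q (2 * R) * (2 * R) ^ (2 * j)) := by ring
        _ ≤ κ * (C * (2 * R) ^ n) := mul_le_mul_of_nonneg_left h2 hκ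
        _ = κ * (C * 2 ^ n) * R ^ n := by rw [mul_pow]; ring
  obtain ⟨C, hC, hCR⟩ := hiter n
  refine le_antisymm (le_of_forall_pos_le_add fun ε hε => ?_) (h0 R)
  rw [zero_add]
  set r := max (max 1 R) (C / ε) with hr
  have hr1 : 1 ≤ r := (le_max_left _ _).trans (le_max_left _ _)
  have hrn : 0 < r ^ n := by positivity
  have h1 : Q r * r ^ n ≤ C := by
    have h2 := hCR r hr1
    rw [two_mul, pow_add, ← mul_assoc] at h2
    exact le_of_mul_le_mul_right h2 hrn
  have h3 : Q r * r ≤ C :=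
    (mul_le_mul_of_nonneg_left (le_self_pow₀ hr1 (by omega)) (h0 _)).trans h1
  have h4 : C ≤ ε * r := by
    have : C / ε ≤ r := le_max_right _ _
    rw [div_le_iff₀ hε] at this
    linarith
  have h5 : Q r ≤ ε := le_of_mul_le_mul_right (h3.trans h4) (by linarith)
  exact (hmono ((le_max_right _ _).trans (le_max_left _ _))).trans h5

/-- The pointwise lower bound for the tested integrand. -/
theorem tested_lower_bound {a A c l w d φ τ ν W : ℝ} (ha : 0 < a) (haA : a ≤ A) (hl : 0 ≤ l)
    (hw : w = max W 0) (hτ : |τ| ≤ ν * d) :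
    a * w ^ 2 * d ^ 2 * φ ^ 2 - A ^ 2 * (a⁻¹ * w ^ 4 * ν ^ 2) -
        (c ^ 2 / 4 + l * A) * (a⁻¹ * w ^ 4 * φ ^ 2) ≤
      a * (3 * w ^ 2 * d ^ 2 * φ ^ 2 + 2 * w ^ 3 * φ * τ) -
        (c * d + l * |W|) * (w ^ 3 * φ ^ 2) := by
  have hw0 : 0 ≤ w := hw ▸ le_max_right _ _
  have hWw : |W| * w ^ 3 = w ^ 4 := by
    rcases le_total W 0 with h | h
    · rw [hw, max_eq_right h]; norm_num
    · rw [hw, max_eq_left h, abs_of_nonneg h]; ring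
  have hi : 0 < a⁻¹ := inv_pos.2 ha
  have hai : a * a⁻¹ = 1 := mul_inv_cancel₀ ha.ne'
  -- The upper bound A converts every remainder to the weight a⁻¹, the one controlled by the
  -- Poincaré inequality.
  have haA2 : a ≤ A ^ 2 * a⁻¹ := by
    rw [← div_eq_mul_inv, le_div_iff₀ ha]; nlinarith
  have hone : 1 ≤ A * a⁻¹ := by rw [← div_eq_mul_inv, le_div_iff₀ ha]; linarith
  -- the cross term
  have h1 : -(a * w ^ 2 * d ^ 2 * φ ^ 2 + A ^ 2 * (a⁻¹ * w ^ 4 * ν ^ 2)) ≤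
      a * (2 * w ^ 3 * φ * τ) := by
    have h2 : |φ * τ| ≤ |φ| * (ν * d) := by
      rw [abs_mul]; exact mul_le_mul_of_nonneg_left hτ (abs_nonneg _)
    have h3 : 2 * w * (|φ| * (ν * d)) ≤ φ ^ 2 * d ^ 2 + w ^ 2 * ν ^ 2 := by
      nlinarith [sq_nonneg (|φ| * d - w * ν), sq_abs φ]
    have h4 : -(φ ^ 2 * d ^ 2 + w ^ 2 * ν ^ 2) ≤ 2 * w * (φ * τ) := by
      have := mul_le_mul_of_nonneg_left (neg_le_of_abs_le h2) (show 0 ≤ 2 * w by positivity)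
      linarith
    have h5 : a * (w ^ 4 * ν ^ 2) ≤ A ^ 2 * a⁻¹ * (w ^ 4 * ν ^ 2) :=
      mul_le_mul_of_nonneg_right haA2 (by positivity)
    have h6 := mul_le_mul_of_nonneg_left h4 (show 0 ≤ a * w ^ 2 by positivity)
    linarith
  -- the gradient term
  have h6 : c * d * (w ^ 3 * φ ^ 2) ≤
      a * w ^ 2 * d ^ 2 * φ ^ 2 + c ^ 2 / 4 * (a⁻¹ * w ^ 4 * φ ^ 2) := by
    have h7 : c * d * w ≤ a * d ^ 2 + c ^ 2 / 4 * (a⁻¹ * w ^ 2) := by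
      have h8 : 0 ≤ a * (d - c / 2 * a⁻¹ * w) ^ 2 := by positivity
      have h9 : a * (d - c / 2 * a⁻¹ * w) ^ 2 = a * d ^ 2 - (a * a⁻¹) * (c * d * w) +
        (a * a⁻¹) * (c ^ 2 / 4 * (a⁻¹ * w ^ 2)) := by ring
      rw [h9, hai] at h8
      linarith
    have := mul_le_mul_of_nonneg_right h7 (show 0 ≤ w ^ 2 * φ ^ 2 by positivity)
    nlinarith
  have h10 : l * |W| * (w ^ 3 * φ ^ 2) ≤ l * A * (a⁻¹ * w ^ 4 * φ ^ 2) := by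
    have : l * |W| * (w ^ 3 * φ ^ 2) = l * (1 * (w ^ 4 * φ ^ 2)) := by rw [← hWw]; ring
    rw [this]
    have h11 := mul_le_mul_of_nonneg_right hone (show 0 ≤ w ^ 4 * φ ^ 2 by positivity)
    have := mul_le_mul_of_nonneg_left h11 hl
    linarith
  linarith

namespace IsBoundaryNonpos

variable {n : ℕ} {Ω : Set (E n)} {K : ℝ} {W : E n → ℝ} {D : E n → E n}

/-- The bound on the energy of `W₊ ^ 2 φ` in terms of the two kinds of terms. -/
noncomputable def energyBound (a W : E n → ℝ) (D : E n → E n) (φ : E n → ℝ) (z : E n) : ℝ :=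
  8 * (a z * max (W z) 0 ^ 2 * ‖D z‖ ^ 2 * φ z ^ 2) +
    2 * (a z * max (W z) 0 ^ 4 * ‖fderiv ℝ φ z‖ ^ 2)

theorem energyBound_mem_Icc (h : IsBoundaryNonpos Ω K W D) {a : E n → ℝ} {A : ℝ}
    (ha : ∀ z ∈ Ω, a z ∈ Icc 0 A) {φ : E n → ℝ} (hφ : ∀ z, φ z ∈ Icc (0 : ℝ) 1) {Φ : ℝ}
    (hφ' : ∀ z, ‖fderiv ℝ φ z‖ ≤ Φ) {z : E n} (hz : z ∈ Ω) :
    energyBound a W D φ z ∈ Icc 0 (8 * (A * K ^ 2 * K ^ 2 * 1 ^ 2) + 2 * (A * K ^ 4 * Φ ^ 2)) := by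
  obtain ⟨ha0, haA⟩ := ha z hz
  have hA : 0 ≤ A := ha0.trans haA
  have hD := h.norm_grad_le z hz
  have hK : 0 ≤ K := (norm_nonneg _).trans hD
  have hw : max (W z) 0 ≤ K := max_le ((le_abs_self _).trans (h.abs_le z hz)) hK
  have hw0 : 0 ≤ max (W z) 0 := le_max_right _ _
  obtain ⟨h1, h2⟩ := hφ z
  have h3 := hφ' z
  unfold energyBound
  constructor
  · positivity
  · gcongr

theorem continuousOn_energyBound (h : IsBoundaryNonpos Ω K W D) {a : E n → ℝ}
    (ha : ContinuousOn a Ω) {φ : E n → ℝ} (hφ : ContDiff ℝ 1 φ) :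
    ContinuousOn (energyBound a W D φ) Ω := by
  have hW : ContinuousOn W Ω := h.continuousOn.mono subset_closure
  have hD := h.continuousOn_grad
  have h1 : ContinuousOn φ Ω := hφ.continuous.continuousOn
  have h2 : ContinuousOn (fun z => fderiv ℝ φ z) Ω :=
    (hφ.continuous_fderiv one_ne_zero).continuousOn
  have h3 : ContinuousOn (fun z => max (W z) 0) Ω := ContinuousOn.sup hW continuousOn_const
  unfold energyBound
  fun_prop

theorem energyBound_eq_zero {a : E n → ℝ} {φ : E n → ℝ} {z : E n} (hz : z ∉ tsupport φ) :
    energyBound a W D φ z = 0 := by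
  rw [energyBound, image_eq_zero_of_notMem_tsupport hz, fderiv_eq_zero_of_notMem_tsupport hz]
  simp

/-- A bounded density on a set of finite volume. This crude bound is what makes Q(R) grow at most
like R^n and starts the iteration over scales. -/
theorem integrableOn_energyBound (h : IsBoundaryNonpos Ω K W D) {a : E n → ℝ} {A : ℝ}
    (hA : 0 ≤ A) (ha : ∀ z ∈ Ω, a z ∈ Icc 0 A) (hac : ContinuousOn a Ω) {φ : E n → ℝ} (hφ : ContDiff ℝ 1 φ)
    (hφc : HasCompactSupport φ) (hφ1 : ∀ z, φ z ∈ Icc (0 : ℝ) 1) {Φ : ℝ}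
    (hφ' : ∀ z, ‖fderiv ℝ φ z‖ ≤ Φ) :
    IntegrableOn (energyBound a W D φ) Ω ∧ ∫ z in Ω, energyBound a W D φ z ≤
      (8 * (A * K ^ 2 * K ^ 2 * 1 ^ 2) + 2 * (A * K ^ 4 * Φ ^ 2)) * volume.real (tsupport φ) := by
  set C := 8 * (A * K ^ 2 * K ^ 2 * 1 ^ 2) + 2 * (A * K ^ 4 * Φ ^ 2) with hC
  have hΩm := h.isOpen.measurableSet
  have hbound : ∀ z ∈ Ω, energyBound a W D φ z ≤ (tsupport φ).indicator (fun _ => C) z := by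
    intro z hz
    by_cases hzφ : z ∈ tsupport φ
    · rw [indicator_of_mem hzφ]
      exact (h.energyBound_mem_Icc ha hφ1 hφ' hz).2
    · rw [indicator_of_notMem hzφ, energyBound_eq_zero hzφ]
  have hm := (isClosed_tsupport φ).measurableSet
  have hdom' : Integrable ((tsupport φ).indicator fun _ => C) := by
    rw [integrable_indicator_iff hm]
    exact integrableOn_const hφc.isCompact.measure_lt_top.ne
  have hdom : IntegrableOn ((tsupport φ).indicator fun _ => C) Ω := hdom'.integrableOn
  have hintegrable : IntegrableOn (energyBound a W D φ) Ω := by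
    refine hdom.mono' ((h.continuousOn_energyBound hac hφ).aestronglyMeasurable hΩm) ?_
    filter_upwards [ae_restrict_mem hΩm] with z hz
    rw [Real.norm_of_nonneg (h.energyBound_mem_Icc ha hφ1 hφ' hz).1]
    exact hbound z hz
  refine ⟨hintegrable, (setIntegral_mono_on hintegrable hdom hΩm hbound).trans ?_⟩
  have hC0 : 0 ≤ C := by positivity
  calc _ ≤ ∫ z, (tsupport φ).indicator (fun _ => C) z :=
        setIntegral_le_integral hdom' (Filter.Eventually.of_forall fun z =>
          indicator_nonneg (fun _ _ => hC0) z)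
    _ = C * volume.real (tsupport φ) := by
        rw [integral_indicator hm, setIntegral_const, smul_eq_mul, mul_comm]

/-- The Poincaré inequality for `W₊ ^ 2 φ`. -/
theorem poincare_cutoff (h : IsBoundaryNonpos Ω K W D) {a : E n → ℝ} {A η : ℝ} (hη : 0 ≤ η)
    (ha : ∀ z ∈ Ω, a z ∈ Icc 0 A) (hac : ContinuousOn a Ω)
    (hapos : ∀ᵐ z ∂(volume.restrict Ω), 0 < a z) (hP : HasWeightedPoincare Ω a η)
    {φ : E n → ℝ} (hφ : ContDiff ℝ 1 φ) (hintegrable : IntegrableOn (energyBound a W D φ) Ω) :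
    IntegrableOn (fun z => (a z)⁻¹ * max (W z) 0 ^ 4 * φ z ^ 2) Ω ∧
      ∫ z in Ω, (a z)⁻¹ * max (W z) 0 ^ 4 * φ z ^ 2 ≤ η * ∫ z in Ω, energyBound a W D φ z := by
  have hΩm := h.isOpen.measurableSet
  obtain ⟨hF, hF'⟩ := h.contDiff_sq
  have hGd : ∀ z, HasFDerivAt (fun z => truncPow Ω W 2 0 z * φ z)
      (truncPow Ω W 2 0 z • fderiv ℝ φ z + φ z • truncPowDeriv Ω W D 2 0 z) z := fun z =>
    (hF' z).mul (hφ.differentiable one_ne_zero z).hasFDerivAt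
  have key := hP (fun z => truncPow Ω W 2 0 z * φ z) (hF.mul hφ)
    (fun z hz => by rw [truncPow, indicator_of_notMem hz, zero_mul])
    (fun z hz => by
      rw [(hGd z).fderiv, truncPow, truncPowDeriv, indicator_of_notMem hz, indicator_of_notMem hz]
      simp)
  have hE0 : ∀ z ∈ Ω, 0 ≤ energyBound a W D φ z := fun z hz => by
    have := (ha z hz).1
    unfold energyBound
    positivity
  have hleft : ∫⁻ z in Ω, (ENNReal.ofReal (a z))⁻¹ * ‖truncPow Ω W 2 0 z * φ z‖ₑ ^ (2 : ℝ) =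
      ∫⁻ z in Ω, ENNReal.ofReal ((a z)⁻¹ * max (W z) 0 ^ 4 * φ z ^ 2) := by
    refine lintegral_congr_ae ?_
    filter_upwards [hapos, ae_restrict_mem hΩm] with z hz hzΩ
    rw [enorm_rpow_two, ← ENNReal.ofReal_inv_of_pos hz, ← ENNReal.ofReal_mul (by positivity),
      truncPow, indicator_of_mem hzΩ, sub_zero, Real.norm_eq_abs, sq_abs]
    congr 1
    ring
  have hright : ∫⁻ z in Ω, ENNReal.ofReal (a z) *
      ‖fderiv ℝ (fun z => truncPow Ω W 2 0 z * φ z) z‖ₑ ^ (2 : ℝ) ≤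
      ∫⁻ z in Ω, ENNReal.ofReal (energyBound a W D φ z) := by
    refine setLIntegral_mono' hΩm fun z hz => ?_
    have ha0 := (ha z hz).1
    rw [enorm_rpow_two, ← ENNReal.ofReal_mul ha0]
    refine ENNReal.ofReal_le_ofReal ?_
    have h1 : ‖fderiv ℝ (fun z => truncPow Ω W 2 0 z * φ z) z‖ ≤
        max (W z) 0 ^ 2 * ‖fderiv ℝ φ z‖ + |φ z| * (2 * max (W z) 0 * ‖D z‖) := by
      rw [(hGd z).fderiv, truncPow, truncPowDeriv, indicator_of_mem hz, indicator_of_mem hz]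
      refine (norm_add_le _ _).trans (le_of_eq ?_)
      rw [norm_smul, norm_smul, norm_smul, innerSL_apply_norm]
      simp [abs_of_nonneg]
    have h2 := pow_le_pow_left₀ (norm_nonneg _) h1 2
    -- From (x + y)² ≤ 2x² + 2y²; the factor 8 is 2 · 2², one 2 coming from the derivative of the
    -- square.
    have h3 : (max (W z) 0 ^ 2 * ‖fderiv ℝ φ z‖ + |φ z| * (2 * max (W z) 0 * ‖D z‖)) ^ 2 ≤
        8 * (max (W z) 0 ^ 2 * ‖D z‖ ^ 2 * φ z ^ 2) +
          2 * (max (W z) 0 ^ 4 * ‖fderiv ℝ φ z‖ ^ 2) := by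
      refine (add_sq_le (a := max (W z) 0 ^ 2 * ‖fderiv ℝ φ z‖)).trans (le_of_eq ?_)
      rw [mul_pow |φ z|, sq_abs]
      ring
    calc _ ≤ _ := mul_le_mul_of_nonneg_left (h2.trans h3) ha0
      _ = energyBound a W D φ z := by unfold energyBound; ring
  have hE : ∫⁻ z in Ω, ENNReal.ofReal (energyBound a W D φ z) =
      ENNReal.ofReal (∫ z in Ω, energyBound a W D φ z) :=
    (ofReal_integral_eq_lintegral_ofReal hintegrable
      ((ae_restrict_iff' hΩm).2 (Filter.Eventually.of_forall hE0))).symm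
  rw [hleft] at key
  have hle := key.trans (mul_le_mul_right hright _)
  rw [hE, ← ENNReal.ofReal_mul hη] at hle
  have hx0 : 0 ≤ᵐ[volume.restrict Ω] fun z => (a z)⁻¹ * max (W z) 0 ^ 4 * φ z ^ 2 := by
    filter_upwards [hapos] with z hz
    simp only [Pi.zero_apply]
    positivity
  have hxm : AEStronglyMeasurable (fun z => (a z)⁻¹ * max (W z) 0 ^ 4 * φ z ^ 2)
      (volume.restrict Ω) := by
    have h1 : AEMeasurable a (volume.restrict Ω) := hac.aemeasurable hΩm
    have h2 : AEMeasurable W (volume.restrict Ω) :=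
      (h.continuousOn.mono subset_closure).aemeasurable hΩm
    have h3 : AEMeasurable φ (volume.restrict Ω) := hφ.continuous.aemeasurable
    exact (((h1.inv).mul ((h2.max aemeasurable_const).pow_const 4)).mul
      (h3.pow_const 2)).aestronglyMeasurable
  -- Since a⁻¹ may be unbounded, integrability is not known beforehand; it is part of the conclusion
  -- of the Poincaré inequality, whose right-hand side is finite.
  have hxint : IntegrableOn (fun z => (a z)⁻¹ * max (W z) 0 ^ 4 * φ z ^ 2) Ω := by
    refine ⟨hxm, ?_⟩
    rw [hasFiniteIntegral_iff_ofReal hx0]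
    exact hle.trans_lt ENNReal.ofReal_lt_top
  refine ⟨hxint, ?_⟩
  rw [← ofReal_integral_eq_lintegral_ofReal hxint hx0] at hle
  refine (ENNReal.ofReal_le_ofReal_iff (mul_nonneg hη ?_)).1 hle
  exact setIntegral_nonneg hΩm hE0

end IsBoundaryNonpos

end TubeComparison

/-! ### Absorption and decay over dyadic scales. -/

namespace TubeComparison

namespace IsBoundaryNonpos

variable {n : ℕ} {Ω : Set (E n)} {K : ℝ} {W : E n → ℝ} {D : E n → E n}

/-- A function `W` that is nonpositive on the boundary and satisfies the linearized weak inequality is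
nonpositive, provided that the constant in the weighted Poincaré inequality is small. -/
theorem nonpos_of_weak (h : IsBoundaryNonpos Ω K W D) (hn : 1 ≤ n) {a : E n → ℝ} {A c l η : ℝ}
    (hA : 0 ≤ A) (hη0 : 0 ≤ η) (hη1 : η ≤ 1) (hη : 16 * η * (c ^ 2 / 4 + l * A) ≤ 1)
    (ha : ∀ z ∈ Ω, a z ∈ Icc 0 A) (hac : ContinuousOn a Ω) (hc : 0 ≤ c) (hl : 0 ≤ l)
    (hapos : ∀ᵐ z ∂(volume.restrict Ω), 0 < a z) (hP : HasWeightedPoincare Ω a η)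
    (hweak : ∀ ψ, IsTestFunction Ω ψ →
      weakForm Ω (fun z => a z • D z) (fun z => c * ‖D z‖ + l * |W z|) ψ ≤ 0) :
    ∀ z ∈ Ω, W z ≤ 0 := by
  have hΩm := h.isOpen.measurableSet
  obtain ⟨C₀, hC₀, hcut⟩ := exists_cutoff n
  choose! φ hφ hφc hφ1 hφR hφs hφ' using hcut
  let g : E n → ℝ := fun z => (a z)⁻¹ * max (W z) 0 ^ 4
  have hg0 : ∀ᵐ z ∂(volume.restrict Ω), 0 ≤ g z := by
    filter_upwards [hapos] with z hz
    positivity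
  have hE := fun R (hR : 0 < R) =>
    h.integrableOn_energyBound hA ha hac (hφ R hR) (hφc R hR) (hφ1 R hR) (hφ' R hR)
  have hX := fun R (hR : 0 < R) =>
    h.poincare_cutoff hη0 ha hac hapos hP (hφ R hR) (hE R hR).1
  let B : ℝ → Set (E n) := fun R => Metric.closedBall 0 R
  have hBm : ∀ R, MeasurableSet (B R) := fun R => Metric.isClosed_closedBall.measurableSet
  -- local integrability of `g`
  have hgB : ∀ R, IntegrableOn ((B R).indicator g) Ω := by
    intro R
    have hr : 0 < max R 1 := by positivity
    have h1 := ((hX _ hr).1).indicator (hBm R)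
    refine h1.congr (Filter.Eventually.of_forall fun z => ?_)
    by_cases hz : z ∈ B R
    · have h2 : z ∈ Metric.closedBall (0 : E n) (max R 1) :=
        Metric.closedBall_subset_closedBall (le_max_left _ _) hz
      simp only [indicator_of_mem hz, hφR _ hr z h2, g]
      ring
    · simp only [indicator_of_notMem hz]
  let Q : ℝ → ℝ := fun R => ∫ z in Ω, (B R).indicator g z
  have hQX : ∀ R, 0 < R → Q R ≤ ∫ z in Ω, g z * φ R z ^ 2 := by
    intro R hR
    refine integral_mono_ae (hgB R) (hX R hR).1 ?_
    filter_upwards [hg0] with z hz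
    by_cases hzB : z ∈ B R
    · simp only [indicator_of_mem hzB, hφR R hR z hzB, g]
      simp
    · simp only [indicator_of_notMem hzB]
      positivity
  have hQ0 : ∀ R, 0 ≤ Q R := fun R => by
    refine integral_nonneg_of_ae ?_
    filter_upwards [hg0] with z hz
    by_cases hzB : z ∈ B R
    · simpa [indicator_of_mem hzB] using hz
    · simp [indicator_of_notMem hzB]
  have hQmono : Monotone Q := by
    intro R R' hRR
    refine integral_mono_ae (hgB R) (hgB R') ?_
    filter_upwards [hg0] with z hz
    by_cases hzB : z ∈ B R
    · have : z ∈ B R' := Metric.closedBall_subset_closedBall hRR hzB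
      simp [indicator_of_mem hzB, indicator_of_mem this]
    · rw [indicator_of_notMem hzB]
      by_cases hzB' : z ∈ B R'
      · rwa [indicator_of_mem hzB']
      · rw [indicator_of_notMem hzB']
  -- polynomial growth
  have hgrow : ∃ C₁ : ℝ, ∀ R, 1 ≤ R → Q R ≤ C₁ * R ^ n := by
    refine ⟨(8 * (A * K ^ 2 * K ^ 2 * 1 ^ 2) + 2 * (A * K ^ 4 * C₀ ^ 2)) *
      (2 ^ n * volume.real (B 1)), fun R hR => ?_⟩
    have hR0 : 0 < R := by linarith
    have hI0 : 0 ≤ ∫ z in Ω, energyBound a W D (φ R) z :=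
      setIntegral_nonneg hΩm fun z hz =>
        (h.energyBound_mem_Icc ha (hφ1 R hR0) (hφ' R hR0) hz).1
    have hvol : volume.real (tsupport (φ R)) ≤ (2 ^ n * volume.real (B 1)) * R ^ n := by
      refine (measureReal_mono (hφs R hR0) measure_closedBall_lt_top.ne).trans (le_of_eq ?_)
      rw [Measure.real, Measure.addHaar_closedBall' _ _ (by positivity), ENNReal.toReal_mul,
        ENNReal.toReal_ofReal (by positivity), finrank_euclideanSpace_fin, mul_pow]
      simp only [B, Measure.real]
      ring
    calc Q R ≤ ∫ z in Ω, g z * φ R z ^ 2 := hQX R hR0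
      _ ≤ η * ∫ z in Ω, energyBound a W D (φ R) z := (hX R hR0).2
      _ ≤ 1 * ∫ z in Ω, energyBound a W D (φ R) z := mul_le_mul_of_nonneg_right hη1 hI0
      _ ≤ (8 * (A * K ^ 2 * K ^ 2 * 1 ^ 2) + 2 * (A * K ^ 4 * (C₀ / R) ^ 2)) *
            volume.real (tsupport (φ R)) := by rw [one_mul]; exact (hE R hR0).2
      _ ≤ (8 * (A * K ^ 2 * K ^ 2 * 1 ^ 2) + 2 * (A * K ^ 4 * C₀ ^ 2)) *
            ((2 ^ n * volume.real (B 1)) * R ^ n) := by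
          have h1 : C₀ / R ≤ C₀ := div_le_self hC₀ hR
          have h2 : 0 ≤ C₀ / R := by positivity
          gcongr
      _ = _ := by ring
  obtain ⟨C₁, hC₁⟩ := hgrow
  -- decay from one scale to the next
  have hdecay : ∀ R, 1 ≤ R → Q R * R ^ 2 ≤ 20 * A ^ 2 * C₀ ^ 2 * Q (2 * R) := by
    intro R hR
    have hR0 : 0 < R := by linarith
    let x : E n → ℝ := fun z => (a z)⁻¹ * max (W z) 0 ^ 4 * φ R z ^ 2
    let y : E n → ℝ := fun z => a z * max (W z) 0 ^ 2 * ‖D z‖ ^ 2 * φ R z ^ 2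
    let ζ : E n → ℝ := fun z => (a z)⁻¹ * max (W z) 0 ^ 4 * ‖fderiv ℝ (φ R) z‖ ^ 2
    let y' : E n → ℝ := fun z => a z * max (W z) 0 ^ 4 * ‖fderiv ℝ (φ R) z‖ ^ 2
    have hxint : IntegrableOn x Ω := (hX R hR0).1
    have hWc : ContinuousOn W Ω := h.continuousOn.mono subset_closure
    have hwc : ContinuousOn (fun z => max (W z) 0) Ω := ContinuousOn.sup hWc continuousOn_const
    have hDc := h.continuousOn_grad
    have hφcont : ContinuousOn (φ R) Ω := (hφ R hR0).continuous.continuousOn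
    have hφcont' : ContinuousOn (fderiv ℝ (φ R)) Ω :=
      ((hφ R hR0).continuous_fderiv one_ne_zero).continuousOn
    have hdom : ∀ {f : E n → ℝ}, ContinuousOn f Ω →
        (∀ z ∈ Ω, 0 ≤ f z ∧ f z ≤ energyBound a W D (φ R) z) → IntegrableOn f Ω := by
      intro f hf hle
      refine (hE R hR0).1.mono' (hf.aestronglyMeasurable hΩm) ?_
      filter_upwards [ae_restrict_mem hΩm] with z hz
      rw [Real.norm_of_nonneg (hle z hz).1]
      exact (hle z hz).2
    have hyz : ∀ z ∈ Ω, 0 ≤ y z ∧ 0 ≤ y' z := fun z hz => by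
      have := (ha z hz).1
      exact ⟨by positivity, by positivity⟩
    have hEy : ∀ z, energyBound a W D (φ R) z = 8 * y z + 2 * y' z := fun z => rfl
    have hyint : IntegrableOn y Ω := by
      refine hdom (by fun_prop) fun z hz => ?_
      obtain ⟨h1, h2⟩ := hyz z hz
      exact ⟨h1, by rw [hEy]; linarith⟩
    have hy'int : IntegrableOn y' Ω := by
      refine hdom (by fun_prop) fun z hz => ?_
      obtain ⟨h1, h2⟩ := hyz z hz
      exact ⟨h2, by rw [hEy]; linarith⟩
    have hζle : ∀ᵐ z ∂(volume.restrict Ω), ζ z ≤ (C₀ / R) ^ 2 * (B (2 * R)).indicator g z := by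
      filter_upwards [hg0] with z hz
      by_cases hzB : z ∈ B (2 * R)
      · rw [indicator_of_mem hzB, mul_comm]
        exact mul_le_mul_of_nonneg_left (pow_le_pow_left₀ (norm_nonneg _) (hφ' R hR0 z) 2) hz
      · have : z ∉ tsupport (φ R) := fun h => hzB (hφs R hR0 h)
        simp only [ζ]
        rw [indicator_of_notMem hzB, fderiv_eq_zero_of_notMem_tsupport this]
        simp
    have hζ0 : ∀ᵐ z ∂(volume.restrict Ω), 0 ≤ ζ z := by
      filter_upwards [hapos] with z hz
      positivity
    have hζint : IntegrableOn ζ Ω := by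
      refine ((hgB (2 * R)).const_mul ((C₀ / R) ^ 2)).mono' ?_ ?_
      · have h1 : AEMeasurable a (volume.restrict Ω) := hac.aemeasurable hΩm
        have h2 : AEMeasurable (fun z => max (W z) 0) (volume.restrict Ω) := hwc.aemeasurable hΩm
        have h3 : AEMeasurable (fun z => ‖fderiv ℝ (φ R) z‖) (volume.restrict Ω) :=
          hφcont'.norm.aemeasurable hΩm
        exact ((h1.inv.mul (h2.pow_const 4)).mul (h3.pow_const 2)).aestronglyMeasurable
      · filter_upwards [hζ0, hζle] with z h1 h2
        rwa [Real.norm_of_nonneg h1]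
    have hZ : ∫ z in Ω, ζ z ≤ (C₀ / R) ^ 2 * Q (2 * R) := by
      rw [← integral_const_mul]
      exact integral_mono_ae hζint ((hgB (2 * R)).const_mul _) hζle
    -- the tested inequality
    obtain ⟨htint, htest⟩ := h.integral_testedIntegrand_nonpos ha hac hc hl hweak (hφ R hR0)
      (hφc R hR0)
    -- Of the three copies of `y` in the tested inequality, one absorbs the cutoff cross term and
    -- one the gradient term; the third remains.
    have hY : ∫ z in Ω, y z ≤
        A ^ 2 * (∫ z in Ω, ζ z) + (c ^ 2 / 4 + l * A) * ∫ z in Ω, x z := by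
      have hi₁ : IntegrableOn (fun z => A ^ 2 * ζ z) Ω := hζint.const_mul _
      have hi₂ : IntegrableOn (fun z => y z - A ^ 2 * ζ z) Ω := hyint.sub hi₁
      have hi₃ : IntegrableOn (fun z => (c ^ 2 / 4 + l * A) * x z) Ω := hxint.const_mul _
      have h1 : ∫ z in Ω, (y z - A ^ 2 * ζ z - (c ^ 2 / 4 + l * A) * x z) ≤ 0 := by
        refine le_trans (integral_mono_ae (hi₂.sub hi₃) htint ?_) htest
        filter_upwards [hapos, ae_restrict_mem hΩm] with z hz hzΩ
        have h2 := tested_lower_bound (c := c) (d := ‖D z‖) (φ := φ R z) hz (ha z hzΩ).2 hl rfl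
          (show |fderiv ℝ (φ R) z (D z)| ≤ ‖fderiv ℝ (φ R) z‖ * ‖D z‖ from
            (fderiv ℝ (φ R) z).le_opNorm _) (W := W z)
        simpa only [testedIntegrand, sub_zero] using h2
      rw [integral_sub hi₂ hi₃, integral_sub hyint hi₁, integral_const_mul,
        integral_const_mul] at h1
      linarith
    have hY' : ∫ z in Ω, y' z ≤ A ^ 2 * ∫ z in Ω, ζ z := by
      rw [← integral_const_mul]
      refine integral_mono_ae hy'int (hζint.const_mul _) ?_
      filter_upwards [hapos, ae_restrict_mem hΩm] with z hz hzΩ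
      have h1 : a z ≤ A ^ 2 * (a z)⁻¹ := by
        rw [← div_eq_mul_inv, le_div_iff₀ hz]
        nlinarith [(ha z hzΩ).2]
      have := mul_le_mul_of_nonneg_right h1
        (show 0 ≤ max (W z) 0 ^ 4 * ‖fderiv ℝ (φ R) z‖ ^ 2 by positivity)
      simp only [y', ζ]
      linarith
    have hXle : ∫ z in Ω, x z ≤ η * (8 * (∫ z in Ω, y z) + 2 * ∫ z in Ω, y' z) := by
      have h1 := (hX R hR0).2
      have h2 : ∫ z in Ω, energyBound a W D (φ R) z =
          8 * (∫ z in Ω, y z) + 2 * ∫ z in Ω, y' z := by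
        rw [← integral_const_mul, ← integral_const_mul,
          ← integral_add (hyint.const_mul _) (hy'int.const_mul _)]
        rfl
      rwa [h2] at h1
    have hQx : Q R ≤ ∫ z in Ω, x z := hQX R hR0
    have hZ0 : 0 ≤ ∫ z in Ω, ζ z := integral_nonneg_of_ae hζ0
    have hX0 : 0 ≤ ∫ z in Ω, x z := (hQ0 R).trans hQx
    set X := ∫ z in Ω, x z
    set Y := ∫ z in Ω, y z
    set Y' := ∫ z in Ω, y' z
    set Z := ∫ z in Ω, ζ z
    -- The smallness condition on η bounds 8η(c²/4 + lA)X by X/2, which is moved to the left; the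
    -- cutoff terms then give 2 · 10.
    have h3 : X ≤ 20 * A ^ 2 * Z := by
      have h4 : 8 * Y + 2 * Y' ≤ 10 * (A ^ 2 * Z) + 8 * ((c ^ 2 / 4 + l * A) * X) := by linarith
      have h5 := mul_le_mul_of_nonneg_left h4 hη0
      have h6 : η * (10 * (A ^ 2 * Z)) ≤ 1 * (10 * (A ^ 2 * Z)) :=
        mul_le_mul_of_nonneg_right hη1 (by positivity)
      have h7 := mul_le_mul_of_nonneg_right hη hX0
      linarith
    have h8 : Q R ≤ 20 * A ^ 2 * ((C₀ / R) ^ 2 * Q (2 * R)) :=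
      (hQx.trans h3).trans (mul_le_mul_of_nonneg_left hZ (by positivity))
    calc Q R * R ^ 2 ≤ 20 * A ^ 2 * ((C₀ / R) ^ 2 * Q (2 * R)) * R ^ 2 :=
          mul_le_mul_of_nonneg_right h8 (by positivity)
      _ = _ := by field_simp
  have hQzero := eq_zero_of_scale_decay hn (by positivity) hQ0 hQmono hC₁ hdecay
  -- `W₊` vanishes almost everywhere, hence everywhere
  have hae : ∀ᵐ z ∂(volume.restrict Ω), W z ≤ 0 := by
    have h1 : ∀ j : ℕ, ∀ᵐ z ∂(volume.restrict Ω), (B j).indicator g z = 0 := fun j => by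
      have h2 : 0 ≤ᵐ[volume.restrict Ω] (B j).indicator g := by
        filter_upwards [hg0] with z hz
        by_cases hzB : z ∈ B j
        · simpa [indicator_of_mem hzB] using hz
        · simp [indicator_of_notMem hzB]
      exact (integral_eq_zero_iff_of_nonneg_ae h2 (hgB j)).1 (hQzero j)
    filter_upwards [ae_all_iff.2 h1, hapos] with z hz hza
    obtain ⟨j, hj⟩ := exists_nat_ge ‖z‖
    have h3 := hz j
    rw [indicator_of_mem (by simpa [B] using hj)] at h3
    have h4 : max (W z) 0 ^ 4 = 0 := (mul_eq_zero.1 h3).resolve_left (inv_ne_zero hza.ne')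
    exact max_eq_right_iff.1 (pow_eq_zero_iff (by norm_num) |>.1 h4)
  intro z hz
  by_contra hcon
  rw [not_le] at hcon
  -- A nonempty open set has positive measure, so the exceptional null set is empty.
  have hopen : IsOpen (Ω ∩ W ⁻¹' Ioi 0) :=
    (h.continuousOn.mono subset_closure).isOpen_inter_preimage h.isOpen isOpen_Ioi
  have hpos := hopen.measure_pos volume ⟨z, hz, hcon⟩
  rw [ae_restrict_iff' hΩm] at hae
  refine hpos.ne' (measure_mono_null (fun x hx => ?_) (ae_iff.1 hae))
  intro hx'
  exact absurd (hx' hx.1) (not_le.2 hx.2)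

end IsBoundaryNonpos

end TubeComparison

/-! ### Linearization of the difference of the two solutions. -/

namespace TubeComparison

/-- Mean value inequality; q ≥ 1 keeps the derivative q x^{q-1} bounded down to x = 0, so vanishing
gradients cause no trouble. -/
theorem abs_rpow_sub_rpow_le {q K r s : ℝ} (hq : 1 ≤ q) (hr : r ∈ Icc 0 K) (hs : s ∈ Icc 0 K) :
    |r ^ q - s ^ q| ≤ q * K ^ (q - 1) * |r - s| := by
  refine (convex_Icc (0 : ℝ) K).norm_image_sub_le_of_norm_hasDerivWithin_le
    (f := fun x => x ^ q) (f' := fun x => q * x ^ (q - 1))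
    (fun x _ => (Real.hasDerivAt_rpow_const (Or.inr hq)).hasDerivWithinAt) (fun x hx => ?_) hs hr
  have hx0 := hx.1
  rw [Real.norm_of_nonneg (by positivity)]
  have := Real.rpow_le_rpow hx0 hx.2 (sub_nonneg.2 hq)
  gcongr

theorem inner_gradient {n : ℕ} (ψ : E n → ℝ) (x z : E n) :
    inner ℝ x (gradient ψ z) = fderiv ℝ ψ z x := by
  rw [real_inner_comm, gradient, InnerProductSpace.toDual_symm_apply]

namespace IsRegular

variable {n : ℕ} {Ω : Set (E n)} {K : ℝ} {u : E n → ℝ}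

theorem hasFDerivAt (h : IsRegular Ω K u) (hΩ : IsOpen Ω) {z : E n} (hz : z ∈ Ω) :
    HasFDerivAt u (innerSL ℝ (gradient u z)) z :=
  hasGradientAt_iff_hasFDerivAt.1 (((h.contDiffOn.contDiffAt (hΩ.mem_nhds hz)).differentiableAt
    one_ne_zero).hasGradientAt)

theorem continuousOn_gradient (h : IsRegular Ω K u) (hΩ : IsOpen Ω) :
    ContinuousOn (gradient u) Ω :=
  (LinearIsometryEquiv.continuous _).comp_continuousOn
    (h.contDiffOn.continuousOn_fderiv_of_isOpen hΩ le_rfl)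

theorem isBoundaryNonpos_sub {K' : ℝ} {v : E n → ℝ} (hu : IsRegular Ω K u)
    (hv : IsRegular Ω K' v) (hΩ : IsOpen Ω) (huv : ∀ z ∈ frontier Ω, u z ≤ v z) :
    IsBoundaryNonpos Ω (K + K') (fun z => u z - v z) (fun z => gradient u z - gradient v z) where
  isOpen := hΩ
  contDiffOn := hu.contDiffOn.sub hv.contDiffOn
  continuousOn := hu.continuousOn.sub hv.continuousOn
  hasFDerivAt z hz := by
    rw [map_sub]
    exact (hu.hasFDerivAt hΩ hz).sub (hv.hasFDerivAt hΩ hz)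
  continuousOn_grad := (hu.continuousOn_gradient hΩ).sub (hv.continuousOn_gradient hΩ)
  abs_le z hz := (abs_sub _ _).trans (add_le_add (hu.bound z hz) (hv.bound z hz))
  norm_grad_le z hz :=
    (norm_sub_le _ _).trans (add_le_add (hu.gradient_bound z hz) (hv.gradient_bound z hz))
  nonpos z hz := sub_nonpos.2 (huv z hz)

end IsRegular

theorem IsTestFunction.integrableOn_mul {n : ℕ} {Ω : Set (E n)} {ψ F : E n → ℝ}
    (hψ : IsTestFunction Ω ψ) (hΩ : IsOpen Ω) (hF : LocallyIntegrableOn F Ω) :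
    IntegrableOn (fun z => F z * ψ z) Ω := by
  have h1 : IntegrableOn (fun z => F z * ψ z) (tsupport ψ) :=
    (hF.integrableOn_compact_subset hψ.tsupport_subset hψ.hasCompactSupport.isCompact).mul_continuousOn
      hψ.smooth.continuous.continuousOn hψ.hasCompactSupport.isCompact
  refine h1.of_forall_sdiff_eq_zero hΩ.measurableSet fun z hz => ?_
  rw [image_eq_zero_of_notMem_tsupport hz.2, mul_zero]

theorem IsRegular.integrableOn_weakLHS {n : ℕ} {Ω : Set (E n)} {K Λ q : ℝ} {a u ψ : E n → ℝ}
    (hu : IsRegular Ω K u) (hΩ : IsOpen Ω) (hq : 1 ≤ q) (ha : ContinuousOn a Ω)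
    (hψ : IsTestFunction Ω ψ) :
    IntegrableOn (fun z => a z * inner ℝ (gradient u z) (gradient ψ z) +
      Λ * ‖gradient u z‖ ^ q * ψ z) Ω := by
  simp_rw [inner_gradient]
  have hg := hu.continuousOn_gradient hΩ
  have h1 : Continuous (fderiv ℝ ψ) := hψ.smooth.continuous_fderiv (by simp)
  refine integrableOn_of_continuousOn_of_compact hΩ hψ.hasCompactSupport.isCompact
    hψ.tsupport_subset ?_ fun z hz => ?_
  · exact (ha.mul (h1.continuousOn.clm_apply hg)).add ((continuousOn_const.mul
      (hg.norm.rpow_const fun z _ => Or.inr (by linarith))).mul hψ.smooth.continuous.continuousOn)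
  · rw [fderiv_eq_zero_of_notMem_tsupport hz, image_eq_zero_of_notMem_tsupport hz]
    simp

/-- The difference of a subsolution and a supersolution satisfies a linearized inequality. -/
theorem weakForm_sub_nonpos {n : ℕ} {Ω : Set (E n)} (hΩ : IsOpen Ω) {a : E n → ℝ}
    (ha : ContinuousOn a Ω) {Λ q Ku Kv m : ℝ} (hq : 1 ≤ q) {L : ℝ → ℝ} {f : E n → ℝ → ℝ}
    (hf : IsUniformlyLocallyLipschitz Ω L f) {u v : E n → ℝ} (hu : IsRegular Ω Ku u)
    (hv : IsRegular Ω Kv v) (hsub : IsWeakSubsolution Ω a Λ q f u)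
    (hsup : IsWeakSupersolution Ω a Λ q f v) (hm : 0 < m) (hum : Ku ≤ m) (hvm : Kv ≤ m)
    {ψ : E n → ℝ} (hψ : IsTestFunction Ω ψ) :
    weakForm Ω (fun z => a z • (gradient u z - gradient v z))
      (fun z => |Λ| * (q * m ^ (q - 1)) * ‖gradient u z - gradient v z‖ + |L m| * |u z - v z|) ψ
      ≤ 0 := by
  have hiu := hu.integrableOn_weakLHS (Λ := Λ) hΩ hq ha hψ
  have hiv := hv.integrableOn_weakLHS (Λ := Λ) hΩ hq ha hψ
  have hfu := hψ.integrableOn_mul hΩ hsub.locallyIntegrable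
  have hfv := hψ.integrableOn_mul hΩ hsup.locallyIntegrable
  have h1 := hsub.le ψ hψ
  have h2 := hsup.ge ψ hψ
  have hDc : ContinuousOn (fun z => gradient u z - gradient v z) Ω :=
    (hu.continuousOn_gradient hΩ).sub (hv.continuousOn_gradient hΩ)
  have hWc : ContinuousOn (fun z => u z - v z) Ω :=
    (hu.continuousOn.sub hv.continuousOn).mono subset_closure
  have hψc : Continuous (fderiv ℝ ψ) := hψ.smooth.continuous_fderiv (by simp)
  have hiF : IntegrableOn (fun z => fderiv ℝ ψ z (a z • (gradient u z - gradient v z)) -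
      (|Λ| * (q * m ^ (q - 1)) * ‖gradient u z - gradient v z‖ + |L m| * |u z - v z|) * ψ z) Ω := by
    refine integrableOn_of_continuousOn_of_compact hΩ hψ.hasCompactSupport.isCompact
      hψ.tsupport_subset ?_ fun z hz => ?_
    · exact (hψc.continuousOn.clm_apply (ha.smul hDc)).sub
        (((continuousOn_const.mul hDc.norm).add (continuousOn_const.mul hWc.abs)).mul
          hψ.smooth.continuous.continuousOn)
    · rw [fderiv_eq_zero_of_notMem_tsupport hz, image_eq_zero_of_notMem_tsupport hz]
      simp
  have hle := setIntegral_mono_on hiF ((hiu.sub hiv).sub (hfu.sub hfv)) hΩ.measurableSet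
    fun z hz => ?_
  · refine hle.trans ?_
    have h3 := integral_sub (hiu.sub hiv) (hfu.sub hfv)
    have h4 := integral_sub hiu hiv
    have h5 := integral_sub hfu hfv
    simp only [weakLHS, Pi.sub_apply] at *
    linarith
  · have hu0 := hu.gradient_bound z hz
    have hv0 := hv.gradient_bound z hz
    have h3 : |‖gradient u z‖ ^ q - ‖gradient v z‖ ^ q| ≤
        q * m ^ (q - 1) * ‖gradient u z - gradient v z‖ :=
      (abs_rpow_sub_rpow_le hq ⟨norm_nonneg _, hu0.trans hum⟩ ⟨norm_nonneg _, hv0.trans hvm⟩).trans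
        (mul_le_mul_of_nonneg_left (abs_norm_sub_norm_le _ _) (by positivity))
    -- Only the Lipschitz bound matters here, so the sign of Λ is irrelevant.
    have h4 : -(|Λ| * (q * m ^ (q - 1)) * ‖gradient u z - gradient v z‖) ≤
        Λ * (‖gradient u z‖ ^ q - ‖gradient v z‖ ^ q) := by
      refine neg_le_of_neg_le ((neg_le_abs _).trans ?_)
      rw [abs_mul, mul_assoc]
      exact mul_le_mul_of_nonneg_left h3 (abs_nonneg _)
    have h5 : f z (u z) - f z (v z) ≤ |L m| * |u z - v z| :=
      (le_abs_self _).trans ((hf m hm z hz _ (abs_le.1 ((hu.bound z hz).trans hum)) _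
        (abs_le.1 ((hv.bound z hz).trans hvm))).trans
          (mul_le_mul_of_nonneg_right (le_abs_self _) (abs_nonneg _)))
    have h6 := mul_le_mul_of_nonneg_right (sub_le_sub h4 h5) (hψ.nonneg z)
    simp only [Pi.sub_apply, inner_gradient, map_smul, map_sub, smul_eq_mul]
    linarith

end TubeComparison

/-! ### The comparison theorem and the choice of `ε₀`. -/

open TubeComparison in
/-- The constant `ε₀` depends only on `n`, `k`, `t`, `q`, `Λ`, on the exponent `γ`, on the bounds
`Ca`, `A` for the weight, on the Lipschitz constants `L` of the nonlinearity, on the bounds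
`Ku`, `Kv` for the `W^{1,∞}` norms, and on a radius `ρ` for which `M` has a normal tube. -/
theorem theorem1p1 (n k : ℕ) (hk : 1 ≤ k) (hkn : k ≤ n) (t q Λ γ : ℝ) (ht : (k : ℝ) < t)
    (hq : 1 ≤ q) (hγ : 0 < γ) (Ca A Ku Kv : ℝ) (L : ℝ → ℝ) (ρ : ℝ) :
    ∃ ε₀ > 0, ∀ M : Set (E n),
      IsSmoothSubmanifold (n - k) M → HasNormalTube M ρ →
      HasBoundedAtlas (n - k) M → HasVolumeGrowth (n - k) M γ →
      ∀ ε : ℝ, 0 < ε → ε < ε₀ → HasNormalTube M ε →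
      ∀ Ω : Set (E n), IsSmoothDomain Ω → Ω ⊆ tube M ε →
      ∀ (a : E n → ℝ) (f : E n → ℝ → ℝ) (u v : E n → ℝ),
        IsAdmissibleWeight M ε Ω t Ca A a →
        IsUniformlyLocallyLipschitz Ω L f →
        IsRegular Ω Ku u → IsRegular Ω Kv v →
        IsWeakSubsolution Ω a Λ q f u → IsWeakSupersolution Ω a Λ q f v →
        (∀ z ∈ frontier Ω, u z ≤ v z) →
        ∀ z ∈ Ω, u z ≤ v z := by
  -- A common bound for the two functions and their gradients; the summand 1 makes it positive, as
  -- the Lipschitz condition on f requires.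
  let m : ℝ := |Ku| + |Kv| + 1
  have hm : 0 < m := by positivity
  have hum : Ku ≤ m := by linarith [le_abs_self Ku, abs_nonneg Kv]
  have hvm : Kv ≤ m := by linarith [le_abs_self Kv, abs_nonneg Ku]
  let c : ℝ := |Λ| * (q * m ^ (q - 1))
  have hc : 0 ≤ c := by positivity
  have hA : 0 ≤ |A| := abs_nonneg A
  let s : ℝ := 16 * (c ^ 2 / 4 + |L m| * |A|)
  have hs : 0 ≤ s := by positivity
  -- The Poincaré constant η = 1/(s + 1) satisfies both η ≤ 1 and ηs ≤ 1, the latter being the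
  -- absorption condition of `nonpos_of_weak`. It depends on the data only through s, so `ε₀` is
  -- fixed before M, Ω and the functions.
  have hη : 0 < 1 / (s + 1) := by positivity
  obtain ⟨ε₀, hε₀, hP⟩ := exists_radius_tube_poincare hk hkn ht Ca A ρ hη
  refine ⟨ε₀, hε₀, ?_⟩
  intro M hMs hMρ _ _ ε _ hε _ Ω hΩ hΩt a f u v ha hf hu hv hsub hsup huv z hz
  obtain ⟨hapos, hpoinc⟩ := hP M hMs hMρ ε hε Ω hΩ.isOpen hΩt a ha
  have hac : ContinuousOn a Ω := ha.continuousOn.mono subset_closure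
  refine sub_nonpos.1 ((hu.isBoundaryNonpos_sub hv hΩ.isOpen huv).nonpos_of_weak (hk.trans hkn)
    (η := 1 / (s + 1)) (c := c) (l := |L m|) hA hη.le ?_ ?_
    (fun z hz => ⟨ha.nonneg z (subset_closure hz), (ha.le z hz).trans (le_abs_self A)⟩) hac hc
    (abs_nonneg _) hapos hpoinc
    (fun ψ hψ => weakForm_sub_nonpos hΩ.isOpen hac hq hf hu hv hsub hsup hm hum hvm hψ) z hz)
  · rw [div_le_one (by positivity)]
    linarith
  · have : 16 * (1 / (s + 1)) * (c ^ 2 / 4 + |L m| * |A|) = s / (s + 1) := by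
      simp only [s]
      ring
    rw [this, div_le_one (by positivity)]
    linarith
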